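/- Let $R$ be a commutative ring with $1$, let $m\ge 1$ and $r\ge 0$ be integers, let $q\in R$ be invertible and $u_1,\dots,u_m\in R$. Let $H=H_m^r$ be the Ariki--Koike algebra: the associative unital $R$-algebra with generators $T_0,\dots,T_{r-1}$ and relations $T_0T_1T_0T_1=T_1T_0T_1T_0$; $T_iT_{i+1}T_i=T_{i+1}T_iT_{i+1}$ for $1\le i\le r-2$; $T_iT_j=T_jT_i$ for $|i-j|\ge 2$; $(T_i-q)(T_i+1)=0$ for $i\ne 0$; $(T_0-u_1)\cdots(T_0-u_m)=0$. Let $\mathfrak S_r$ act on $\{1,\dots,r\}$ from the right, let $s_i=(i,i+1)$, and put $T_w=T_{i_1}\cdots T_{i_k}$ for a reduced expression $w=s_{i_1}\cdots s_{i_k}$. Put $L_1=T_0$, $L_i=q^{-1}T_{i-1}L_{i-1}T_{i-1}$ for $2\le i\le r$, and $\pi_n(x)=\prod_{j=1}^n(L_j-x)$ for $0\le n\le r$, $x\in R$ (so $\pi_0(x)=1$). Let $\Lambda[m,r]$ be the set of integer sequences $a=[a_0,\dots,a_m]$ with $0=a_0\le a_1\le\cdots\le a_m=r$. For $a\in\Lambda[m,r]$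 put $a'=[0,r-a_{m-1},\dots,r-a_1,r]$, let $\mathfrak S_a=\mathfrak S_{\{1,\dots,a_1\}}\times\cdots\times\mathfrak S_{\{a_{m-1}+1,\dots,a_m\}}$, let $\mathcal H(\mathfrak S_a)\subseteq H$ be the subalgebra generated by the $T_i$ ($1\le i\le r-1$) with $s_i\in\mathfrak S_a$, and let $w_a\in\mathfrak S_r$ be given by $(a_{i-1}+l)w_a=r-a_i+l$ for $1\le l\le a_i-a_{i-1}$. Let $\pi_a=\pi_{a_1}(u_2)\cdots\pi_{a_{m-1}}(u_m)$, $\tilde\pi_a=\pi_{a_1}(u_{m-1})\cdots\pi_{a_{m-1}}(u_1)$ and $v_a=\pi_aT_{w_a}\tilde\pi_{a'}$. For every $a\in\Lambda[m,r]$ there is exactly one element $z_a\in\mathcal H(\mathfrak S_a)$ with $v_aT_{w_{a'}}v_a=z_av_a$. If $z_a$ is invertible, put $e_a=v_aT_{w_{a'}}z_a^{-1}$. Then: (1) If $a,b\in\Lambda[m,r]$ are such that $z_a$ and $z_b$ are invertible and $a\ne b$, then $e_aHe_b=0$. (2) If $z_a$ is invertible, then $e_a$ is an idempotent and $e_aHe_a\cong\mathcal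 H(\mathfrak S_a)$ as $R$-algebras. (3) If $z_a$ is invertible for all $a\in\Lambda[m,r]$, then $\varepsilon=\sum_{a\in\Lambda[m,r]}e_a$ is an idempotent and $\varepsilon H\varepsilon\cong\bigoplus_{a\in\Lambda[m,r]}\mathcal H(\mathfrak S_a)$ as $R$-algebras. -/

import Mathlib

/-! ### Corner algebras -/

/-- The corner `e A e` of an `R`-algebra `A` at an idempotent `e` (with unit `e`) is an
`R`-algebra, the scalars acting as they do on `A`. -/
instance cornerAlgebra {R A : Type*} [CommRing R] [Ring A] [Algebra R A] {e : A}
    (idem : IsIdempotentElem e) : Algebra R idem.Corner :=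
  letI : Module R idem.Corner :=
    { smul := fun c x => ⟨c • x.1, by
        obtain ⟨y, hy⟩ := x.2
        refine ⟨c • y, ?_⟩
        have hy' : e * y * e = x.1 := hy
        simp only [mul_smul_comm, smul_mul_assoc, hy']⟩
      one_smul := fun x => Subtype.ext (one_smul R x.1)
      mul_smul := fun c d x => Subtype.ext (mul_smul c d x.1)
      smul_zero := fun c => Subtype.ext (smul_zero (A := A) c)
      smul_add := fun c x y => Subtype.ext (smul_add c x.1 y.1)
      add_smul := fun c d x => Subtype.ext (add_smul c d x.1)
      zero_smul := fun x => Subtype.ext (zero_smul R x.1) }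
  Algebra.ofModule (fun c x y => Subtype.ext (smul_mul_assoc c x.1 y.1))
    (fun c x y => Subtype.ext (mul_smul_comm c x.1 y.1))

namespace ArikiKoike

/-! ### Permutations and reduced words

A permutation `w` of the `r` letters `0, …, r-1` (the usual `1, …, r` shifted by one) is
thought of as acting from the right, `(i)w = w i`; so the product "first `v`, then `w`" is
`w * v` in Mathlib's convention. -/

/-- The basic transposition `s_k = (k, k+1)` for `1 ≤ k < r`; on the zero-based letters it
exchanges `k-1` and `k`. For `k` outside `1 ≤ k < r` it is the identity (never used). -/
def simpleRefl (r k : ℕ) : Equiv.Perm (Fin r) :=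
  if h : 1 ≤ k ∧ k < r then Equiv.swap ⟨k - 1, by omega⟩ ⟨k, h.2⟩ else 1

/-- The product `s_{k₁} s_{k₂} ⋯ s_{kₙ}` of permutations acting from the right
(first `s_{k₁}`, then `s_{k₂}`, and so on). -/
def wordPerm (r : ℕ) : List ℕ → Equiv.Perm (Fin r)
  | [] => 1
  | k :: l => wordPerm r l * simpleRefl r k

/-- `l(w) = #{(i, j) : i < j, (i)w > (j)w}`. -/
def inversions {r : ℕ} (w : Equiv.Perm (Fin r)) : ℕ :=
  ((Finset.univ : Finset (Fin r × Fin r)).filter fun p => p.1 < p.2 ∧ w p.2 < w p.1).card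

/-- `(k)w > (k+1)w` (one-based letters), that is `l(s_k w) < l(w)`. -/
def IsDescent {r : ℕ} (w : Equiv.Perm (Fin r)) (k : ℕ) : Prop :=
  ∃ h : 1 ≤ k ∧ k < r, w ⟨k, h.2⟩ < w ⟨k - 1, by omega⟩

theorem simpleRefl_mul_self (r k : ℕ) : simpleRefl r k * simpleRefl r k = 1 := by
  unfold simpleRefl
  split_ifs <;> simp

/-- A basic transposition preserves the order of every pair other than `(k-1, k)`. -/
theorem simpleRefl_lt {r k : ℕ} (hk : 1 ≤ k ∧ k < r) {i j : Fin r} (hij : i < j)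
    (hne : ¬ (i.val = k - 1 ∧ j.val = k)) : simpleRefl r k i < simpleRefl r k j := by
  have hij' : i.val < j.val := hij
  have val : ∀ x : Fin r, (simpleRefl r k x).val =
      if x.val = k - 1 then k else if x.val = k then k - 1 else x.val := by
    intro x
    simp only [simpleRefl, dif_pos hk, Equiv.swap_apply_def, Fin.ext_iff]
    split_ifs <;> rfl
  rw [Fin.lt_def, val, val]
  split_ifs <;> omega

theorem inversions_mul_le {r k : ℕ} (w : Equiv.Perm (Fin r)) :
    inversions w ≤ inversions (w * simpleRefl r k) + 1 := by
  by_cases hk : 1 ≤ k ∧ k < r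
  · unfold inversions
    let p₀ : Fin r × Fin r := (⟨k - 1, by omega⟩, ⟨k, hk.2⟩)
    refine le_trans (Finset.card_le_card_sdiff_add_card (t := {p₀})) ?_
    rw [Finset.card_singleton]
    refine Nat.add_le_add_right (Finset.card_le_card_of_injOn
      (fun p => (simpleRefl r k p.1, simpleRefl r k p.2)) ?_ ?_) 1
    · intro p hp
      rw [Finset.mem_coe, Finset.mem_sdiff, Finset.mem_filter, Finset.mem_singleton] at hp
      obtain ⟨⟨-, h1, h2⟩, h3⟩ := hp
      have hs : ∀ x, simpleRefl r k (simpleRefl r k x) = x := fun x => by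
        rw [← Equiv.Perm.mul_apply, simpleRefl_mul_self, Equiv.Perm.one_apply]
      rw [Finset.mem_coe, Finset.mem_filter]
      simp only [Equiv.Perm.mul_apply, hs]
      refine ⟨Finset.mem_univ _, simpleRefl_lt hk h1 ?_, h2⟩
      rintro ⟨h4, h5⟩
      exact h3 (Prod.ext (Fin.ext h4) (Fin.ext h5))
    · intro p _ p' _ h
      simp only [Prod.mk.injEq, EmbeddingLike.apply_eq_iff_eq] at h
      exact Prod.ext h.1 h.2
  · have : simpleRefl r k = 1 := by simp [simpleRefl, hk]
    rw [this, mul_one]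
    exact Nat.le_succ _

theorem inversions_lt {r k : ℕ} {w : Equiv.Perm (Fin r)} (hk : IsDescent w k) :
    inversions (w * simpleRefl r k) < inversions w := by
  obtain ⟨hk, hd⟩ := hk
  have hs : ∀ x, simpleRefl r k (simpleRefl r k x) = x := fun x => by
    rw [← Equiv.Perm.mul_apply, simpleRefl_mul_self, Equiv.Perm.one_apply]
  have hs0 : simpleRefl r k ⟨k - 1, by omega⟩ = ⟨k, hk.2⟩ := by
    simp [simpleRefl, hk]
  have hs1 : simpleRefl r k ⟨k, hk.2⟩ = ⟨k - 1, by omega⟩ := by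
    simp [simpleRefl, hk]
  unfold inversions
  let p₀ : Fin r × Fin r := (⟨k - 1, by omega⟩, ⟨k, hk.2⟩)
  have hp₀ : p₀ ∈ (Finset.univ : Finset (Fin r × Fin r)).filter
      fun p => p.1 < p.2 ∧ w p.2 < w p.1 := by
    simp only [Finset.mem_filter, Finset.mem_univ, true_and]
    exact ⟨by rw [Fin.lt_def]; show k - 1 < k; omega, hd⟩
  refine lt_of_le_of_lt ?_ (Finset.card_erase_lt_of_mem hp₀)
  refine Finset.card_le_card_of_injOn (fun p => (simpleRefl r k p.1, simpleRefl r k p.2)) ?_ ?_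
  · intro p hp
    rw [Finset.mem_coe, Finset.mem_filter] at hp
    obtain ⟨-, h1, h2⟩ := hp
    simp only [Equiv.Perm.mul_apply] at h2
    have hne : ¬ (p.1.val = k - 1 ∧ p.2.val = k) := by
      rintro ⟨h4, h5⟩
      have e1 : p.1 = ⟨k - 1, by omega⟩ := Fin.ext h4
      have e2 : p.2 = ⟨k, hk.2⟩ := Fin.ext h5
      rw [e1, e2, hs0, hs1] at h2
      exact absurd hd (not_lt.mpr h2.le)
    have hlt := simpleRefl_lt hk h1 hne
    rw [Finset.mem_coe, Finset.mem_erase, Finset.mem_filter]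
    refine ⟨fun h => ?_, Finset.mem_univ _, hlt, h2⟩
    have e1 : simpleRefl r k p.1 = ⟨k - 1, by omega⟩ := congrArg Prod.fst h
    have e2 : simpleRefl r k p.2 = ⟨k, hk.2⟩ := congrArg Prod.snd h
    have f1 : p.1 = ⟨k, hk.2⟩ := by rw [← hs p.1, e1, hs0]
    have f2 : p.2 = ⟨k - 1, by omega⟩ := by rw [← hs p.2, e2, hs1]
    rw [f1, f2, Fin.lt_def] at h1
    simp only at h1
    omega
  · intro p _ p' _ h
    simp only [Prod.mk.injEq, EmbeddingLike.apply_eq_iff_eq] at h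
    exact Prod.ext h.1 h.2

open Classical in
/-- A reduced word `k₁, …, kₙ` of `w = s_{k₁} ⋯ s_{kₙ}`, obtained by removing left descents. -/
noncomputable def reducedWord {r : ℕ} (w : Equiv.Perm (Fin r)) : List ℕ :=
  if h : ∃ k, IsDescent w k then h.choose :: reducedWord (w * simpleRefl r h.choose) else []
termination_by inversions w
decreasing_by exact inversions_lt h.choose_spec

/-- The word `reducedWord w` represents `w`. -/
theorem wordPerm_reducedWord {r : ℕ} (w : Equiv.Perm (Fin r)) :
    wordPerm r (reducedWord w) = w := by
  induction hn : inversions w using Nat.strong_induction_on generalizing w with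
  | _ n ih =>
    rw [reducedWord]
    split_ifs with h
    · rw [wordPerm, ih _ (hn ▸ inversions_lt h.choose_spec) _ rfl, mul_assoc,
        simpleRefl_mul_self, mul_one]
    · have hmono : StrictMono w := by
        cases r with
        | zero => exact fun i => i.elim0
        | succ r =>
          rw [Fin.strictMono_iff_lt_succ]
          intro i
          by_contra hi
          apply h
          refine ⟨i.val + 1, ⟨by omega, by omega⟩, ?_⟩
          have hle : w i.succ ≤ w i.castSucc := not_lt.mp hi
          refine lt_of_le_of_ne hle fun heq => ?_
          have := congrArg Fin.val (w.injective heq)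
          simp at this
      ext i
      have := Subsingleton.elim (StrictMono.orderIsoOfSurjective w hmono w.surjective)
        (OrderIso.refl (Fin r))
      have := congrArg (fun f => (f i).val) this
      simpa [wordPerm] using this.symm

/-- The word `reducedWord w` is as short as any expression of `w`. -/
theorem length_reducedWord_le {r : ℕ} (w : Equiv.Perm (Fin r)) (l : List ℕ)
    (hl : wordPerm r l = w) : (reducedWord w).length ≤ l.length := by
  have h1 : ∀ n, ∀ w : Equiv.Perm (Fin r), inversions w = n →
      (reducedWord w).length ≤ inversions w := by
    intro n
    induction n using Nat.strong_induction_on with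
    | _ n ih =>
      intro w hn
      rw [reducedWord]
      split_ifs with h
      · have hlt := inversions_lt h.choose_spec
        have := ih _ (hn ▸ hlt) _ rfl
        rw [List.length_cons]
        omega
      · simp
  have h2 : ∀ l : List ℕ, inversions (wordPerm r l) ≤ l.length := by
    intro l
    induction l with
    | nil =>
      simp only [wordPerm, inversions, Equiv.Perm.one_apply, List.length_nil, Nat.le_zero,
        Finset.card_eq_zero]
      refine Finset.filter_eq_empty_iff.mpr ?_
      intro p _ hp
      exact absurd hp.1 (not_lt.mpr hp.2.le)
    | cons k l ih =>
      have := inversions_mul_le (k := k) (wordPerm r (k :: l))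
      rw [wordPerm, mul_assoc, simpleRefl_mul_self, mul_one] at this
      rw [wordPerm, List.length_cons]
      omega
  exact (h1 _ w rfl).trans (hl ▸ h2 l)

/-! ### The set `Λ[m, r]` -/

/-- `Λ[m, r]`: the sequences `[a_0, …, a_m]` of integers with
`0 = a_0 ≤ a_1 ≤ ⋯ ≤ a_m = r`. Such a sequence is stored as a function on `ℕ` by continuing it
with the constant value `r`, so that there is exactly one function for each sequence. -/
@[ext]
structure Lam (m r : ℕ) where
  /-- the entries `a_i` -/
  seq : ℕ → ℕ
  zero : seq 0 = 0
  mono : Monotone seq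
  top : ∀ i, m ≤ i → seq i = r

namespace Lam

variable {m r : ℕ}

theorem le_top (a : Lam m r) (i : ℕ) : a.seq i ≤ r := by
  have h1 := a.mono (le_max_left i m)
  rwa [a.top _ (le_max_right i m)] at h1

instance : Finite (Lam m r) := by
  refine Finite.of_injective
    (fun (a : Lam m r) (i : Fin m) => (⟨a.seq i, Nat.lt_succ_of_le (a.le_top i)⟩ : Fin (r + 1)))
    fun a b h => ?_
  ext i
  by_cases hi : i < m
  · exact congrArg Fin.val (congrFun h ⟨i, hi⟩)
  · rw [a.top i (not_lt.mp hi), b.top i (not_lt.mp hi)]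

noncomputable instance : Fintype (Lam m r) := Fintype.ofFinite _

/-- `a' = [0, r - a_{m-1}, …, r - a_1, r]`. -/
def dual (a : Lam m r) : Lam m r where
  seq i := r - a.seq (m - i)
  zero := by simp [a.top m le_rfl]
  mono := fun i j h => Nat.sub_le_sub_left (a.mono (by omega)) r
  top := fun i h => by simp [Nat.sub_eq_zero_of_le h, a.zero]

theorem exists_lt (a : Lam m r) (p : Fin r) : ∃ i, p.val < a.seq i :=
  ⟨m, by rw [a.top m le_rfl]; exact p.2⟩

/-- The index `i ≥ 1` of the block `a_{i-1} ≤ p < a_i` of a zero-based letter `p`. -/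
def block (a : Lam m r) (p : Fin r) : ℕ := Nat.find (a.exists_lt p)

theorem block_spec (a : Lam m r) (p : Fin r) :
    1 ≤ a.block p ∧ a.seq (a.block p - 1) ≤ p.val ∧ p.val < a.seq (a.block p) := by
  have h := Nat.find_spec (a.exists_lt p)
  have h0 : 1 ≤ a.block p := by
    by_contra hc
    have : a.block p = 0 := by omega
    unfold block at this
    rw [this, a.zero] at h
    omega
  refine ⟨h0, ?_, h⟩
  exact not_lt.mp (Nat.find_min (a.exists_lt p) (m := a.block p - 1)
    (show a.block p - 1 < a.block p by omega))

/-- The permutation `w_a`, given on one-based letters by `(a_{i-1} + l) w_a = r - a_i + l` for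
`1 ≤ l ≤ a_i - a_{i-1}`; so on zero-based letters
`p ↦ (r - a_i) + (p - a_{i-1})` for `a_{i-1} ≤ p < a_i`. -/
noncomputable def perm (a : Lam m r) : Equiv.Perm (Fin r) :=
  Equiv.ofBijective
    (fun p => ⟨(r - a.seq (a.block p)) + (p.val - a.seq (a.block p - 1)), by
      have h := a.block_spec p
      have := a.le_top (a.block p)
      omega⟩)
    (Finite.injective_iff_bijective.mp (by
      have key : ∀ p q : Fin r, a.block p < a.block q →
          (r - a.seq (a.block q)) + (q.val - a.seq (a.block q - 1)) <
          (r - a.seq (a.block p)) + (p.val - a.seq (a.block p - 1)) := by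
        intro p q hpq
        have hp := a.block_spec p
        have hq := a.block_spec q
        have h1 := a.le_top (a.block q)
        have h2 : a.seq (a.block p) ≤ a.seq (a.block q - 1) := a.mono (by omega)
        omega
      intro p q h
      have h' := congrArg Fin.val h
      simp only at h'
      rcases lt_trichotomy (a.block p) (a.block q) with hlt | heq | hgt
      · have := key p q hlt
        omega
      · have hp := a.block_spec p
        have hq := a.block_spec q
        rw [heq] at h' hp
        exact Fin.ext (by omega)
      · have := key q p hgt
        omega))

end Lam

/-! ### The Ariki-Koike algebra -/

section Algebra

variable {R : Type*} [CommRing R]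

/-- The defining relations of the Ariki-Koike algebra with generators `T_0, …, T_{r-1}` and
parameters `q`, `u_1, …, u_m` (`u k` is `u_{k+1}`). -/
inductive Rel (m r : ℕ) (q : Rˣ) (u : Fin m → R) :
    FreeAlgebra R (Fin r) → FreeAlgebra R (Fin r) → Prop
  | braid_four (i j : Fin r) (hi : i.val = 0) (hj : j.val = 1) :
      Rel m r q u
        (FreeAlgebra.ι R i * FreeAlgebra.ι R j * FreeAlgebra.ι R i * FreeAlgebra.ι R j)
        (FreeAlgebra.ι R j * FreeAlgebra.ι R i * FreeAlgebra.ι R j * FreeAlgebra.ι R i)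
  | braid_three (i j : Fin r) (hi : 1 ≤ i.val) (hj : j.val = i.val + 1) :
      Rel m r q u
        (FreeAlgebra.ι R i * FreeAlgebra.ι R j * FreeAlgebra.ι R i)
        (FreeAlgebra.ι R j * FreeAlgebra.ι R i * FreeAlgebra.ι R j)
  | comm (i j : Fin r) (hij : i.val + 2 ≤ j.val) :
      Rel m r q u
        (FreeAlgebra.ι R i * FreeAlgebra.ι R j)
        (FreeAlgebra.ι R j * FreeAlgebra.ι R i)
  | quadratic (i : Fin r) (hi : i.val ≠ 0) :
      Rel m r q u
        ((FreeAlgebra.ι R i - algebraMap R _ (q : R)) * (FreeAlgebra.ι R i + 1)) 0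
  | cyclotomic (i : Fin r) (hi : i.val = 0) :
      Rel m r q u
        (((List.finRange m).map fun k => FreeAlgebra.ι R i - algebraMap R _ (u k)).prod) 0

/-- The Ariki-Koike algebra `H = H_m^r` over `R` with parameters `q`, `u_1, …, u_m`. -/
abbrev AK (m r : ℕ) (q : Rˣ) (u : Fin m → R) : Type _ := RingQuot (Rel m r q u)

variable {m r : ℕ} (q : Rˣ) (u : Fin m → R)

/-- The generator `T_i`, for `0 ≤ i ≤ r - 1` (and `0` for other `i`, which are never used). -/
def gen (r : ℕ) (i : ℕ) : AK m r q u :=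
  if h : i < r then RingQuot.mkAlgHom R (Rel m r q u) (FreeAlgebra.ι R ⟨i, h⟩) else 0

/-- `L_1 = T_0` and `L_i = q⁻¹ T_{i-1} L_{i-1} T_{i-1}` for `i ≥ 2` (index `0` is unused). -/
def jm (r : ℕ) : ℕ → AK m r q u
  | 0 => 0
  | 1 => gen q u r 0
  | i + 2 => ((q⁻¹ : Rˣ) : R) • (gen q u r (i + 1) * jm r (i + 1) * gen q u r (i + 1))

/-- `T_w = T_{k₁} ⋯ T_{kₙ}` for a reduced expression `w = s_{k₁} ⋯ s_{kₙ}`. -/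
noncomputable def T (w : Equiv.Perm (Fin r)) : AK m r q u :=
  ((reducedWord w).map (gen q u r)).prod

/-- `π_n(x) = (L_1 - x) ⋯ (L_n - x)`. -/
def piOne (r n : ℕ) (x : R) : AK m r q u :=
  ((List.range n).map fun j => jm q u r (j + 1) - algebraMap R _ x).prod

/-- `π_a = π_{a_1}(u_2) ⋯ π_{a_{m-1}}(u_m)`. With `u i = u_{i+1}` the factor of index `i` is
`π_{a_i}(u_{i+1})`; the factor of index `i = 0` is `π_0(u_1) = 1`. -/
def piElt (a : Lam m r) : AK m r q u :=
  ((List.finRange m).map fun i : Fin m => piOne q u r (a.seq i) (u i)).prod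

/-- `π̃_a = π_{a_1}(u_{m-1}) ⋯ π_{a_{m-1}}(u_1)`. With `u i = u_{i+1}` the factor of index `i` is
`π_{a_i}(u_{m-i})`; the factor of index `i = 0` is `π_0(u_m) = 1`. -/
def piTilde (a : Lam m r) : AK m r q u :=
  ((List.finRange m).map fun i : Fin m => piOne q u r (a.seq i) (u i.rev)).prod

/-- `v_a = π_a T_{w_a} π̃_{a'}`. -/
noncomputable def vElt (a : Lam m r) : AK m r q u :=
  piElt q u a * T q u a.perm * piTilde q u a.dual

/-- The subalgebra of `H` belonging to the Young subgroup
`S_a = S_{{1, …, a_1}} × ⋯ × S_{{a_{m-1}+1, …, a_m}}`: it is generated by the `T_k` with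
`1 ≤ k < r` and `s_k ∈ S_a`, that is, `k` is none of the `a_j`. -/
def young (a : Lam m r) : Subalgebra R (AK m r q u) :=
  Algebra.adjoin R {x | ∃ k, 1 ≤ k ∧ k < r ∧ (∀ j, a.seq j ≠ k) ∧ x = gen q u r k}

/-- `z` is an element of the subalgebra of `S_a` with `v_a T_{w_{a'}} v_a = z v_a`. -/
def IsZ (a : Lam m r) (z : AK m r q u) : Prop :=
  z ∈ young q u a ∧ vElt q u a * T q u a.dual.perm * vElt q u a = z * vElt q u a

/-- The element `z_a`: the element of the subalgebra of `S_a` with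
`v_a T_{w_{a'}} v_a = z_a v_a`. -/
noncomputable def zElt (a : Lam m r) : AK m r q u := Classical.epsilon (IsZ q u a)

/-- `e_a = v_a T_{w_{a'}} z_a⁻¹` (meaningful when `z_a` is invertible). -/
noncomputable def eElt (a : Lam m r) : AK m r q u :=
  vElt q u a * T q u a.dual.perm * Ring.inverse (zElt q u a)

end Algebra

end ArikiKoike

namespace ArikiKoike

section Relations

variable {R : Type*} [CommRing R] {m : ℕ} (q : Rˣ) (u : Fin m → R) (r : ℕ)

/-! ### Relations between the generators -/

/-! Everything follows from three facts: (i) v_a H v_b = 0 for a ≠ b; (ii) v_a H v_a lies in H(S_a)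
v_a; (iii) y v_a = 0 with y in H(S_a) forces y = 0. Existence of z_a is (ii), uniqueness is (iii).
Put f = v_a T_{w_{a'}}. Then f² = z_a f, and H(S_a) commutes with f, so (iii) makes z_a central in
H(S_a). If z_a is invertible, e_a = f z_a⁻¹ is therefore an idempotent commuting with H(S_a), with
e_a H e_a = H(S_a) e_a, and y ↦ y e_a is the required isomorphism. By (i) the e_a are orthogonal,
which gives the statement for the sum.

For (i) and (ii), H is spanned by the products T_w f(L_1, …, L_r) (`span_T_mul_jmPoly`), and the key
is the vanishing lemma `stair_mul_T_mul_stair`. It strips T_w down to the case where w fixes the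
first letter; then all factors of the cyclotomic relation can be brought together. For a ≠ b a
pigeonhole argument meets its hypothesis for every w (`vElt_mul_mul_vElt_of_ne`). For a = b the only
surviving w send the first a_i letters to the last a_i letters for all i, and for these T_w lies in
H(S_a) T_{w_a}. The polynomial factor is absorbed since v_a L_j lies in H(S_a) v_a
(`piElt_mul_mul_piTilde_dual_mem`).

Fact (iii) is the long part, and is proved without a basis theorem for H. For m ≥ 2 over a
nontrivial ring, `exists_topFunctional` builds a linear map φ on H that commutes with left
multiplication by T_1, …, T_{r-1}, kills everything of degree below r(m-1) in T_0, and takes a unit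
value at every v_a. Then y v_a = 0 gives y φ(v_a) = 0, hence y = 0.

The map φ is built by induction on r. The algebra H_m^{r+1} acts on a sum of r+1 copies of
R[x]/((x-u_1)⋯(x-u_m)) ⊗ H_m^r, where x^n ⊗ h in copy k models T_k⋯T_1 T_0^n T_1⋯T_r h. The defining
relations are checked directly; the hard ones are `act_braid_four` and `act_cyclotomic`. Reading off
the coefficient of x^{m-1} and applying the old functional gives the new one (`exists_extension`).
Its value at v_a is compared in `isUnit_apply_vElt` with the old value at the sequence whose nonzero
entries are lowered by 1; only top-degree terms in T_0 matter there. -/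

theorem gen_of_le {i : ℕ} (h : r ≤ i) : gen q u r i = 0 := by
  rw [gen, dif_neg (by omega)]

theorem gen_of_lt {i : ℕ} (h : i < r) :
    gen q u r i = RingQuot.mkAlgHom R (Rel m r q u) (FreeAlgebra.ι R ⟨i, h⟩) := by
  rw [gen, dif_pos h]

theorem gen_comm {i j : ℕ} (h : i + 2 ≤ j) : Commute (gen q u r i) (gen q u r j) := by
  by_cases hj : j < r
  · have hi : i < r := by omega
    rw [gen_of_lt q u r hi, gen_of_lt q u r hj]
    have := RingQuot.mkAlgHom_rel R (Rel.comm (m := m) (q := q) (u := u) ⟨i, hi⟩ ⟨j, hj⟩ h)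
    rw [map_mul, map_mul] at this
    exact this
  · rw [gen_of_le q u r (not_lt.mp hj)]
    exact Commute.zero_right _

theorem gen_braid {i : ℕ} (h : 1 ≤ i) :
    gen q u r i * gen q u r (i + 1) * gen q u r i =
      gen q u r (i + 1) * gen q u r i * gen q u r (i + 1) := by
  by_cases hj : i + 1 < r
  · have hi : i < r := by omega
    rw [gen_of_lt q u r hi, gen_of_lt q u r hj]
    have := RingQuot.mkAlgHom_rel R
      (Rel.braid_three (m := m) (q := q) (u := u) ⟨i, hi⟩ ⟨i + 1, hj⟩ h rfl)
    simpa only [map_mul] using this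
  · rw [gen_of_le q u r (not_lt.mp hj)]
    simp

theorem gen_braid_four :
    gen q u r 0 * gen q u r 1 * gen q u r 0 * gen q u r 1 =
      gen q u r 1 * gen q u r 0 * gen q u r 1 * gen q u r 0 := by
  by_cases hj : 1 < r
  · have hi : 0 < r := by omega
    rw [gen_of_lt q u r hi, gen_of_lt q u r hj]
    have := RingQuot.mkAlgHom_rel R
      (Rel.braid_four (m := m) (q := q) (u := u) ⟨0, hi⟩ ⟨1, hj⟩ rfl rfl)
    simpa only [map_mul] using this
  · rw [gen_of_le q u r (not_lt.mp hj)]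
    simp

theorem gen_mul_self {i : ℕ} (h1 : 1 ≤ i) (h2 : i < r) :
    gen q u r i * gen q u r i = ((q : R) - 1) • gen q u r i + (q : R) • 1 := by
  have := RingQuot.mkAlgHom_rel R
      (Rel.quadratic (m := m) (q := q) (u := u) ⟨i, h2⟩ (by simpa using Nat.one_le_iff_ne_zero.mp h1))
  rw [map_mul, map_sub, map_add, map_one, AlgHom.commutes, map_zero, ← gen_of_lt q u r h2,
    Algebra.algebraMap_eq_smul_one] at this
  rw [← sub_eq_zero, ← this]
  have e : ((q : R) - 1) • gen q u r i = (q : R) • gen q u r i - (1 : R) • gen q u r i :=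
    @sub_smul R (AK m r q u) _ _ _ _ _ _
  rw [e, sub_mul, mul_add, smul_mul_assoc, one_mul, mul_one, one_smul, smul_add]
  abel

theorem gen_cyclotomic (h : 0 < r) :
    ((List.finRange m).map fun k => gen q u r 0 - algebraMap R (AK m r q u) (u k)).prod = 0 := by
  have := RingQuot.mkAlgHom_rel R
      (Rel.cyclotomic (m := m) (q := q) (u := u) ⟨0, h⟩ rfl)
  rw [map_list_prod, map_zero, List.map_map] at this
  rw [← this, gen_of_lt q u r h]
  congr 1
  refine List.map_congr_left fun k _ => ?_
  rw [Function.comp_apply, map_sub, AlgHom.commutes]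

theorem adjoin_gen : Algebra.adjoin R (Set.range (gen q u r)) = ⊤ := by
  rw [eq_top_iff]
  rintro x -
  obtain ⟨y, rfl⟩ := RingQuot.mkAlgHom_surjective R (Rel m r q u) x
  induction y using FreeAlgebra.induction with
  | grade0 c => rw [AlgHom.commutes]; exact Subalgebra.algebraMap_mem _ _
  | grade1 i =>
    rw [← gen_of_lt q u r i.2]
    exact Algebra.subset_adjoin ⟨_, rfl⟩
  | mul a b ha hb => rw [map_mul]; exact mul_mem ha hb
  | add a b ha hb => rw [map_add]; exact add_mem ha hb

/-- A submodule containing `1` and stable under left multiplication by the generators is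
everything. -/
theorem eq_top_of_gen_mul_mem {S : Submodule R (AK m r q u)} (h1 : 1 ∈ S)
    (h : ∀ i < r, ∀ x ∈ S, gen q u r i * x ∈ S) : S = ⊤ := by
  rw [eq_top_iff]
  have key : ∀ y ∈ Algebra.adjoin R (Set.range (gen q u r)), ∀ x ∈ S, y * x ∈ S := by
    intro y hy
    induction hy using Algebra.adjoin_induction with
    | mem y hy =>
      obtain ⟨i, rfl⟩ := hy
      intro x hx
      by_cases hi : i < r
      · exact h i hi x hx
      · rw [gen_of_le q u r (not_lt.mp hi), zero_mul]; exact zero_mem _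
    | algebraMap c =>
      intro x hx
      rw [← Algebra.smul_def]
      exact S.smul_mem c hx
    | add a b _ _ ha hb => intro x hx; rw [add_mul]; exact add_mem (ha x hx) (hb x hx)
    | mul a b _ _ ha hb => intro x hx; rw [mul_assoc]; exact ha _ (hb x hx)
  rintro x -
  simpa using key x (by rw [adjoin_gen]; trivial) 1 h1

/-! ### Inverses of the generators -/

/-- The inverse of `T_i` for `1 ≤ i < r`. -/
def genInv (i : ℕ) : AK m r q u :=
  ((q⁻¹ : Rˣ) : R) • (gen q u r i - ((q : R) - 1) • 1)

theorem gen_mul_genInv {i : ℕ} (h1 : 1 ≤ i) (h2 : i < r) : gen q u r i * genInv q u r i = 1 := by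
  rw [genInv, mul_smul_comm, mul_sub, gen_mul_self q u r h1 h2, mul_smul_comm, mul_one,
    add_sub_cancel_left, smul_smul, Units.inv_mul, one_smul]

theorem genInv_mul_gen {i : ℕ} (h1 : 1 ≤ i) (h2 : i < r) : genInv q u r i * gen q u r i = 1 := by
  rw [genInv, smul_mul_assoc, sub_mul, gen_mul_self q u r h1 h2, smul_mul_assoc, one_mul,
    add_sub_cancel_left, smul_smul, Units.inv_mul, one_smul]

theorem isUnit_gen {i : ℕ} (h1 : 1 ≤ i) (h2 : i < r) : IsUnit (gen q u r i) :=
  ⟨⟨_, _, gen_mul_genInv q u r h1 h2, genInv_mul_gen q u r h1 h2⟩, rfl⟩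

theorem commute_genInv {i : ℕ} {x : AK m r q u} (h : Commute (gen q u r i) x) :
    Commute (genInv q u r i) x :=
  ((h.sub_left ((Commute.one_left x).smul_left _))).smul_left _

/-! ### The Jucys-Murphy elements -/

theorem jm_succ {i : ℕ} (h : 1 ≤ i) :
    jm q u r (i + 1) = ((q⁻¹ : Rˣ) : R) • (gen q u r i * jm q u r i * gen q u r i) := by
  obtain ⟨j, rfl⟩ : ∃ j, i = j + 1 := ⟨i - 1, by omega⟩
  rfl

theorem jm_one : jm q u r 1 = gen q u r 0 := rfl

theorem gen_commute_jm_of_lt {i j : ℕ} (hj : 1 ≤ j) (h : j < i) :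
    Commute (gen q u r i) (jm q u r j) := by
  induction j, hj using Nat.le_induction with
  | base => exact (gen_comm q u r (by omega)).symm
  | succ j hj ih =>
    rw [jm_succ q u r hj]
    have h1 : Commute (gen q u r i) (gen q u r j) := (gen_comm q u r (by omega)).symm
    exact ((h1.mul_right (ih (by omega))).mul_right h1).smul_right _

/-- The essential case is j = i + 2: up to a scalar, L_{i+2} is T_{i+1} T_i L_i T_i T_{i+1}. One
braid move turns T_i into T_{i+1}, which passes L_i, and a second one turns it back. For i = 0 this
is the four-term braid relation. -/
theorem gen_commute_jm_of_gt {i j : ℕ} (h : i + 2 ≤ j) :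
    Commute (gen q u r i) (jm q u r j) := by
  induction j, h using Nat.le_induction with
  | base =>
    rcases Nat.eq_zero_or_pos i with rfl | hi
    · rw [jm_succ q u r (le_refl 1), jm_one]
      refine Commute.smul_right ?_ _
      have := gen_braid_four q u r
      simpa only [Commute, SemiconjBy, mul_assoc] using this
    · rw [jm_succ q u r (by omega : 1 ≤ i + 1), jm_succ q u r hi]
      have hb := gen_braid q u r hi
      have hc : Commute (gen q u r (i + 1)) (jm q u r i) :=
        gen_commute_jm_of_lt q u r hi (by omega)
      rw [mul_smul_comm, smul_mul_assoc]
      refine (Commute.smul_right ?_ _).smul_right _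
      generalize gen q u r i = a at *
      generalize gen q u r (i + 1) = b at *
      generalize jm q u r i = c at *
      have hc' : b * c = c * b := hc
      calc a * (b * (a * c * a) * b) = (a * b * a) * c * a * b := by noncomm_ring
        _ = b * a * (b * c) * a * b := by rw [hb]; noncomm_ring
        _ = b * a * c * (b * a * b) := by rw [hc']; noncomm_ring
        _ = b * (a * c * a) * b * a := by rw [← hb]; noncomm_ring
  | succ j hj ih =>
    rw [jm_succ q u r (by omega)]
    have h1 : Commute (gen q u r i) (gen q u r j) := gen_comm q u r (by omega)
    exact ((h1.mul_right ih).mul_right h1).smul_right _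

theorem gen_commute_jm {i j : ℕ} (hj : 1 ≤ j) (h1 : j ≠ i) (h2 : j ≠ i + 1) :
    Commute (gen q u r i) (jm q u r j) := by
  rcases Nat.lt_or_ge j i with h | h
  · exact gen_commute_jm_of_lt q u r hj h
  · exact gen_commute_jm_of_gt q u r (by omega)

/-- L_i is a word in T_0, …, T_{i-1}, and each of these commutes with L_j. -/
theorem jm_commute_of_lt {i j : ℕ} (hi : 1 ≤ i) (h : i < j) :
    Commute (jm q u r i) (jm q u r j) := by
  induction i, hi using Nat.le_induction with
  | base => exact gen_commute_jm_of_gt q u r (by omega)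
  | succ i hi ih =>
    rw [jm_succ q u r hi]
    have h1 : Commute (gen q u r i) (jm q u r j) := gen_commute_jm_of_gt q u r (by omega)
    exact ((h1.mul_left (ih (by omega))).mul_left h1).smul_left _

theorem jm_commute (i j : ℕ) : Commute (jm q u r (i + 1)) (jm q u r (j + 1)) := by
  rcases lt_trichotomy i j with h | h | h
  · exact jm_commute_of_lt q u r (by omega) (by omega)
  · rw [h]
  · exact (jm_commute_of_lt q u r (by omega) (by omega)).symm

theorem jm_succ_mul_gen {i : ℕ} (h1 : 1 ≤ i) (h2 : i < r) :
    jm q u r (i + 1) * gen q u r i =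
      gen q u r i * jm q u r i + ((q : R) - 1) • jm q u r (i + 1) := by
  conv_lhs => rw [jm_succ q u r h1]
  rw [smul_mul_assoc, mul_assoc, gen_mul_self q u r h1 h2, mul_add, smul_add, mul_smul_comm,
    mul_smul_comm, mul_one, smul_smul, smul_smul, Units.inv_mul, one_smul, add_comm,
    jm_succ q u r h1, smul_smul, mul_comm]

theorem gen_mul_jm_succ {i : ℕ} (h1 : 1 ≤ i) (h2 : i < r) :
    gen q u r i * jm q u r (i + 1) =
      jm q u r i * gen q u r i + ((q : R) - 1) • jm q u r (i + 1) := by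
  conv_lhs => rw [jm_succ q u r h1]
  rw [mul_smul_comm, ← mul_assoc, ← mul_assoc, gen_mul_self q u r h1 h2, add_mul, add_mul,
    smul_add, smul_mul_assoc, smul_mul_assoc, smul_mul_assoc, smul_mul_assoc, one_mul,
    smul_smul, smul_smul, Units.inv_mul, one_smul, add_comm,
    jm_succ q u r h1, smul_smul, mul_comm]

/-- Together with `gen_commute_jm_mul` this makes T_i commute with the symmetric expression (L_i -
x)(L_{i+1} - x). -/
theorem gen_commute_jm_add {i : ℕ} (h1 : 1 ≤ i) :
    Commute (gen q u r i) (jm q u r i + jm q u r (i + 1)) := by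
  by_cases h2 : i < r
  · have e1 := jm_succ_mul_gen q u r h1 h2
    have e2 := gen_mul_jm_succ q u r h1 h2
    rw [Commute, SemiconjBy, mul_add, add_mul, e1, e2]
    abel
  · rw [gen_of_le q u r (not_lt.mp h2)]
    exact Commute.zero_left _

theorem gen_commute_jm_mul {i : ℕ} (h1 : 1 ≤ i) :
    Commute (gen q u r i) (jm q u r i * jm q u r (i + 1)) := by
  by_cases h2 : i < r
  · have e1 := jm_succ_mul_gen q u r h1 h2
    have e2 := gen_mul_jm_succ q u r h1 h2
    have e3 : jm q u r i * jm q u r (i + 1) = jm q u r (i + 1) * jm q u r i :=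
      jm_commute_of_lt q u r h1 (Nat.lt_succ_self i)
    have e4 : gen q u r i * jm q u r i = jm q u r (i + 1) * gen q u r i
        - ((q : R) - 1) • jm q u r (i + 1) := by rw [e1]; abel
    rw [Commute, SemiconjBy, ← mul_assoc, e4, sub_mul, mul_assoc, e2, mul_add, mul_smul_comm,
      smul_mul_assoc, add_sub_cancel_right, ← mul_assoc, e3]
  · rw [gen_of_le q u r (not_lt.mp h2)]
    exact Commute.zero_left _

/-! ### Polynomials in the Jucys-Murphy elements -/

/-- The algebra homomorphism from the polynomial ring to `H` with `X_j ↦ L_{j+1}`. -/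
noncomputable def jmPoly : MvPolynomial ℕ R →ₐ[R] AK m r q u :=
  let s : Set (AK m r q u) := Set.range fun j => jm q u r (j + 1)
  have hs : ∀ a ∈ s, ∀ b ∈ s, a * b = b * a := by
    rintro _ ⟨i, rfl⟩ _ ⟨j, rfl⟩
    exact jm_commute q u r i j
  -- The L_j commute pairwise, so they generate a commutative subalgebra, into which polynomials can
  -- be evaluated.
  letI : CommRing (Algebra.adjoin R s) :=
    { (inferInstance : Ring (Algebra.adjoin R s)) with
      mul_comm := (Algebra.isMulCommutative_adjoin R hs).is_comm.comm }
  (Algebra.adjoin R s).val.comp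
    (MvPolynomial.aeval fun j => (⟨jm q u r (j + 1), Algebra.subset_adjoin ⟨j, rfl⟩⟩ :
      Algebra.adjoin R s))

@[simp]
theorem jmPoly_X (j : ℕ) : jmPoly q u r (MvPolynomial.X j) = jm q u r (j + 1) := by
  simp [jmPoly]

theorem jmPoly_C (x : R) : jmPoly q u r (MvPolynomial.C x) = algebraMap R _ x :=
  (jmPoly q u r).commutes x

theorem jmPoly_commute (f g : MvPolynomial ℕ R) : Commute (jmPoly q u r f) (jmPoly q u r g) :=
  (Commute.all f g).map (jmPoly q u r)

/-- The polynomial `∏_i ∏_{j < n_i} (X_j - u_i)` over an index set `J`. -/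
noncomputable def stairPoly {m : ℕ} (u : Fin m → R) (J : Finset (Fin m)) (n : Fin m → ℕ) :
    MvPolynomial ℕ R :=
  ∏ i ∈ J, ∏ j ∈ Finset.range (n i), (MvPolynomial.X j - MvPolynomial.C (u i))

theorem piOne_succ (n : ℕ) (x : R) : piOne q u r (n + 1) x =
    piOne q u r n x * (jm q u r (n + 1) - algebraMap R _ x) := by
  rw [piOne, List.range_succ, List.map_append, List.prod_append]
  simp [piOne]

theorem piOne_eq (n : ℕ) (x : R) : piOne q u r n x =
    jmPoly q u r (∏ j ∈ Finset.range n, (MvPolynomial.X j - MvPolynomial.C x)) := by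
  induction n with
  | zero => simp [piOne]
  | succ n ih => rw [piOne_succ, ih, Finset.prod_range_succ, map_mul, map_sub, jmPoly_X, jmPoly_C]

theorem piElt_eq (a : Lam m r) :
    piElt q u a = jmPoly q u r (stairPoly u Finset.univ fun i => a.seq i) := by
  rw [stairPoly, Fin.prod_univ_def, map_list_prod, List.map_map, piElt]
  congr 1
  exact List.map_congr_left fun i _ => piOne_eq q u r _ _

/-- Reversing the index puts the parameters in the same order as in `piElt_eq`; the two products
then differ only in their exponents. -/
theorem piTilde_eq (a : Lam m r) :
    piTilde q u a = jmPoly q u r (stairPoly u Finset.univ fun i => a.seq i.rev) := by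
  rw [stairPoly, ← Equiv.prod_comp Fin.revPerm, Fin.prod_univ_def, map_list_prod,
    List.map_map, piTilde]
  congr 1
  refine List.map_congr_left fun i _ => ?_
  simp only [Function.comp_apply, Fin.revPerm_apply, Fin.rev_rev]
  exact piOne_eq q u r _ _

/-- Factors other than those of L_i and L_{i+1} commute with T_i singly. If i < n, these two occur
together in a symmetric product. The case i = n is excluded because then L_i occurs without L_{i+1}.
-/
theorem gen_commute_piOne {i n : ℕ} (h1 : 1 ≤ i) (h2 : i ≠ n) (x : R) :
    Commute (gen q u r i) (piOne q u r n x) := by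
  have hc : Commute (gen q u r i) (algebraMap R _ x) := (Algebra.commutes x _).symm
  have hlow : ∀ n < i, Commute (gen q u r i) (piOne q u r n x) := by
    intro n
    induction n with
    | zero => intro _; simp [piOne]
    | succ n ih =>
      intro hn
      rw [piOne_succ]
      exact (ih (by omega)).mul_right
        ((gen_commute_jm q u r (by omega) (by omega) (by omega)).sub_right hc)
  rcases Nat.lt_or_ge n i with h | h
  · exact hlow n h
  · have h : i + 1 ≤ n := by omega
    clear h2
    induction n, h using Nat.le_induction with
    | base =>
      obtain ⟨k, rfl⟩ : ∃ k, i = k + 1 := ⟨i - 1, by omega⟩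
      rw [piOne_succ, piOne_succ, mul_assoc]
      refine (hlow k (by omega)).mul_right ?_
      have e : (jm q u r (k + 1) - algebraMap R _ x) * (jm q u r (k + 1 + 1) - algebraMap R _ x) =
          jm q u r (k + 1) * jm q u r (k + 1 + 1) -
            algebraMap R _ x * (jm q u r (k + 1) + jm q u r (k + 1 + 1))
            + algebraMap R _ x * algebraMap R _ x := by
        have := Algebra.commutes x (jm q u r (k + 1))
        rw [sub_mul, mul_sub, mul_sub, ← this]
        noncomm_ring
      rw [e]
      exact ((gen_commute_jm_mul q u r h1).sub_right
        (hc.mul_right (gen_commute_jm_add q u r h1))).add_right (hc.mul_right hc)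
    | succ n hn ih =>
      rw [piOne_succ]
      exact (ih (by omega)).mul_right
        ((gen_commute_jm q u r (by omega) (by omega) (by omega)).sub_right hc)

theorem gen_commute_stairPoly (v : Fin m → R) {i : ℕ} (h1 : 1 ≤ i) {J : Finset (Fin m)}
    {n : Fin m → ℕ} (h2 : ∀ j ∈ J, i ≠ n j) :
    Commute (gen q u r i) (jmPoly q u r (stairPoly v J n)) := by
  induction J using Finset.induction_on with
  | empty => simp [stairPoly]
  | insert a J ha ih =>
    have e : stairPoly v (insert a J) n =
      (∏ j ∈ Finset.range (n a), (MvPolynomial.X j - MvPolynomial.C (v a))) * stairPoly v J n := by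
      rw [stairPoly, Finset.prod_insert ha]; rfl
    rw [e, map_mul, ← piOne_eq]
    exact (gen_commute_piOne q u r h1 (h2 a (Finset.mem_insert_self _ _)) _).mul_right
      (ih fun j hj => h2 j (Finset.mem_insert_of_mem hj))

theorem stairPoly_dvd {J K : Finset (Fin m)} {n n' : Fin m → ℕ} (h1 : J ⊆ K)
    (h2 : ∀ j ∈ J, n j ≤ n' j) : stairPoly u J n ∣ stairPoly u K n' := by
  refine dvd_trans ?_ (Finset.prod_dvd_prod_of_subset _ _ _ h1)
  refine Finset.prod_dvd_prod_of_dvd _ _ fun j hj => ?_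
  exact Finset.prod_dvd_prod_of_subset _ _ _ (Finset.range_mono (h2 j hj))

end Relations

end ArikiKoike

namespace ArikiKoike

/-! ### Basic transpositions -/

theorem simpleRefl_val {r k : ℕ} (hk : 1 ≤ k ∧ k < r) (x : Fin r) :
    (simpleRefl r k x).val = if x.val = k - 1 then k else if x.val = k then k - 1 else x.val := by
  simp only [simpleRefl, dif_pos hk, Equiv.swap_apply_def, Fin.ext_iff]
  split_ifs <;> rfl

theorem simpleRefl_apply_of_ne {r k : ℕ} {x : Fin r} (h1 : x.val ≠ k - 1) (h2 : x.val ≠ k) :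
    simpleRefl r k x = x := by
  by_cases hk : 1 ≤ k ∧ k < r
  · apply Fin.ext
    rw [simpleRefl_val hk, if_neg h1, if_neg h2]
  · rw [simpleRefl, dif_neg hk]; rfl

theorem simpleRefl_apply_left {r k : ℕ} (hk : 1 ≤ k ∧ k < r) (h : k - 1 < r) :
    simpleRefl r k ⟨k - 1, h⟩ = ⟨k, hk.2⟩ := by
  apply Fin.ext
  rw [simpleRefl_val hk, if_pos rfl]

theorem simpleRefl_apply_right {r k : ℕ} (hk : 1 ≤ k ∧ k < r) :
    simpleRefl r k ⟨k, hk.2⟩ = ⟨k - 1, by omega⟩ := by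
  apply Fin.ext
  rw [simpleRefl_val hk, if_neg (by simp only; omega), if_pos rfl]

theorem simpleRefl_apply_self {r k : ℕ} (x : Fin r) :
    simpleRefl r k (simpleRefl r k x) = x := by
  rw [← Equiv.Perm.mul_apply, simpleRefl_mul_self, Equiv.Perm.one_apply]

theorem simpleRefl_comm {r i j : ℕ} (hi : 1 ≤ i) (h : i + 2 ≤ j) :
    simpleRefl r i * simpleRefl r j = simpleRefl r j * simpleRefl r i := by
  by_cases hj : j < r
  · ext x
    simp only [Equiv.Perm.mul_apply]
    rw [simpleRefl_val ⟨hi, by omega⟩, simpleRefl_val ⟨by omega, hj⟩,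
      simpleRefl_val ⟨by omega, hj⟩, simpleRefl_val ⟨hi, by omega⟩]
    split_ifs <;> omega
  · have : simpleRefl r j = 1 := by simp [simpleRefl, hj]
    rw [this, mul_one, one_mul]

theorem simpleRefl_braid {r i : ℕ} (hi : 1 ≤ i) (hj : i + 1 < r) :
    simpleRefl r i * simpleRefl r (i + 1) * simpleRefl r i =
      simpleRefl r (i + 1) * simpleRefl r i * simpleRefl r (i + 1) := by
  have hi' : 1 ≤ i ∧ i < r := ⟨hi, by omega⟩
  have hj' : 1 ≤ i + 1 ∧ i + 1 < r := ⟨by omega, hj⟩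
  have key : ∀ a b c : Fin r, a ≠ b → a ≠ c → b ≠ c →
      Equiv.swap a b * Equiv.swap b c * Equiv.swap a b =
        Equiv.swap b c * Equiv.swap a b * Equiv.swap b c := by
    intro a b c hab hac hbc
    rw [Equiv.swap_mul_swap_mul_swap hab hac, Equiv.swap_comm a b, Equiv.swap_comm b c,
      Equiv.swap_mul_swap_mul_swap hbc.symm hac.symm, Equiv.swap_comm]
  simp only [simpleRefl, dif_pos hi', dif_pos hj', Nat.add_sub_cancel]
  refine key _ _ _ ?_ ?_ ?_ <;>
  · rw [Ne, Fin.ext_iff]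
    simp only
    omega

theorem isDescent_mul_simpleRefl_of_far {r i j : ℕ} {w : Equiv.Perm (Fin r)}
    (hij : i + 2 ≤ j ∨ j + 2 ≤ i) (hi : 1 ≤ i) (hj : IsDescent w j) :
    IsDescent (w * simpleRefl r i) j := by
  obtain ⟨h, hd⟩ := hj
  refine ⟨h, ?_⟩
  rw [Equiv.Perm.mul_apply, Equiv.Perm.mul_apply,
    simpleRefl_apply_of_ne (by simp only; omega) (by simp only; omega),
    simpleRefl_apply_of_ne (by simp only; omega) (by simp only; omega)]
  exact hd

theorem isDescent_or {r k : ℕ} (h1 : 1 ≤ k) (h2 : k < r) (w : Equiv.Perm (Fin r)) :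
    IsDescent w k ∨ IsDescent (w * simpleRefl r k) k := by
  have hk : 1 ≤ k ∧ k < r := ⟨h1, h2⟩
  rcases lt_or_ge (w ⟨k, h2⟩) (w ⟨k - 1, by omega⟩) with h | h
  · exact Or.inl ⟨hk, h⟩
  · refine Or.inr ⟨hk, ?_⟩
    rw [Equiv.Perm.mul_apply, Equiv.Perm.mul_apply, simpleRefl_apply_left hk,
      simpleRefl_apply_right hk]
    refine lt_of_le_of_ne h fun e => ?_
    have := congrArg Fin.val (w.injective e)
    simp only at this
    omega

theorem eq_one_of_no_descent {r : ℕ} {w : Equiv.Perm (Fin r)} (h : ∀ k, ¬ IsDescent w k) :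
    w = 1 := by
  have h1 : reducedWord w = [] := by
    rw [reducedWord, dif_neg]
    rintro ⟨k, hk⟩
    exact h k hk
  rw [← wordPerm_reducedWord w, h1]
  rfl

/-- Induction on permutations by removing left descents. -/
theorem descent_induction {r : ℕ} {P : Equiv.Perm (Fin r) → Prop} (h1 : P 1)
    (h : ∀ w k, IsDescent w k → P (w * simpleRefl r k) → P w) (w : Equiv.Perm (Fin r)) : P w := by
  induction hn : inversions w using Nat.strong_induction_on generalizing w with
  | _ n ih =>
    by_cases hd : ∃ k, IsDescent w k
    · obtain ⟨k, hk⟩ := hd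
      exact h w k hk (ih _ (hn ▸ inversions_lt hk) _ rfl)
    · rw [eq_one_of_no_descent (not_exists.mp hd)]
      exact h1

/-- A permutation preserving the order is trivial. -/
theorem eq_one_of_strictMono {r : ℕ} {w : Equiv.Perm (Fin r)} (h : StrictMono w) : w = 1 := by
  refine eq_one_of_no_descent fun k => ?_
  rintro ⟨hk, hd⟩
  exact absurd hd (not_lt.mpr (h (by rw [Fin.lt_def]; simp only; omega)).le)

/-! ### The elements T_w and Matsumoto's theorem -/

section

variable {R : Type*} [CommRing R] {m : ℕ} (q : Rˣ) (u : Fin m → R) (r : ℕ)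

theorem T_one : T q u (1 : Equiv.Perm (Fin r)) = 1 := by
  have : ¬ ∃ k, IsDescent (1 : Equiv.Perm (Fin r)) k := by
    rintro ⟨k, hk, hd⟩
    simp only [Equiv.Perm.one_apply, Fin.lt_def] at hd
    omega
  rw [T, reducedWord, dif_neg this]
  simp

variable {r}

/-- `T_w = T_k T_{s_k w}` if `l(s_k w) < l(w)`. -/
theorem T_of_isDescent {w : Equiv.Perm (Fin r)} {k : ℕ} (hk : IsDescent w k) :
    T q u w = gen q u r k * T q u (w * simpleRefl r k) := by
  induction hn : inversions w using Nat.strong_induction_on generalizing w k with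
  | _ n ih =>
    -- If i and i + 1 are both descents, a reduced word of w may start with s_i s_{i+1} s_i or with
    -- s_{i+1} s_i s_{i+1}. Induction exposes both prefixes over one common tail.
    have braid : ∀ i, IsDescent w i → IsDescent w (i + 1) →
        gen q u r i * T q u (w * simpleRefl r i) =
          gen q u r (i + 1) * T q u (w * simpleRefl r (i + 1)) := by
      intro i hi hj
      obtain ⟨hi', di⟩ := id hi
      obtain ⟨hj', dj⟩ := id hj
      have a1 : simpleRefl r i ⟨i - 1, by omega⟩ = ⟨i, hi'.2⟩ := simpleRefl_apply_left hi' _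
      have a2 : simpleRefl r i ⟨i, hi'.2⟩ = ⟨i - 1, by omega⟩ := simpleRefl_apply_right hi'
      have a3 : simpleRefl r i ⟨i + 1, hj'.2⟩ = ⟨i + 1, hj'.2⟩ :=
        simpleRefl_apply_of_ne (by simp only; omega) (by simp only; omega)
      have b1 : simpleRefl r (i + 1) ⟨i, hi'.2⟩ = ⟨i + 1, hj'.2⟩ := simpleRefl_apply_left hj' _
      have b2 : simpleRefl r (i + 1) ⟨i + 1, hj'.2⟩ = ⟨i, hi'.2⟩ := simpleRefl_apply_right hj'
      have b3 : simpleRefl r (i + 1) ⟨i - 1, by omega⟩ = ⟨i - 1, by omega⟩ :=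
        simpleRefl_apply_of_ne (by simp only; omega) (by simp only; omega)
      simp only [Nat.add_sub_cancel] at dj
      have l1 := inversions_lt hi
      have l2 := inversions_lt hj
      have c1 : IsDescent (w * simpleRefl r i) (i + 1) := by
        refine ⟨hj', ?_⟩
        simp only [Equiv.Perm.mul_apply, Nat.add_sub_cancel, a3, a2]
        exact dj.trans di
      have c2 : IsDescent (w * simpleRefl r i * simpleRefl r (i + 1)) i := by
        refine ⟨hi', ?_⟩
        simp only [Equiv.Perm.mul_apply, b1, b3, a3, a1]
        exact dj
      have c3 : IsDescent (w * simpleRefl r (i + 1)) i := by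
        refine ⟨hi', ?_⟩
        simp only [Equiv.Perm.mul_apply, b1, b3]
        exact dj.trans di
      have c4 : IsDescent (w * simpleRefl r (i + 1) * simpleRefl r i) (i + 1) := by
        refine ⟨hj', ?_⟩
        simp only [Equiv.Perm.mul_apply, Nat.add_sub_cancel, a3, a2, b2, b3]
        exact di
      rw [ih _ (hn ▸ l1) c1 rfl, ih _ (hn ▸ (inversions_lt c1).trans l1) c2 rfl,
        ih _ (hn ▸ l2) c3 rfl, ih _ (hn ▸ (inversions_lt c3).trans l2) c4 rfl,
        mul_assoc w, mul_assoc w, mul_assoc w, mul_assoc w, simpleRefl_braid hi'.1 hj'.2,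
        ← mul_assoc, ← mul_assoc, ← mul_assoc, ← mul_assoc, gen_braid q u r hi'.1]
      simp only [mul_assoc]
    have far : ∀ i j, i + 2 ≤ j → IsDescent w i → IsDescent w j →
        gen q u r i * T q u (w * simpleRefl r i) = gen q u r j * T q u (w * simpleRefl r j) := by
      intro i j hij hi hj
      have hi' := hi.choose
      have hj' := hj.choose
      have l1 := inversions_lt hi
      have l2 := inversions_lt hj
      rw [ih _ (hn ▸ l1) (isDescent_mul_simpleRefl_of_far (Or.inl hij) hi'.1 hj) rfl,
        ih _ (hn ▸ l2) (isDescent_mul_simpleRefl_of_far (Or.inr hij) hj'.1 hi) rfl,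
        mul_assoc w, mul_assoc w, simpleRefl_comm hi'.1 hij, ← mul_assoc, ← mul_assoc,
        (gen_comm q u r hij).eq, mul_assoc]
    have hd : ∃ k, IsDescent w k := ⟨k, hk⟩
    -- `reducedWord` removes one chosen descent; comparing it with k shows that any descent gives
    -- the same product.
    have e : T q u w = gen q u r hd.choose * T q u (w * simpleRefl r hd.choose) := by
      conv_lhs => rw [T, reducedWord, dif_pos hd, List.map_cons, List.prod_cons]
      rfl
    rw [e]
    have hc := hd.choose_spec
    generalize hd.choose = c at *
    rcases lt_trichotomy c k with h | h | h
    · rcases Nat.lt_or_ge (c + 1) k with h' | h'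
      · exact far c k h' hc hk
      · obtain rfl : k = c + 1 := by omega
        exact braid c hc hk
    · rw [h]
    · rcases Nat.lt_or_ge (k + 1) c with h' | h'
      · exact (far k c h' hk hc).symm
      · obtain rfl : c = k + 1 := by omega
        exact (braid k hk hc).symm

theorem gen_mul_T_of_not_isDescent {w : Equiv.Perm (Fin r)} {k : ℕ} (h1 : 1 ≤ k) (h2 : k < r)
    (hk : ¬ IsDescent w k) : gen q u r k * T q u w = T q u (w * simpleRefl r k) := by
  rw [T_of_isDescent q u ((isDescent_or h1 h2 w).resolve_left hk), mul_assoc w,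
    simpleRefl_mul_self, mul_one]

/-- `T_k T_w` is a linear combination of `T_w` and `T_{s_k w}`. -/
theorem gen_mul_T {w : Equiv.Perm (Fin r)} {k : ℕ} (h1 : 1 ≤ k) (h2 : k < r) :
    ∃ c d : R, gen q u r k * T q u w = c • T q u w + d • T q u (w * simpleRefl r k) := by
  by_cases hk : IsDescent w k
  · refine ⟨(q : R) - 1, q, ?_⟩
    conv_lhs => rw [T_of_isDescent q u hk, ← mul_assoc, gen_mul_self q u r h1 h2, add_mul,
      smul_mul_assoc, smul_mul_assoc, one_mul, ← T_of_isDescent q u hk]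
  · refine ⟨0, 1, ?_⟩
    rw [gen_mul_T_of_not_isDescent q u h1 h2 hk, zero_smul, one_smul, zero_add]

/-- Exchanging the values k - 1 and k can destroy the descent at j only if they are the two values
compared there, and then k would be a descent of the inverse. -/
theorem isDescent_simpleRefl_mul {w : Equiv.Perm (Fin r)} {j k : ℕ} (h1 : 1 ≤ k) (h2 : k < r)
    (hj : IsDescent w j) (hk : ¬ IsDescent w⁻¹ k) : IsDescent (simpleRefl r k * w) j := by
  obtain ⟨hj', dj⟩ := hj
  refine ⟨hj', ?_⟩
  rw [Equiv.Perm.mul_apply, Equiv.Perm.mul_apply]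
  refine simpleRefl_lt ⟨h1, h2⟩ dj ?_
  rintro ⟨e1, e2⟩
  refine hk ⟨⟨h1, h2⟩, ?_⟩
  have f1 : w⁻¹ ⟨k - 1, by omega⟩ = ⟨j, hj'.2⟩ := by
    rw [Equiv.Perm.inv_eq_iff_eq]; exact (Fin.ext e1).symm
  have f2 : w⁻¹ ⟨k, h2⟩ = ⟨j - 1, by omega⟩ := by
    rw [Equiv.Perm.inv_eq_iff_eq]; exact (Fin.ext e2).symm
  rw [f1, f2, Fin.lt_def]
  simp only
  omega

theorem not_isDescent_inv_mul {w : Equiv.Perm (Fin r)} {j k : ℕ} (h1 : 1 ≤ k) (h2 : k < r)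
    (hj : IsDescent w j) (hk : ¬ IsDescent w⁻¹ k) :
    ¬ IsDescent (w * simpleRefl r j)⁻¹ k := by
  rintro ⟨_, d⟩
  obtain ⟨hj', dj⟩ := hj
  have hs : (simpleRefl r j)⁻¹ = simpleRefl r j :=
    inv_eq_of_mul_eq_one_left (simpleRefl_mul_self r j)
  rw [mul_inv_rev, hs, Equiv.Perm.mul_apply, Equiv.Perm.mul_apply] at d
  have hlt : w⁻¹ ⟨k - 1, by omega⟩ < w⁻¹ ⟨k, h2⟩ := by
    refine lt_of_le_of_ne (not_lt.mp fun h => hk ⟨⟨h1, h2⟩, h⟩) fun e => ?_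
    have := congrArg Fin.val (w⁻¹.injective e)
    simp only at this
    omega
  refine absurd d (not_lt.mpr (simpleRefl_lt hj' hlt ?_).le)
  rintro ⟨e1, e2⟩
  have f1 : w ⟨j - 1, by omega⟩ = ⟨k - 1, by omega⟩ := by
    rw [← Equiv.Perm.eq_inv_iff_eq]; exact (Fin.ext e1).symm
  have f2 : w ⟨j, hj'.2⟩ = ⟨k, h2⟩ := by
    rw [← Equiv.Perm.eq_inv_iff_eq]; exact (Fin.ext e2).symm
  rw [f1, f2, Fin.lt_def] at dj
  simp only at dj
  omega

/-- `T_w T_k = T_{w s_k}` if `l(w s_k) > l(w)`. -/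
theorem T_mul_gen_of_not_isDescent {w : Equiv.Perm (Fin r)} {k : ℕ} (h1 : 1 ≤ k) (h2 : k < r)
    (hk : ¬ IsDescent w⁻¹ k) : T q u w * gen q u r k = T q u (simpleRefl r k * w) := by
  induction w using descent_induction with
  | h1 =>
    have hs : IsDescent (simpleRefl r k) k := by
      refine ⟨⟨h1, h2⟩, ?_⟩
      rw [simpleRefl_apply_left ⟨h1, h2⟩, simpleRefl_apply_right ⟨h1, h2⟩, Fin.lt_def]
      simp only
      omega
    rw [mul_one, T_of_isDescent q u hs, simpleRefl_mul_self, T_one, one_mul, mul_one]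
  | h w j hj ih =>
    rw [T_of_isDescent q u hj, mul_assoc, ih (not_isDescent_inv_mul h1 h2 hj hk), ← mul_assoc,
      ← T_of_isDescent q u (isDescent_simpleRefl_mul h1 h2 hj hk)]

theorem T_of_isDescent_inv {w : Equiv.Perm (Fin r)} {k : ℕ} (hk : IsDescent w⁻¹ k) :
    T q u w = T q u (simpleRefl r k * w) * gen q u r k := by
  obtain ⟨⟨h1, h2⟩, d⟩ := id hk
  have hs : (simpleRefl r k)⁻¹ = simpleRefl r k :=
    inv_eq_of_mul_eq_one_left (simpleRefl_mul_self r k)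
  rw [T_mul_gen_of_not_isDescent q u h1 h2, ← mul_assoc, simpleRefl_mul_self, one_mul]
  rw [mul_inv_rev, hs]
  rintro ⟨_, d'⟩
  rw [Equiv.Perm.mul_apply, Equiv.Perm.mul_apply, simpleRefl_apply_left ⟨h1, h2⟩,
    simpleRefl_apply_right ⟨h1, h2⟩] at d'
  exact absurd d' (not_lt.mpr d.le)

theorem isUnit_T (w : Equiv.Perm (Fin r)) : IsUnit (T q u w) := by
  induction w using descent_induction with
  | h1 => rw [T_one]; exact isUnit_one
  | h w k hk ih =>
    rw [T_of_isDescent q u hk]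
    obtain ⟨h1, h2⟩ := hk.choose
    exact (isUnit_gen q u r h1 h2).mul ih

/-- `T_w` commutes with `T_0` if `w` fixes the first letter. -/
theorem gen_zero_commute_T (h : 0 < r) (w : Equiv.Perm (Fin r)) (hw : w ⟨0, h⟩ = ⟨0, h⟩) :
    Commute (gen q u r 0) (T q u w) := by
  induction w using descent_induction with
  | h1 => rw [T_one]; exact Commute.one_right _
  | h w k hk ih =>
    rw [T_of_isDescent q u hk]
    obtain ⟨⟨h1, h2⟩, d⟩ := hk
    have hk1 : k ≠ 1 := by
      rintro rfl
      simp only [Nat.sub_self, hw] at d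
      exact absurd d (by simp [Fin.lt_def])
    refine (gen_comm q u r (by omega)).mul_right (ih ?_)
    rw [Equiv.Perm.mul_apply, simpleRefl_apply_of_ne (by simp only; omega) (by simp only; omega), hw]

/-- If `s_k w = w s_l` and both have length `l(w) + 1`, then `T_k T_w = T_w T_l`. -/
theorem gen_mul_T_eq_T_mul_gen {w : Equiv.Perm (Fin r)} {k l : ℕ} (hk : 1 ≤ k ∧ k < r)
    (hl : 1 ≤ l ∧ l < r) (e1 : w ⟨k - 1, by omega⟩ = ⟨l - 1, by omega⟩)
    (e2 : w ⟨k, hk.2⟩ = ⟨l, hl.2⟩) :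
    gen q u r k * T q u w = T q u w * gen q u r l := by
  have f1 : w⁻¹ ⟨l - 1, by omega⟩ = ⟨k - 1, by omega⟩ := by rw [Equiv.Perm.inv_eq_iff_eq, e1]
  have f2 : w⁻¹ ⟨l, hl.2⟩ = ⟨k, hk.2⟩ := by rw [Equiv.Perm.inv_eq_iff_eq, e2]
  rw [gen_mul_T_of_not_isDescent q u hk.1 hk.2, T_mul_gen_of_not_isDescent q u hl.1 hl.2]
  · congr 1
    rw [simpleRefl, dif_pos hk, simpleRefl, dif_pos hl, Equiv.mul_swap_eq_swap_mul, e1, e2]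
  · rintro ⟨_, d⟩
    rw [f1, f2, Fin.lt_def] at d
    simp only at d
    omega
  · rintro ⟨_, d⟩
    rw [e1, e2, Fin.lt_def] at d
    simp only at d
    omega

end

end ArikiKoike

namespace ArikiKoike

/-! ### Permutations and order -/

theorem le_of_no_descent {r lo hi : ℕ} {w : Equiv.Perm (Fin r)}
    (h : ∀ k, lo < k → k < hi → ¬ IsDescent w k) {i j : Fin r} (hi' : lo ≤ i.val) (hij : i ≤ j)
    (hj : j.val < hi) : w i ≤ w j := by
  obtain ⟨j, hjr⟩ := j
  replace hij : i.val ≤ j := hij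
  induction j, hij using Nat.le_induction with
  | base => exact le_rfl
  | succ j hij ih =>
    simp only at hj
    refine (ih (by omega) (by simp only; omega)).trans (not_lt.mp fun hd => ?_)
    exact h (j + 1) (by omega) hj ⟨⟨by omega, hjr⟩, hd⟩

theorem inversions_inv {r : ℕ} (w : Equiv.Perm (Fin r)) : inversions w⁻¹ = inversions w := by
  unfold inversions
  refine Finset.card_nbij' (fun p => (w⁻¹ p.2, w⁻¹ p.1)) (fun p => (w p.2, w p.1)) ?_ ?_ ?_ ?_
  · intro p hp
    simpa [and_comm] using hp
  · intro p hp
    simpa [and_comm] using hp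
  · intro p _
    simp
  · intro p _
    simp

theorem inversions_simpleRefl_mul_lt {r k : ℕ} {w : Equiv.Perm (Fin r)} (hk : IsDescent w⁻¹ k) :
    inversions (simpleRefl r k * w) < inversions w := by
  have hs : (simpleRefl r k)⁻¹ = simpleRefl r k :=
    inv_eq_of_mul_eq_one_left (simpleRefl_mul_self r k)
  rw [← inversions_inv w, ← inversions_inv, mul_inv_rev, hs]
  exact inversions_lt hk

/-- Pigeonhole: otherwise A letters would be mapped injectively into the r - B letters from B on. -/
theorem exists_lt_apply_lt {r A B : ℕ} (hA : A ≤ r) (hB : B ≤ r) (h : r < A + B)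
    (w : Equiv.Perm (Fin r)) : ∃ p : Fin r, p.val < A ∧ (w p).val < B := by
  by_contra hc
  push Not at hc
  have := Fintype.card_le_of_injective
    (fun p : Fin A => (⟨(w ⟨p.val, by omega⟩).val - B, by
      have h1 := hc ⟨p.val, by omega⟩ p.2
      have h2 := (w ⟨p.val, by omega⟩).2
      omega⟩ : Fin (r - B))) ?_
  · simp only [Fintype.card_fin] at this
    omega
  · intro p p' e
    have h1 := hc ⟨p.val, by omega⟩ p.2
    have h2 := hc ⟨p'.val, by omega⟩ p'.2
    simp only [Fin.mk.injEq] at e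
    have e' : w ⟨p.val, by omega⟩ = w ⟨p'.val, by omega⟩ := Fin.ext (by omega)
    have := congrArg Fin.val (w.injective e')
    exact Fin.ext this

theorem simpleRefl_val_lt {r k A : ℕ} (hA : k ≠ A) {x : Fin r} (hx : x.val < A) :
    (simpleRefl r k x).val < A := by
  by_cases hk : 1 ≤ k ∧ k < r
  · rw [simpleRefl_val hk]
    split_ifs <;> omega
  · rwa [simpleRefl, dif_neg hk, Equiv.Perm.one_apply]

section

variable {R : Type*} [CommRing R] {m : ℕ} (q : Rˣ) (u : Fin m → R) {r : ℕ}

/-! ### The vanishing lemma -/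

theorem stairPoly_one_commute_T (v : Fin m → R) (J : Finset (Fin m)) (h : 0 < r)
    (w : Equiv.Perm (Fin r)) (hw : w ⟨0, h⟩ = ⟨0, h⟩) :
    Commute (jmPoly q u r (stairPoly v J fun _ => 1)) (T q u w) := by
  induction J using Finset.induction_on with
  | empty => simp [stairPoly]
  | insert a J ha ih =>
    rw [stairPoly, Finset.prod_insert ha, map_mul]
    refine Commute.mul_left ?_ ih
    rw [Finset.prod_range_one, map_sub, jmPoly_X, jmPoly_C]
    exact (gen_zero_commute_T q u h w hw).sub_left (Algebra.commutes _ _)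

theorem jmPoly_stairPoly_one (h : 0 < r) :
    jmPoly q u r (stairPoly u Finset.univ fun _ => 1) = 0 := by
  rw [stairPoly, Fin.prod_univ_def, map_list_prod, List.map_map, ← gen_cyclotomic q u r h]
  congr 1
  refine List.map_congr_left fun k _ => ?_
  rw [Function.comp_apply, Finset.prod_range_one, map_sub, jmPoly_X, jmPoly_C, jm_one]

/-- Descents of w other than A, and of its inverse other than B, can be stripped off, since their
generators commute with the adjacent staircase. What remains is a w fixing the first letter. Then
T_w commutes with T_0, and the factors in L_1 = T_0 from the two sides combine to the whole
cyclotomic product. -/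
theorem stair_mul_T_mul_stair_const (J : Finset (Fin m)) (A B : ℕ) (w : Equiv.Perm (Fin r))
    (p : Fin r) (hp : p.val < A) (hw : (w p).val < B) :
    jmPoly q u r (stairPoly u J fun _ => A) * T q u w *
      jmPoly q u r (stairPoly u Jᶜ fun _ => B) = 0 := by
  induction hn : inversions w using Nat.strong_induction_on generalizing w p with
  | _ n ih =>
    by_cases hl : ∃ k, IsDescent w k ∧ k ≠ A
    · obtain ⟨k, hk, hkA⟩ := hl
      have hk1 := hk.choose.1
      rw [T_of_isDescent q u hk, ← mul_assoc,
        ← (gen_commute_stairPoly q u r u hk1 fun _ _ => hkA).eq, mul_assoc, mul_assoc,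
        ← mul_assoc (jmPoly q u r _) (T q u _), ih _ (hn ▸ inversions_lt hk) _
          (simpleRefl r k p) (simpleRefl_val_lt hkA hp) _ rfl, mul_zero]
      rwa [Equiv.Perm.mul_apply, simpleRefl_apply_self]
    by_cases hr : ∃ k, IsDescent w⁻¹ k ∧ k ≠ B
    · obtain ⟨k, hk, hkB⟩ := hr
      have hk1 := hk.choose.1
      rw [T_of_isDescent_inv q u hk, mul_assoc, mul_assoc,
        (gen_commute_stairPoly q u r u hk1 fun _ _ => hkB).eq, ← mul_assoc, ← mul_assoc,
        ih _ (hn ▸ inversions_simpleRefl_mul_lt hk) _ p hp _ rfl, zero_mul]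
      rw [Equiv.Perm.mul_apply]
      exact simpleRefl_val_lt hkB hw
    -- Now w increases on the first A letters and its inverse on the first B. The letter p forces
    -- the image of the first letter below B, and monotonicity of the inverse then shows that w
    -- fixes the first letter.
    push Not at hl hr
    have h0 : 0 < r := by have := p.2; omega
    have e1 : w ⟨0, h0⟩ ≤ w p := le_of_no_descent (lo := 0) (hi := A)
      (fun k _ hk hd => by have := hl k hd; omega) (Nat.zero_le _) (Nat.zero_le _) hp
    have e2 : w⁻¹ ⟨0, h0⟩ ≤ w⁻¹ (w ⟨0, h0⟩) := le_of_no_descent (lo := 0) (hi := B)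
      (fun k _ hk hd => by have := hr k hd; omega) (Nat.zero_le _) (Nat.zero_le _)
      (lt_of_le_of_lt e1 hw)
    rw [Equiv.Perm.inv_def, Equiv.symm_apply_apply] at e2
    have e3 : w⁻¹ ⟨0, h0⟩ = ⟨0, h0⟩ := le_antisymm e2 (Nat.zero_le _)
    have e4 : w ⟨0, h0⟩ = ⟨0, h0⟩ := by rw [Equiv.Perm.inv_eq_iff_eq] at e3; exact e3.symm
    obtain ⟨f, hf⟩ := stairPoly_dvd (u := u) (J := J) (K := J) (n := fun _ => 1)
      (n' := fun _ => A) subset_rfl (fun _ _ => by omega)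
    obtain ⟨g, hg⟩ := stairPoly_dvd (u := u) (J := Jᶜ) (K := Jᶜ) (n := fun _ => 1)
      (n' := fun _ => B) subset_rfl (fun _ _ => by omega)
    have e5 : jmPoly q u r (stairPoly u J fun _ => 1) *
        jmPoly q u r (stairPoly u Jᶜ fun _ => 1) = 0 := by
      rw [← map_mul, ← jmPoly_stairPoly_one q u h0, stairPoly, stairPoly, stairPoly,
        Finset.prod_mul_prod_compl]
    rw [hf, hg, mul_comm _ f, map_mul, map_mul, mul_assoc (jmPoly q u r f),
      (stairPoly_one_commute_T q u u J h0 w e4).eq, mul_assoc, mul_assoc,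
      ← mul_assoc (jmPoly q u r (stairPoly u J _)), e5, zero_mul, mul_zero, mul_zero]

/-- The vanishing lemma: if the exponents are at least `A` on `J` and at least `B` on the
complement of `J`, and `w` maps some `p < A` to a letter `< B`, then the product is zero. -/
theorem stair_mul_T_mul_stair (J : Finset (Fin m)) (A B : ℕ) {n n' : Fin m → ℕ}
    (hn : ∀ i ∈ J, A ≤ n i) (hn' : ∀ i ∉ J, B ≤ n' i) (w : Equiv.Perm (Fin r))
    (p : Fin r) (hp : p.val < A) (hw : (w p).val < B) :
    jmPoly q u r (stairPoly u Finset.univ n) * T q u w *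
      jmPoly q u r (stairPoly u Finset.univ n') = 0 := by
  obtain ⟨f, hf⟩ := stairPoly_dvd (u := u) (J := J) (K := Finset.univ) (n := fun _ => A)
    (n' := n) (Finset.subset_univ _) hn
  obtain ⟨g, hg⟩ := stairPoly_dvd (u := u) (J := Jᶜ) (K := Finset.univ) (n := fun _ => B)
    (n' := n') (Finset.subset_univ _) (fun i hi => hn' i (Finset.mem_compl.mp hi))
  rw [hf, hg, mul_comm _ f, map_mul, map_mul]
  have := stair_mul_T_mul_stair_const q u J A B w p hp hw
  calc _ = jmPoly q u r f * (jmPoly q u r (stairPoly u J fun _ => A) * T q u w *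
      jmPoly q u r (stairPoly u Jᶜ fun _ => B)) * jmPoly q u r g := by simp only [mul_assoc]
    _ = 0 := by rw [this, mul_zero, zero_mul]

/-! ### Spanning set -/

variable (r) in
theorem jm_mul_gen {i : ℕ} (h1 : 1 ≤ i) (h2 : i < r) (j : ℕ) :
    ∃ f g : MvPolynomial ℕ R, jm q u r (j + 1) * gen q u r i =
      gen q u r i * jmPoly q u r f + jmPoly q u r g := by
  rcases eq_or_ne (j + 1) i with h | h
  · refine ⟨MvPolynomial.X (j + 1), -(MvPolynomial.C ((q : R) - 1) * MvPolynomial.X (j + 1)), ?_⟩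
    have := gen_mul_jm_succ q u r h1 h2
    rw [map_neg, map_mul, jmPoly_X, jmPoly_C, ← Algebra.smul_def, h, this]
    abel
  rcases eq_or_ne (j + 1) (i + 1) with h' | h'
  · obtain rfl : j = i := by omega
    refine ⟨MvPolynomial.X (j - 1), MvPolynomial.C ((q : R) - 1) * MvPolynomial.X j, ?_⟩
    rw [map_mul, jmPoly_X, jmPoly_X, jmPoly_C, ← Algebra.smul_def, Nat.sub_add_cancel h1]
    exact jm_succ_mul_gen q u r h1 h2
  · refine ⟨MvPolynomial.X j, 0, ?_⟩
    rw [map_zero, add_zero, jmPoly_X]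
    exact (gen_commute_jm q u r (by omega) h h').eq.symm

variable (r) in
-- Straightening: a generator moves to the left through a polynomial at the cost of a term in which
-- it no longer occurs.
theorem jmPoly_mul_gen {i : ℕ} (h1 : 1 ≤ i) (h2 : i < r) (p : MvPolynomial ℕ R) :
    ∃ f g : MvPolynomial ℕ R, jmPoly q u r p * gen q u r i =
      gen q u r i * jmPoly q u r f + jmPoly q u r g := by
  induction p using MvPolynomial.induction_on with
  | C c =>
    refine ⟨MvPolynomial.C c, 0, ?_⟩
    rw [map_zero, add_zero, jmPoly_C, Algebra.commutes]
  | add p p' hp hp' =>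
    obtain ⟨f, g, h⟩ := hp
    obtain ⟨f', g', h'⟩ := hp'
    refine ⟨f + f', g + g', ?_⟩
    rw [map_add, add_mul, h, h', map_add, map_add, mul_add]
    abel
  | mul_X p j hp =>
    obtain ⟨f, g, h⟩ := hp
    obtain ⟨f', g', h'⟩ := jm_mul_gen q u r h1 h2 j
    refine ⟨f * f', g * f' + p * g', ?_⟩
    rw [map_mul, jmPoly_X, mul_assoc, h', mul_add, ← mul_assoc, h, map_mul, map_add, map_mul,
      map_mul, add_mul, mul_assoc, add_assoc]

variable (r) in
/-- `H` is spanned by the elements `T_w f(L_1, …, L_r)`. -/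
theorem span_T_mul_jmPoly : Submodule.span R
    {x | ∃ (w : Equiv.Perm (Fin r)) (f : MvPolynomial ℕ R), x = T q u w * jmPoly q u r f} = ⊤ := by
  set S := Submodule.span R
    {x | ∃ (w : Equiv.Perm (Fin r)) (f : MvPolynomial ℕ R), x = T q u w * jmPoly q u r f} with hS
  have hmem : ∀ w f, T q u w * jmPoly q u r f ∈ S := fun w f => Submodule.subset_span ⟨w, f, rfl⟩
  have hgen : ∀ i, 1 ≤ i → i < r → ∀ x ∈ S, gen q u r i * x ∈ S := by
    intro i h1 h2 x hx
    induction hx using Submodule.span_induction with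
    | mem x hx =>
      obtain ⟨w, f, rfl⟩ := hx
      obtain ⟨c, d, e⟩ := gen_mul_T q u (w := w) h1 h2
      rw [← mul_assoc, e, add_mul, smul_mul_assoc, smul_mul_assoc]
      exact add_mem (S.smul_mem _ (hmem _ _)) (S.smul_mem _ (hmem _ _))
    | zero => rw [mul_zero]; exact zero_mem _
    | add x y _ _ hx hy => rw [mul_add]; exact add_mem hx hy
    | smul c x _ hx => rw [mul_smul_comm]; exact S.smul_mem c hx
  -- Applied to f = L_1 = T_0, this gives stability of the span under left multiplication by T_0,
  -- the only generator that `hgen` does not cover.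
  have hpoly : ∀ w : Equiv.Perm (Fin r), ∀ f, jmPoly q u r f * T q u w ∈ S := by
    intro w
    induction w using descent_induction with
    | h1 => intro f; have := hmem 1 f; rw [T_one, one_mul] at this; rwa [T_one, mul_one]
    | h w k hk ih =>
      intro f
      obtain ⟨k1, k2⟩ := hk.choose
      obtain ⟨f', g, h⟩ := jmPoly_mul_gen q u r k1 k2 f
      rw [T_of_isDescent q u hk, ← mul_assoc, h, add_mul, mul_assoc]
      exact add_mem (hgen k k1 k2 _ (ih f')) (ih g)
  refine eq_top_of_gen_mul_mem q u r ?_ ?_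
  · have := hmem 1 1
    rwa [T_one, map_one, mul_one] at this
  · intro i hi x hx
    rcases Nat.eq_zero_or_pos i with rfl | h1
    · induction hx using Submodule.span_induction with
      | mem x hx =>
        obtain ⟨w, f, rfl⟩ := hx
        have h2 := hpoly w (MvPolynomial.X 0)
        rw [jmPoly_X, jm_one] at h2
        rw [← mul_assoc]
        generalize gen q u r 0 * T q u w = y at h2
        induction h2 using Submodule.span_induction with
        | mem x hx =>
          obtain ⟨w, g, rfl⟩ := hx
          rw [mul_assoc, ← map_mul]
          exact hmem _ _
        | zero => rw [zero_mul]; exact zero_mem _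
        | add x y _ _ hx hy => rw [add_mul]; exact add_mem hx hy
        | smul c x _ hx => rw [smul_mul_assoc]; exact S.smul_mem c hx
      | zero => rw [mul_zero]; exact zero_mem _
      | add x y _ _ hx hy => rw [mul_add]; exact add_mem hx hy
      | smul c x _ hx => rw [mul_smul_comm]; exact S.smul_mem c hx
    · exact hgen i h1 hi x hx

end

end ArikiKoike

namespace ArikiKoike

/-! ### The permutations w_a and permutations reversing the blocks -/

namespace Lam

variable {m r : ℕ} (a : Lam m r)

theorem perm_val (p : Fin r) :
    (a.perm p).val = (r - a.seq (a.block p)) + (p.val - a.seq (a.block p - 1)) := rfl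

theorem block_le_of_lt {p : Fin r} {i : ℕ} (h : p.val < a.seq i) : a.block p ≤ i :=
  Nat.find_min' _ h

theorem block_eq {p : Fin r} {i : ℕ} (h1 : a.seq (i - 1) ≤ p.val) (h2 : p.val < a.seq i) :
    a.block p = i := by
  refine le_antisymm (a.block_le_of_lt h2) (not_lt.mp fun h => ?_)
  have h3 := (a.block_spec p).2.2
  have h4 := a.mono (show a.block p ≤ i - 1 by omega)
  omega

theorem block_le (p : Fin r) : a.block p ≤ m :=
  a.block_le_of_lt (by rw [a.top m le_rfl]; exact p.2)

theorem dual_dual : a.dual.dual = a := by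
  ext i
  change r - (r - a.seq (m - (m - i))) = a.seq i
  have := a.le_top i
  by_cases h : i ≤ m
  · rw [Nat.sub_sub_self h, Nat.sub_sub_self this]
  · rw [show m - i = 0 by omega, a.top _ (by omega), a.top i (by omega)]
    omega

/-- Block i of a is translated onto block m - i + 1 of a', and w_{a'} translates it back. -/
theorem dual_perm_perm (p : Fin r) : a.dual.perm (a.perm p) = p := by
  obtain ⟨h1, h2, h3⟩ := a.block_spec p
  have h4 := a.block_le p
  have hp := a.perm_val p
  have hlt := a.le_top (a.block p)
  have hlt' := a.le_top (a.block p - 1)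
  set i := a.block p with hi
  have e1 : a.dual.seq (m - i + 1) = r - a.seq (i - 1) := by
    change r - a.seq (m - (m - i + 1)) = _
    rw [show m - (m - i + 1) = i - 1 by omega]
  have e2 : a.dual.seq (m - i) = r - a.seq i := by
    change r - a.seq (m - (m - i)) = _
    rw [Nat.sub_sub_self h4]
  have hb : a.dual.block (a.perm p) = m - i + 1 := by
    refine a.dual.block_eq ?_ ?_
    · rw [Nat.add_sub_cancel, e2, hp]; omega
    · rw [e1, hp]; omega
  apply Fin.ext
  rw [perm_val, hb, Nat.add_sub_cancel, e1, e2, hp]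
  omega

theorem perm_dual_perm (p : Fin r) : a.perm (a.dual.perm p) = p := by
  have := a.dual.dual_perm_perm p
  rwa [dual_dual] at this

/-- `w_a` maps adjacent letters of one block to adjacent letters of one block. -/
theorem perm_adjacent {k : ℕ} (h1 : 1 ≤ k) (h2 : k < r) (hk : ∀ j, a.seq j ≠ k) :
    (a.perm ⟨k, h2⟩).val = (a.perm ⟨k - 1, by omega⟩).val + 1 ∧
      ∀ j, a.dual.seq j ≠ (a.perm ⟨k, h2⟩).val := by
  obtain ⟨b1, b2, b3⟩ := a.block_spec ⟨k, h2⟩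
  have hp := a.perm_val ⟨k, h2⟩
  have hp' := a.perm_val ⟨k - 1, by omega⟩
  set i := a.block ⟨k, h2⟩ with hi
  simp only at b2 b3 hp hp'
  have hne := hk (i - 1)
  have e : a.block ⟨k - 1, by omega⟩ = i :=
    a.block_eq (by simp only; omega) (by simp only; omega)
  rw [e] at hp'
  have hlt := a.le_top i
  refine ⟨by omega, fun j hj => ?_⟩
  change r - a.seq (m - j) = _ at hj
  have hlt' := a.le_top (m - j)
  rcases Nat.lt_or_ge (m - j) i with h | h
  · have := a.mono (show m - j ≤ i - 1 by omega)
    omega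
  · have := a.mono h
    omega

/-- `w` maps the first `a_i` letters to the last `a_i` letters, for all `i`. -/
def Reverses (w : Equiv.Perm (Fin r)) : Prop :=
  ∀ (i : ℕ) (p : Fin r), p.val < a.seq i → r - a.seq i ≤ (w p).val

theorem reverses_perm : a.Reverses a.perm := by
  intro i p hp
  have := a.mono (a.block_le_of_lt hp)
  rw [perm_val]
  omega

variable {a}

/-- Followed by the order reversal of all letters, w maps the first a_i letters into themselves. By
finiteness the inverse does so too, and hence no later letter can land there. -/
theorem Reverses.lt {w : Equiv.Perm (Fin r)} (h : a.Reverses w) {i : ℕ} {p : Fin r}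
    (hp : a.seq i ≤ p.val) : (w p).val < r - a.seq i := by
  by_contra hc
  set f : Equiv.Perm (Fin r) := Fin.revPerm * w with hf
  have hv : ∀ x, (f x).val = r - (w x).val - 1 := fun x => by
    simp only [hf, Equiv.Perm.mul_apply, Fin.revPerm_apply, Fin.val_rev]
    omega
  have hm : Set.MapsTo f {x : Fin r | x.val < a.seq i} {x : Fin r | x.val < a.seq i} := by
    intro x hx
    have := h i x hx
    have h2 := (w x).2
    have hlt := a.le_top i
    change (f x).val < a.seq i
    rw [hv]
    omega
  have h1 := Equiv.Perm.perm_symm_mapsTo_of_mapsTo f hm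
  have h2 : f p ∈ {x : Fin r | x.val < a.seq i} := by
    change (f p).val < a.seq i
    rw [hv]
    have h2 := (w p).2
    omega
  have h3 := h1 h2
  rw [Equiv.symm_apply_apply] at h3
  exact absurd hp (not_le.mpr h3)

theorem Reverses.lt_of_block_lt {w : Equiv.Perm (Fin r)} (h : a.Reverses w) {p p' : Fin r}
    (hb : a.block p < a.block p') : w p' < w p := by
  have h1 := h _ p (a.block_spec p).2.2
  have h2 := h.lt (i := a.block p) (p := p')
    ((a.mono (show a.block p ≤ a.block p' - 1 by omega)).trans (a.block_spec p').2.1)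
  rw [Fin.lt_def]
  omega

theorem perm_lt_perm {p p' : Fin r} (h : p < p') (hb : a.block p = a.block p') :
    a.perm p < a.perm p' := by
  rw [Fin.lt_def] at *
  have h1 := a.block_spec p
  rw [perm_val, perm_val, ← hb]
  omega

/-- A permutation reversing the blocks with no descent inside the blocks is `w_a`. -/
theorem Reverses.eq_perm {w : Equiv.Perm (Fin r)} (h : a.Reverses w)
    (hd : ∀ k, IsDescent w k → ∃ j, a.seq j = k) : w = a.perm := by
  have hmono : ∀ p p' : Fin r, p ≤ p' → a.block p = a.block p' → w p ≤ w p' := by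
    intro p p' hp hb
    refine le_of_no_descent (lo := a.seq (a.block p - 1)) (hi := a.seq (a.block p)) ?_
      (a.block_spec p).2.1 hp (hb ▸ (a.block_spec p').2.2)
    intro k h1 h2 hk
    obtain ⟨j, rfl⟩ := hd k hk
    rcases Nat.lt_or_ge j (a.block p) with hj | hj
    · exact absurd (a.mono (show j ≤ a.block p - 1 by omega)) (not_le.mpr h1)
    · exact absurd (a.mono hj) (not_le.mpr h2)
  -- Both w and w_a reverse the order of the blocks and increase within each block, so the composite
  -- preserves the order.
  have : a.perm * w⁻¹ = 1 := by
    refine eq_one_of_strictMono fun x y hxy => ?_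
    obtain ⟨p, rfl⟩ := w.surjective x
    obtain ⟨p', rfl⟩ := w.surjective y
    simp only [Equiv.Perm.mul_apply, Equiv.Perm.inv_def, Equiv.symm_apply_apply]
    rcases lt_trichotomy (a.block p) (a.block p') with hb | hb | hb
    · exact absurd hxy (not_lt.mpr (h.lt_of_block_lt hb).le)
    · refine perm_lt_perm (not_le.mp fun hle => ?_) hb
      exact absurd hxy (not_lt.mpr (hmono p' p hle hb.symm))
    · exact a.reverses_perm.lt_of_block_lt hb
  exact (mul_inv_eq_one.mp this).symm

end Lam

/-! ### The Young subalgebra -/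

section

variable {R : Type*} [CommRing R] {m : ℕ} (q : Rˣ) (u : Fin m → R) {r : ℕ}

theorem gen_mem_young {a : Lam m r} {k : ℕ} (h1 : 1 ≤ k) (h2 : k < r) (hk : ∀ j, a.seq j ≠ k) :
    gen q u r k ∈ young q u a :=
  Algebra.subset_adjoin ⟨k, h1, h2, hk, rfl⟩

theorem young_commute {a : Lam m r} {x y : AK m r q u} (hy : y ∈ young q u a)
    (h : ∀ k, 1 ≤ k → k < r → (∀ j, a.seq j ≠ k) → Commute (gen q u r k) x) : Commute y x := by
  induction hy using Algebra.adjoin_induction with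
  | mem y hy =>
    obtain ⟨k, h1, h2, hk, rfl⟩ := hy
    exact h k h1 h2 hk
  | algebraMap c => exact Algebra.commutes c x
  | add y z _ _ hy hz => exact hy.add_left hz
  | mul y z _ _ hy hz => exact hy.mul_left hz

theorem young_commute_stairPoly {a : Lam m r} {y : AK m r q u} (hy : y ∈ young q u a)
    (v : Fin m → R) {J : Finset (Fin m)} {n : Fin m → ℕ} (hn : ∀ i ∈ J, ∃ j, a.seq j = n i) :
    Commute y (jmPoly q u r (stairPoly v J n)) := by
  refine young_commute q u hy fun k h1 _ hk => gen_commute_stairPoly q u r v h1 fun j hj e => ?_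
  obtain ⟨i, hi⟩ := hn j hj
  exact hk i (hi.trans e.symm)

/-- If `w` reverses the blocks then `T_w = y T_{w_a}` with a unit `y` from the Young subalgebra. -/
theorem exists_T_eq_mul_T_perm {a : Lam m r} {w : Equiv.Perm (Fin r)} (h : a.Reverses w) :
    ∃ y ∈ young q u a, IsUnit y ∧ T q u w = y * T q u a.perm := by
  induction hn : inversions w using Nat.strong_induction_on generalizing w with
  | _ n ih =>
    by_cases hd : ∃ k, IsDescent w k ∧ ∀ j, a.seq j ≠ k
    · obtain ⟨k, hk, hj⟩ := hd
      have hk' := hk.choose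
      obtain ⟨y, h1, h2, h3⟩ := ih _ (hn ▸ inversions_lt hk) (w := w * simpleRefl r k)
        (fun i p hp => h i _ (simpleRefl_val_lt (hj i).symm hp)) rfl
      refine ⟨gen q u r k * y, mul_mem (gen_mem_young q u hk'.1 hk'.2 hj) h1,
        (isUnit_gen q u r hk'.1 hk'.2).mul h2, ?_⟩
      rw [T_of_isDescent q u hk, h3, mul_assoc]
    · push Not at hd
      exact ⟨1, one_mem _, isUnit_one, by rw [h.eq_perm hd, one_mul]⟩

/-! ### The elements `v_a` -/

/-- With zero-based parameters, u_i has exponent a_i on the left and r - a_{i+1} on the right. Thus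
for every l the left exponents are at least a_l for i ≥ l, and the right ones at least r - a_l for i
< l: the shape that the vanishing lemma needs. -/
theorem vElt_eq (a : Lam m r) : vElt q u a =
    jmPoly q u r (stairPoly u Finset.univ fun i => a.seq i) * T q u a.perm *
      jmPoly q u r (stairPoly u Finset.univ fun i => r - a.seq (i + 1)) := by
  rw [vElt, piElt_eq, piTilde_eq]
  congr 4
  funext i
  change r - a.seq (m - (m - (i + 1))) = _
  rw [Nat.sub_sub_self (by omega)]

theorem piTilde_dual_eq (a : Lam m r) : piTilde q u a.dual =
    jmPoly q u r (stairPoly u Finset.univ fun i => r - a.seq (i + 1)) := by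
  rw [piTilde_eq]
  congr 2
  funext i
  change r - a.seq (m - (m - (i + 1))) = _
  rw [Nat.sub_sub_self (by omega)]

/-- A violation of the reversing property at i is exactly the witness for the vanishing lemma with
bounds a_i and r - a_i. -/
theorem stair_mul_T_mul_stair_of_not_reverses {a : Lam m r} {w : Equiv.Perm (Fin r)}
    (h : ¬ a.Reverses w) :
    jmPoly q u r (stairPoly u Finset.univ fun i => a.seq i) * T q u w *
      jmPoly q u r (stairPoly u Finset.univ fun i => r - a.seq (i + 1)) = 0 := by
  simp only [Lam.Reverses, not_forall, not_le] at h
  obtain ⟨i, p, h1, h2⟩ := h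
  refine stair_mul_T_mul_stair q u (Finset.univ.filter fun j : Fin m => i ≤ j) (a.seq i)
    (r - a.seq i) (fun j hj => ?_) (fun j hj => ?_) w p h1 h2
  · exact a.mono (Finset.mem_filter.mp hj).2
  · rw [Finset.mem_filter, not_and, not_le] at hj
    exact Nat.sub_le_sub_left (a.mono (hj (Finset.mem_univ _))) r

/-- Since a_i + (r - b_i) > r, the pigeonhole argument supplies a witness for the vanishing lemma
whatever w is. -/
theorem piElt_mul_mul_piTilde_dual_of_lt {a b : Lam m r} {i : ℕ} (h : b.seq i < a.seq i)
    (x : AK m r q u) : piElt q u a * x * piTilde q u b.dual = 0 := by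
  have hx : x ∈ (⊤ : Submodule R (AK m r q u)) := trivial
  rw [piElt_eq, piTilde_dual_eq]
  rw [← span_T_mul_jmPoly q u r] at hx
  induction hx using Submodule.span_induction with
  | mem x hx =>
    obtain ⟨w, f, rfl⟩ := hx
    have h1 := a.le_top i
    obtain ⟨p, hp, hw⟩ := exists_lt_apply_lt h1 (Nat.sub_le r (b.seq i)) (by omega) w
    rw [← mul_assoc, mul_assoc, (jmPoly_commute q u r f _).eq, ← mul_assoc,
      stair_mul_T_mul_stair q u (Finset.univ.filter fun j : Fin m => i ≤ j) (a.seq i)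
      (r - b.seq i) (fun j hj => ?_) (fun j hj => ?_) w p hp hw, zero_mul]
    · exact a.mono (Finset.mem_filter.mp hj).2
    · rw [Finset.mem_filter, not_and, not_le] at hj
      exact Nat.sub_le_sub_left (b.mono (hj (Finset.mem_univ _))) r
  | zero => rw [mul_zero, zero_mul]
  | add x y _ _ hx hy => rw [mul_add, add_mul, hx, hy, add_zero]
  | smul c x _ hx => rw [mul_smul_comm, smul_mul_assoc, hx, smul_zero]

/-- The mirror image: the large exponents on the left now belong to the indices below i, and (r -
a_i) + b_i > r. -/
theorem piTilde_dual_mul_mul_piElt_of_lt {a b : Lam m r} {i : ℕ} (h : a.seq i < b.seq i)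
    (x : AK m r q u) : piTilde q u a.dual * x * piElt q u b = 0 := by
  have hx : x ∈ (⊤ : Submodule R (AK m r q u)) := trivial
  rw [piElt_eq, piTilde_dual_eq]
  rw [← span_T_mul_jmPoly q u r] at hx
  induction hx using Submodule.span_induction with
  | mem x hx =>
    obtain ⟨w, f, rfl⟩ := hx
    have h1 := b.le_top i
    obtain ⟨p, hp, hw⟩ := exists_lt_apply_lt (Nat.sub_le r (a.seq i)) h1 (by omega) w
    rw [← mul_assoc, mul_assoc, (jmPoly_commute q u r f _).eq, ← mul_assoc,
      stair_mul_T_mul_stair q u (Finset.univ.filter fun j : Fin m => j < i) (r - a.seq i)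
      (b.seq i) (fun j hj => ?_) (fun j hj => ?_) w p hp hw, zero_mul]
    · exact Nat.sub_le_sub_left (a.mono (Finset.mem_filter.mp hj).2) r
    · rw [Finset.mem_filter, not_and, not_lt] at hj
      exact b.mono (hj (Finset.mem_univ _))
  | zero => rw [mul_zero, zero_mul]
  | add x y _ _ hx hy => rw [mul_add, add_mul, hx, hy, add_zero]
  | smul c x _ hx => rw [mul_smul_comm, smul_mul_assoc, hx, smul_zero]

/-- At an index where the sequences differ, either the two outer or the two inner polynomial factors
annihilate what lies between them, according to which entry is larger. -/
theorem vElt_mul_mul_vElt_of_ne {a b : Lam m r} (h : a ≠ b) (x : AK m r q u) :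
    vElt q u a * x * vElt q u b = 0 := by
  have h1 : ∃ i, a.seq i ≠ b.seq i := by
    by_contra hc
    push Not at hc
    exact h (Lam.ext (funext hc))
  obtain ⟨i, hi⟩ := h1
  rw [vElt, vElt]
  rcases Nat.lt_or_gt_of_ne hi with hlt | hlt
  · calc _ = piElt q u a * T q u a.perm * (piTilde q u a.dual * x * piElt q u b) *
        T q u b.perm * piTilde q u b.dual := by simp only [mul_assoc]
      _ = 0 := by rw [piTilde_dual_mul_mul_piElt_of_lt q u hlt]; simp
  · calc _ = piElt q u a * (T q u a.perm * piTilde q u a.dual * x * piElt q u b *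
        T q u b.perm) * piTilde q u b.dual := by simp only [mul_assoc]
      _ = 0 := piElt_mul_mul_piTilde_dual_of_lt q u hlt _

theorem gen_mul_T_perm (a : Lam m r) {k : ℕ} (h1 : 1 ≤ k) (h2 : k < r) (hk : ∀ j, a.seq j ≠ k) :
    gen q u r k * T q u a.perm = T q u a.perm * gen q u r (a.perm ⟨k, h2⟩).val := by
  obtain ⟨h3, _⟩ := a.perm_adjacent h1 h2 hk
  have h4 := (a.perm ⟨k, h2⟩).2
  refine gen_mul_T_eq_T_mul_gen q u ⟨h1, h2⟩ ⟨by omega, h4⟩ (Fin.ext ?_) (Fin.ext rfl)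
  simp only
  omega

/-- T_k passes the left polynomial because k is no entry of a. Crossing T_{w_a} replaces k by its
image, which is no entry of a', so the new generator passes the right polynomial as well. -/
theorem gen_mul_vElt (a : Lam m r) {k : ℕ} (h1 : 1 ≤ k) (h2 : k < r) (hk : ∀ j, a.seq j ≠ k) :
    gen q u r k * vElt q u a = vElt q u a * gen q u r (a.perm ⟨k, h2⟩).val := by
  obtain ⟨h3, h4⟩ := a.perm_adjacent h1 h2 hk
  have h5 := (a.perm ⟨k, h2⟩).2
  have c1 : Commute (gen q u r k) (jmPoly q u r (stairPoly u Finset.univ fun i => a.seq i)) :=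
    young_commute_stairPoly q u (gen_mem_young q u h1 h2 hk) u fun i _ => ⟨_, rfl⟩
  have c2 : Commute (gen q u r (a.perm ⟨k, h2⟩).val)
      (jmPoly q u r (stairPoly u Finset.univ fun i => a.dual.seq i.rev)) :=
    young_commute_stairPoly q u (gen_mem_young q u (by omega) h5 h4) u fun i _ => ⟨_, rfl⟩
  rw [vElt, piElt_eq, piTilde_eq, ← mul_assoc, ← mul_assoc, c1.eq, mul_assoc _ _ (T q u a.perm),
    gen_mul_T_perm q u a h1 h2 hk, mul_assoc _ _ (gen q u r _), ← c2.eq]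
  simp only [mul_assoc]

theorem vElt_mul_gen (a : Lam m r) {l : ℕ} (h1 : 1 ≤ l) (h2 : l < r)
    (hl : ∀ j, a.dual.seq j ≠ l) :
    ∃ k, gen q u r k ∈ young q u a ∧ vElt q u a * gen q u r l = gen q u r k * vElt q u a := by
  obtain ⟨h3, h4⟩ := a.dual.perm_adjacent h1 h2 hl
  rw [a.dual_dual] at h4
  have h5 : 1 ≤ (a.dual.perm ⟨l, h2⟩).val := by omega
  refine ⟨(a.dual.perm ⟨l, h2⟩).val, gen_mem_young q u h5 (Fin.is_lt _) h4, ?_⟩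
  rw [gen_mul_vElt q u a h5 (Fin.is_lt _) h4, Fin.eta, a.perm_dual_perm]

/-- The elements of the Young subalgebra commute with `v_a T_{w_{a'}}`. -/
theorem young_commute_vElt_mul_T {a : Lam m r} {y : AK m r q u} (hy : y ∈ young q u a) :
    Commute y (vElt q u a * T q u a.dual.perm) := by
  refine young_commute q u hy fun k h1 h2 hk => ?_
  obtain ⟨h3, h4⟩ := a.perm_adjacent h1 h2 hk
  rw [Commute, SemiconjBy, ← mul_assoc, gen_mul_vElt q u a h1 h2 hk, mul_assoc,
    gen_mul_T_perm q u a.dual (by omega) (Fin.is_lt _) h4, Fin.eta, a.dual_perm_perm, mul_assoc]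

/-- The submodule `H(S_a) v_a`. -/
noncomputable def youngMul (a : Lam m r) : Submodule R (AK m r q u) :=
  (Subalgebra.toSubmodule (young q u a)).map (LinearMap.mulRight R (vElt q u a))

theorem mem_youngMul {a : Lam m r} {x : AK m r q u} :
    x ∈ youngMul q u a ↔ ∃ y ∈ young q u a, y * vElt q u a = x := Iff.rfl

theorem mul_mem_youngMul {a : Lam m r} {x y : AK m r q u} (hy : y ∈ young q u a)
    (hx : x ∈ youngMul q u a) : y * x ∈ youngMul q u a := by
  obtain ⟨z, hz, rfl⟩ := hx
  exact ⟨y * z, (young q u a).mul_mem hy hz, mul_assoc _ _ _⟩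

theorem stairPoly_update (v : Fin m → R) (n : Fin m → ℕ) (i : Fin m) :
    stairPoly v Finset.univ n * (MvPolynomial.X (n i) - MvPolynomial.C (v i)) =
      stairPoly v Finset.univ (Function.update n i (n i + 1)) := by
  rw [stairPoly, stairPoly, ← Finset.mul_prod_erase _ _ (Finset.mem_univ i),
    ← Finset.mul_prod_erase _ (fun k => ∏ j ∈ Finset.range (Function.update n i (n i + 1) k), _)
      (Finset.mem_univ i), Function.update_self, Finset.prod_range_succ, mul_right_comm]
  congr 1
  refine Finset.prod_congr rfl fun k hk => ?_
  rw [Function.update_of_ne (Finset.ne_of_mem_erase hk)]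

/-- `L_{j+1}` acts on `v_a` as a scalar if `j + 1` is the first letter of a block of `a'`. -/
theorem vElt_mul_jm_of_first (a : Lam m r) {j l : ℕ} (hj : j < r) (hl : a.dual.seq l = j) :
    ∃ c : R, vElt q u a * jm q u r (j + 1) = c • vElt q u a := by
  obtain ⟨b1, b2, b3⟩ := a.dual.block_spec ⟨j, hj⟩
  have b4 := a.dual.block_le ⟨j, hj⟩
  set b := a.dual.block ⟨j, hj⟩
  have e1 : a.dual.seq (b - 1) = j := by
    refine le_antisymm b2 (hl ▸ a.dual.mono ?_)
    by_contra hc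
    have := a.dual.mono (show b ≤ l by omega)
    simp only at b3
    omega
  change j < r - a.seq (m - b) at b3
  change r - a.seq (m - (b - 1)) = j at e1
  -- The start j of block b of a' is r - a_{m-b+1}. So u_i with zero-based i = m - b is a parameter
  -- whose right exponent is exactly j, and the factor L_{j+1} - u_i raises it by one.
  set i : Fin m := ⟨m - b, by omega⟩ with hi
  have hlt := a.le_top (i.val + 1)
  have e2 : r - a.seq (i.val + 1) = j := by
    rw [hi]
    simp only
    rw [show m - b + 1 = m - (b - 1) by omega, e1]
  set n : Fin m → ℕ := fun i => r - a.seq (i + 1) with hn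
  have e3 : jmPoly q u r (stairPoly u Finset.univ n) * (jm q u r (j + 1) - algebraMap R _ (u i)) =
      jmPoly q u r (stairPoly u Finset.univ (Function.update n i (n i + 1))) := by
    have e : n i = j := e2
    rw [← stairPoly_update, e, map_mul, map_sub, jmPoly_X, jmPoly_C]
  -- Here a_{i+1} + (j + 1) = r + 1, just enough for the pigeonhole, so v_a (L_{j+1} - u_i) = 0.
  obtain ⟨p, hp, hw⟩ := exists_lt_apply_lt (A := a.seq (i.val + 1)) (B := j + 1) hlt hj
    (by omega) a.perm
  have e4 := stair_mul_T_mul_stair q u (Finset.univ.filter fun k : Fin m => i.val + 1 ≤ k)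
    (a.seq (i.val + 1)) (j + 1) (n := fun i => a.seq i)
    (n' := Function.update n i (n i + 1)) (fun k hk => a.mono (Finset.mem_filter.mp hk).2)
    (fun k hk => ?_) a.perm p hp hw
  · refine ⟨u i, ?_⟩
    rw [vElt_eq, ← sub_eq_zero, Algebra.smul_def, Algebra.commutes, ← mul_sub, mul_assoc, e3, e4]
  · rw [Finset.mem_filter, not_and, not_le] at hk
    have hk := hk (Finset.mem_univ _)
    rcases eq_or_ne k i with rfl | hne
    · rw [Function.update_self]
      exact (congrArg (· + 1) e2).ge
    · rw [Function.update_of_ne hne]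
      have hki : k.val + 1 ≤ i.val := by
        have : k.val ≠ i.val := fun h => hne (Fin.ext h)
        omega
      have := a.mono hki
      have hi' : i.val = m - b := rfl
      rw [hi'] at this
      simp only [hn]
      omega

/-- At the first letter of a block of a' the action is by a scalar. Inside a block, L_{j+1} arises
from L_j by multiplication with T_j on both sides, and T_j moves to the left through v_a as a Young
generator. -/
theorem vElt_mul_jm_mem (a : Lam m r) {j : ℕ} (hj : j < r) :
    vElt q u a * jm q u r (j + 1) ∈ youngMul q u a := by
  have hself : vElt q u a ∈ youngMul q u a := ⟨1, (young q u a).one_mem, one_mul _⟩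
  have hgen : ∀ l, 1 ≤ l → l < r → (∀ j, a.dual.seq j ≠ l) → ∀ x ∈ youngMul q u a,
      x * gen q u r l ∈ youngMul q u a := by
    rintro l h1 h2 hl _ ⟨y, hy, rfl⟩
    obtain ⟨k, h3, h4⟩ := vElt_mul_gen q u a h1 h2 hl
    refine ⟨y * gen q u r k, (young q u a).mul_mem hy h3, ?_⟩
    simp only [LinearMap.mulRight_apply]
    rw [mul_assoc, mul_assoc, h4]
  induction j with
  | zero =>
    obtain ⟨c, hc⟩ := vElt_mul_jm_of_first q u a hj a.dual.zero
    rw [hc]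
    exact (youngMul q u a).smul_mem c hself
  | succ j ih =>
    by_cases h : ∃ l, a.dual.seq l = j + 1
    · obtain ⟨l, hl⟩ := h
      obtain ⟨c, hc⟩ := vElt_mul_jm_of_first q u a hj hl
      rw [hc]
      exact (youngMul q u a).smul_mem c hself
    · push Not at h
      obtain ⟨k, h3, h4⟩ := vElt_mul_gen q u a (by omega) hj h
      rw [jm_succ q u r (by omega), mul_smul_comm, ← mul_assoc, ← mul_assoc, h4,
        mul_assoc (gen q u r k)]
      exact (youngMul q u a).smul_mem _
        (hgen _ (by omega) hj h _ (mul_mem_youngMul q u h3 (ih (by omega))))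

theorem youngMul_mul_jmPoly_mem {a : Lam m r} {x : AK m r q u} (hx : x ∈ youngMul q u a)
    (f : MvPolynomial ℕ R) : x * jmPoly q u r f ∈ youngMul q u a := by
  induction f using MvPolynomial.induction_on generalizing x with
  | C c =>
    rw [jmPoly_C, ← Algebra.commutes, ← Algebra.smul_def]
    exact (youngMul q u a).smul_mem c hx
  | add f g hf hg => rw [map_add, mul_add]; exact add_mem (hf hx) (hg hx)
  | mul_X f j hf =>
    rw [map_mul, jmPoly_X, ← mul_assoc]
    obtain ⟨y, hy, e⟩ := hf hx
    rw [← e, LinearMap.mulRight_apply, mul_assoc]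
    refine mul_mem_youngMul q u hy ?_
    by_cases hj : j < r
    · exact vElt_mul_jm_mem q u a hj
    · have : jm q u r (j + 1) = 0 := by
        rcases Nat.eq_zero_or_pos j with rfl | hj0
        · rw [jm_one, gen_of_le q u r (not_lt.mp hj)]
        · rw [jm_succ q u r hj0, gen_of_le q u r (not_lt.mp hj), mul_zero, smul_zero]
      rw [this, mul_zero]
      exact zero_mem _

/-- `π_a H π̃_{a'} ⊆ H(S_a) v_a`. -/
theorem piElt_mul_mul_piTilde_dual_mem (a : Lam m r) (x : AK m r q u) :
    piElt q u a * x * piTilde q u a.dual ∈ youngMul q u a := by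
  have hx : x ∈ (⊤ : Submodule R (AK m r q u)) := trivial
  rw [← span_T_mul_jmPoly q u r] at hx
  induction hx using Submodule.span_induction with
  | mem x hx =>
    obtain ⟨w, f, rfl⟩ := hx
    rw [← mul_assoc, mul_assoc, piTilde_eq, (jmPoly_commute q u r f _).eq, ← piTilde_eq,
      ← mul_assoc]
    refine youngMul_mul_jmPoly_mem q u ?_ f
    -- Only reversing w contribute; for them T_w is T_{w_a} times a Young element, which commutes
    -- with the polynomial on the left.
    by_cases hw : a.Reverses w
    · obtain ⟨y, hy, -, e⟩ := exists_T_eq_mul_T_perm q u hw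
      have c : Commute y (piElt q u a) := by
        rw [piElt_eq]
        exact young_commute_stairPoly q u hy u fun i _ => ⟨_, rfl⟩
      refine ⟨y, hy, ?_⟩
      rw [LinearMap.mulRight_apply, e, vElt, ← mul_assoc (piElt q u a) y, ← c.eq]
      simp only [mul_assoc]
    · rw [piElt_eq, piTilde_dual_eq, stair_mul_T_mul_stair_of_not_reverses q u hw]
      exact zero_mem _
  | zero => rw [mul_zero, zero_mul]; exact zero_mem _
  | add x y _ _ hx hy => rw [mul_add, add_mul]; exact add_mem hx hy
  | smul c x _ hx => rw [mul_smul_comm, smul_mul_assoc]; exact Submodule.smul_mem _ c hx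

theorem vElt_mul_mul_vElt_mem (a : Lam m r) (x : AK m r q u) :
    vElt q u a * x * vElt q u a ∈ youngMul q u a := by
  have := piElt_mul_mul_piTilde_dual_mem q u a
    (T q u a.perm * piTilde q u a.dual * x * piElt q u a * T q u a.perm)
  rw [vElt]
  simpa only [mul_assoc] using this

end

end ArikiKoike

namespace ArikiKoike

/-! ### An induced module -/

/-- Data for the construction of a module over `H_m^{r+1}`: an algebra `M` containing
elements `τ_0, …, τ_{r-1}` which satisfy the relations of `H_m^r`, an element `X` commuting with
them and satisfying the cyclotomic relation, and an operator `E`. -/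
structure InductionData {R M : Type*} [CommRing R] [Ring M] [Algebra R M] {m : ℕ} (q : Rˣ)
    (u : Fin m → R) (r : ℕ) where
  /-- the element commuting with the smaller algebra -/
  X : M
  /-- the generators of the smaller algebra -/
  τ : ℕ → M
  /-- the correction operator -/
  E : M →ₗ[R] M
  /-- the smaller algebra -/
  S : Set M
  commute_X : ∀ i, Commute X (τ i)
  mul_self : ∀ i, 1 ≤ i → i < r → τ i * τ i = ((q : R) - 1) • τ i + (q : R) • 1
  braid : ∀ i, 1 ≤ i → τ i * τ (i + 1) * τ i = τ (i + 1) * τ i * τ (i + 1)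
  braid_four : τ 0 * τ 1 * τ 0 * τ 1 = τ 1 * τ 0 * τ 1 * τ 0
  comm : ∀ i j, i + 2 ≤ j → Commute (τ i) (τ j)
  cyclotomic : 0 < r → ((List.finRange m).map fun k => τ 0 - algebraMap R M (u k)).prod = 0
  cyclotomic_X : ((List.finRange m).map fun k => X - algebraMap R M (u k)).prod = 0
  mul_mem : ∀ i, ∀ s ∈ S, τ i * s ∈ S
  span : Submodule.span R {z | ∃ (n : ℕ) (s : M), s ∈ S ∧ z = X ^ n * s} = ⊤
  -- In the model T_0^n T_1⋯T_r s of X^n s, this is the correction in T_0 T_1 T_0^n T_1 = T_1 T_0^n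
  -- T_1 T_0 + (q - 1)(T_0 T_1 T_0^n - T_0^n T_1 T_0), with the powers of T_0 moved past T_2⋯T_r.
  E_apply : 0 < r → ∀ n, ∀ s ∈ S, E (X ^ n * s) = (X * τ 0 ^ n - X ^ n * τ 0) * s

namespace InductionData

variable {R M : Type*} [CommRing R] [Ring M] [Algebra R M] {m : ℕ} {q : Rˣ} {u : Fin m → R} {r : ℕ}
variable (d : InductionData (M := M) q u r)

theorem linearMap_ext {P : Type*} [AddCommMonoid P] [Module R P] {f g : M →ₗ[R] P}
    (h : ∀ n, ∀ s ∈ d.S, f (d.X ^ n * s) = g (d.X ^ n * s)) : f = g := by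
  refine LinearMap.ext_on d.span ?_
  rintro _ ⟨n, s, hs, rfl⟩
  exact h n s hs

theorem pow_mul_mem (n : ℕ) {s : M} (hs : s ∈ d.S) : d.τ 0 ^ n * s ∈ d.S := by
  induction n with
  | zero => rwa [pow_zero, one_mul]
  | succ n ih => rw [pow_succ', mul_assoc]; exact d.mul_mem _ _ ih

theorem commute_pow (n i : ℕ) : d.τ i * d.X ^ n = d.X ^ n * d.τ i :=
  ((d.commute_X i).pow_left n).eq.symm

theorem commute_assoc (n i : ℕ) (s : M) : d.τ i * (d.X ^ n * s) = d.X ^ n * (d.τ i * s) := by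
  rw [← mul_assoc, commute_pow, mul_assoc]

theorem E_mul (hr : 0 < r) {j : ℕ} (hj : 2 ≤ j) (z : M) : d.E (d.τ j * z) = d.τ j * d.E z := by
  have h1 : Commute (d.τ j) (d.τ 0) := (d.comm 0 j hj).symm
  refine LinearMap.congr_fun (f := d.E ∘ₗ LinearMap.mulLeft R (d.τ j))
    (g := LinearMap.mulLeft R (d.τ j) ∘ₗ d.E) (d.linearMap_ext fun n s hs => ?_) z
  simp only [LinearMap.comp_apply, LinearMap.mulLeft_apply]
  rw [d.commute_assoc, d.E_apply hr _ _ (d.mul_mem _ _ hs), d.E_apply hr _ _ hs, ← mul_assoc,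
    ← mul_assoc]
  congr 1
  refine (Commute.sub_right ?_ ?_).eq.symm
  · exact (d.commute_X j).symm.mul_right (h1.pow_right n)
  · exact ((d.commute_X j).symm.pow_right n).mul_right h1

/-- The operator τ_0 + E sends X^n s to X τ_0^n s, and E kills X S because its two terms agree for n
= 1. -/
theorem E_add (hr : 0 < r) (z : M) : d.E (d.τ 0 * z + d.E z) = 0 := by
  refine LinearMap.congr_fun (f := d.E ∘ₗ (LinearMap.mulLeft R (d.τ 0) + d.E))
    (g := 0) (d.linearMap_ext fun n s hs => ?_) z
  simp only [LinearMap.comp_apply, LinearMap.add_apply, LinearMap.mulLeft_apply,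
    LinearMap.zero_apply]
  rw [d.E_apply hr _ _ hs, ← mul_assoc, d.commute_pow, ← add_mul, add_sub_cancel, mul_assoc]
  have := d.E_apply hr 1 _ (d.pow_mul_mem n hs)
  rw [pow_one, pow_one, sub_self, zero_mul] at this
  exact this

/-- On X^n s both sides are X τ_0^{n+1} s. With `E_add` this is the four-term braid relation on
summand 0. -/
theorem E_X (hr : 0 < r) (z : M) :
    d.τ 0 * (d.τ 0 * z + d.E z) = d.τ 0 * (d.X * z) + d.E (d.X * z) := by
  refine LinearMap.congr_fun
    (f := LinearMap.mulLeft R (d.τ 0) ∘ₗ (LinearMap.mulLeft R (d.τ 0) + d.E))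
    (g := LinearMap.mulLeft R (d.τ 0) ∘ₗ LinearMap.mulLeft R d.X + d.E ∘ₗ LinearMap.mulLeft R d.X)
    (d.linearMap_ext fun n s hs => ?_) z
  simp only [LinearMap.comp_apply, LinearMap.add_apply, LinearMap.mulLeft_apply]
  have e : d.X * (d.X ^ n * s) = d.X ^ (n + 1) * s := by rw [pow_succ', mul_assoc]
  rw [e, d.E_apply hr _ _ hs, d.E_apply hr _ _ hs, ← mul_assoc (d.τ 0), d.commute_pow, ← add_mul,
    ← mul_assoc (d.τ 0), ← mul_assoc (d.τ 0), d.commute_pow, ← add_mul, add_sub_cancel,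
    add_sub_cancel, ← mul_assoc, ← (d.commute_X 0).eq, pow_succ', mul_assoc d.X]

/-- The commutator of `τ_0` and `τ_1 τ_0^n τ_1`. -/
theorem commutator (hr : 1 < r) (n : ℕ) :
    d.τ 0 * (d.τ 1 * d.τ 0 ^ n * d.τ 1) = d.τ 1 * d.τ 0 ^ n * d.τ 1 * d.τ 0 +
      ((q : R) - 1) • (d.τ 0 * d.τ 1 * d.τ 0 ^ n - d.τ 0 ^ n * d.τ 1 * d.τ 0) := by
  have h2 := d.mul_self 1 le_rfl hr
  have h4 := d.braid_four
  generalize d.τ 0 = a at *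
  generalize d.τ 1 = b at *
  induction n with
  | zero =>
    simp only [pow_zero, mul_one, one_mul, h2, mul_add, add_mul, mul_smul_comm, smul_mul_assoc]
    module
  | succ n ih =>
    have hY : Commute a (b * a * b) := by
      rw [Commute, SemiconjBy, ← mul_assoc, ← mul_assoc, h4]
    have hYn := (hY.pow_left n).eq
    -- With Y = b a b commuting with a, this expresses b a^{n+1} b through Y b a^n b and so lowers
    -- the exponent. The identity is proved after multiplication by the unit q.
    have hq : (q : R) • (b * a ^ (n + 1) * b) =
        b * a * b * (b * a ^ n * b) - ((q : R) - 1) • (b * a * b * (a ^ n * b)) := by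
      have : b * a * b * (b * a ^ n * b) = b * a * (b * b) * (a ^ n * b) := by
        simp only [mul_assoc]
      rw [this, h2, mul_add, add_mul, mul_smul_comm, mul_smul_comm, smul_mul_assoc,
        smul_mul_assoc, mul_one, pow_succ']
      simp only [mul_assoc]
      module
    have e1 : b * a * b * (a * (b * a ^ n)) =
        ((q : R) - 1) • (a * (b * a * b) * a ^ n) + (q : R) • (a * b * a ^ (n + 1)) := by
      have : b * a * b * (a * (b * a ^ n)) = a * (b * a * (b * b)) * a ^ n := by
        rw [← mul_assoc _ a, ← hY.eq]
        simp only [mul_assoc]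
      rw [this, h2, pow_succ']
      simp only [mul_add, add_mul, mul_smul_comm, smul_mul_assoc, mul_one, mul_assoc]
    have e2 : b * a * b * (a ^ (n + 1) * b) =
        ((q : R) - 1) • (a ^ (n + 1) * (b * a * b)) + (q : R) • (a ^ (n + 1) * b * a) := by
      have : b * a * b * (a ^ (n + 1) * b) = a ^ (n + 1) * (b * a * (b * b)) := by
        rw [← mul_assoc _ (a ^ (n + 1)), ← (hY.pow_left (n + 1)).eq]
        simp only [mul_assoc]
      rw [this, h2]
      simp only [mul_add, mul_smul_comm, mul_one, mul_assoc]
    have e3 : a * (b * a * b) * a ^ n = a ^ (n + 1) * (b * a * b) := by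
      rw [mul_assoc a, ← hYn, pow_succ']
      simp only [mul_assoc]
    have key : (q : R) • (a * (b * a ^ (n + 1) * b)) = (q : R) •
        (b * a ^ (n + 1) * b * a +
          ((q : R) - 1) • (a * b * a ^ (n + 1) - a ^ (n + 1) * b * a)) := by
      have f1 : (q : R) • (a * (b * a ^ (n + 1) * b)) = a * ((q : R) • (b * a ^ (n + 1) * b)) :=
        (mul_smul_comm _ _ _).symm
      have f2 : (q : R) • (b * a ^ (n + 1) * b * a) = (q : R) • (b * a ^ (n + 1) * b) * a :=
        (smul_mul_assoc _ _ _).symm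
      rw [smul_add, f1, f2, hq, mul_sub, ← mul_assoc a, hY.eq,
        mul_assoc _ a, ih, mul_smul_comm, ← mul_assoc a _ (a ^ n * b), hY.eq, sub_mul,
        smul_mul_assoc, mul_add, mul_smul_comm, mul_sub]
      have e4 : b * a * b * (a * b * a ^ n) = b * a * b * (a * (b * a ^ n)) := by
        simp only [mul_assoc]
      have e5 : b * a * b * a * (a ^ n * b) = b * a * b * (a ^ (n + 1) * b) := by
        rw [pow_succ']; simp only [mul_assoc]
      have e6 : b * a * b * (a ^ n * b) * a = b * a * b * (a ^ n * b * a) := by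
        simp only [mul_assoc]
      have e7 : b * a * b * (b * a ^ n * b) * a = b * a * b * (b * a ^ n * b * a) := by
        simp only [mul_assoc]
      rw [e4, e5, e6, e7, e1, e2, e3]
      module
    have := congrArg (fun x => ((q⁻¹ : Rˣ) : R) • x) key
    simpa only [smul_smul, Units.inv_mul, one_smul] using this

theorem E_apply' (hr : 0 < r) (n : ℕ) {s : M} (hs : s ∈ d.S) :
    d.E (d.X ^ n * s) = d.X * (d.τ 0 ^ n * s) - d.X ^ n * (d.τ 0 * s) := by
  rw [d.E_apply hr n s hs, sub_mul, mul_assoc, mul_assoc]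

theorem E_gen_mul_E (hr : 0 < r) (j n : ℕ) {s : M} (hs : s ∈ d.S) :
    d.E (d.τ j * (d.X * (d.τ 0 ^ n * s) - d.X ^ n * (d.τ 0 * s))) =
      d.X ^ n * (d.τ 0 * (d.τ j * (d.τ 0 * s))) - d.X * (d.τ 0 ^ n * (d.τ j * (d.τ 0 * s))) := by
  have h1 := d.commute_assoc 1 j (d.τ 0 ^ n * s)
  have h2 := d.E_apply' hr 1 (d.mul_mem j _ (d.pow_mul_mem n hs))
  rw [pow_one] at h1 h2
  rw [mul_sub, h1, d.commute_assoc, map_sub, h2,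
    d.E_apply' hr n (d.mul_mem _ _ (d.mul_mem _ _ hs)), pow_one]
  abel

/-- The component in summand 1 of the four-term braid relation on the summands k ≥ 2; `E_braid_zero`
is the component in summand 0. Both reduce to `commutator` and the braid relation of τ_0 and τ_1. -/
theorem E_braid_one (hr : 1 < r) (z : M) :
    d.τ 0 * (d.τ 1 * d.E (d.τ 1 * z)) = d.τ 1 * d.E (d.τ 1 * (d.τ 0 * z)) +
      ((q : R) - 1) • (d.τ 0 * (d.τ 1 * d.E z)) + ((q : R) - 1) • d.E (d.τ 1 * d.E z) := by
  refine LinearMap.congr_fun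
    (f := LinearMap.mulLeft R (d.τ 0) ∘ₗ LinearMap.mulLeft R (d.τ 1) ∘ₗ d.E ∘ₗ
      LinearMap.mulLeft R (d.τ 1))
    (g := LinearMap.mulLeft R (d.τ 1) ∘ₗ d.E ∘ₗ LinearMap.mulLeft R (d.τ 1) ∘ₗ
      LinearMap.mulLeft R (d.τ 0) + ((q : R) - 1) • (LinearMap.mulLeft R (d.τ 0) ∘ₗ
      LinearMap.mulLeft R (d.τ 1) ∘ₗ d.E) +
      ((q : R) - 1) • (d.E ∘ₗ LinearMap.mulLeft R (d.τ 1) ∘ₗ d.E))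
    (d.linearMap_ext fun n s hs => ?_) z
  simp only [LinearMap.comp_apply, LinearMap.add_apply, LinearMap.mulLeft_apply,
    LinearMap.smul_apply]
  have hX : ∀ i y, d.τ i * (d.X * y) = d.X * (d.τ i * y) := fun i y => by
    simpa using d.commute_assoc 1 i y
  have hr0 : 0 < r := by omega
  have hb := d.mul_mem 1 s hs
  have c1 := congrArg (fun y => d.X * (y * s)) (d.commutator hr n)
  have c2 := congrArg (fun y => d.X ^ n * (y * s)) d.braid_four
  rw [d.commute_assoc n 1, d.commute_assoc n 0, d.commute_assoc n 1, d.E_apply' hr0 n hb,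
    d.E_apply' hr0 n (d.mul_mem _ _ (d.mul_mem _ _ hs)), d.E_apply' hr0 n hs,
    d.E_gen_mul_E hr0 1 n hs]
  simp only [add_mul, sub_mul, mul_add, mul_sub, mul_assoc, smul_mul_assoc, mul_smul_comm, hX,
    d.commute_assoc] at c1 c2 ⊢
  linear_combination (norm := module) c1 - c2

theorem E_braid_zero (hr : 1 < r) (z : M) :
    d.τ 1 * d.E (d.τ 1 * (d.τ 0 * (d.τ 1 * z))) +
      ((q : R) - 1) • d.E (d.τ 1 * d.E (d.τ 1 * z)) = (q : R) • (d.τ 0 * (d.τ 1 * d.E z)) := by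
  refine LinearMap.congr_fun
    (f := LinearMap.mulLeft R (d.τ 1) ∘ₗ d.E ∘ₗ LinearMap.mulLeft R (d.τ 1) ∘ₗ
      LinearMap.mulLeft R (d.τ 0) ∘ₗ LinearMap.mulLeft R (d.τ 1) +
      ((q : R) - 1) • (d.E ∘ₗ LinearMap.mulLeft R (d.τ 1) ∘ₗ d.E ∘ₗ LinearMap.mulLeft R (d.τ 1)))
    (g := (q : R) • (LinearMap.mulLeft R (d.τ 0) ∘ₗ LinearMap.mulLeft R (d.τ 1) ∘ₗ d.E))
    (d.linearMap_ext fun n s hs => ?_) z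
  simp only [LinearMap.comp_apply, LinearMap.add_apply, LinearMap.mulLeft_apply,
    LinearMap.smul_apply]
  have hX : ∀ i y, d.τ i * (d.X * y) = d.X * (d.τ i * y) := fun i y => by
    simpa using d.commute_assoc 1 i y
  have hr0 : 0 < r := by omega
  have hb := d.mul_mem 1 s hs
  have h2 : ∀ y, d.τ 1 * (d.τ 1 * y) = ((q : R) - 1) • (d.τ 1 * y) + (q : R) • y := fun y => by
    rw [← mul_assoc, d.mul_self 1 le_rfl hr, add_mul, smul_mul_assoc, smul_mul_assoc, one_mul]
  have c1 := congrArg (fun y => d.X * (y * (d.τ 1 * s))) (d.commutator hr n)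
  have c2 := congrArg (fun y => d.X ^ n * (y * (d.τ 1 * s))) d.braid_four
  rw [d.commute_assoc n 1, d.commute_assoc n 0, d.commute_assoc n 1, d.E_apply' hr0 n hb,
    d.E_apply' hr0 n (d.mul_mem _ _ (d.mul_mem _ _ hb)), d.E_apply' hr0 n hs,
    d.E_gen_mul_E hr0 1 n hb]
  simp only [add_mul, sub_mul, mul_add, mul_sub, mul_assoc, smul_mul_assoc, mul_smul_comm, hX,
    d.commute_assoc, h2] at c1 c2 ⊢
  linear_combination (norm := module) c2 - c1

/-- The product `τ_k ⋯ τ_1`. -/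
def chain : ℕ → M
  | 0 => 1
  | k + 1 => d.τ (k + 1) * chain k

/-- The product `τ_{k+1} ⋯ τ_2`. -/
def chainTail : ℕ → M
  | 0 => 1
  | k + 1 => d.τ (k + 2) * chainTail k

theorem chain_succ (k : ℕ) : d.chain (k + 1) = d.τ (k + 1) * d.chain k := rfl

theorem chain_commute {j k : ℕ} (h : k + 2 ≤ j) : Commute (d.τ j) (d.chain k) := by
  induction k with
  | zero => exact Commute.one_right _
  | succ k ih => exact (d.comm (k + 1) j (by omega)).symm.mul_right (ih (by omega))

theorem chain_mul {j k : ℕ} (h1 : 1 ≤ j) (h : j + 1 ≤ k) :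
    d.chain k * d.τ (j + 1) = d.τ j * d.chain k := by
  induction k, h using Nat.le_induction with
  | base =>
    obtain ⟨i, rfl⟩ : ∃ i, j = i + 1 := ⟨j - 1, by omega⟩
    have h1 := (d.chain_commute (k := i) (j := i + 2) le_rfl).eq
    rw [chain_succ, chain_succ, mul_assoc, mul_assoc, ← h1, ← mul_assoc, ← mul_assoc,
      ← d.braid (i + 1) (by omega)]
    simp only [mul_assoc]
  | succ k hk ih =>
    rw [chain_succ, mul_assoc, ih, ← mul_assoc, ← mul_assoc, (d.comm j (k + 1) (by omega)).eq]

theorem chainTail_mul (k : ℕ) : d.chainTail k * d.τ 1 = d.chain (k + 1) := by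
  induction k with
  | zero => simp [chain, chainTail]
  | succ k ih => rw [chainTail, mul_assoc, ih]; rfl

theorem chainTail_commute_zero (k : ℕ) : Commute (d.τ 0) (d.chainTail k) := by
  induction k with
  | zero => exact Commute.one_right _
  | succ k ih => exact (d.comm 0 (k + 2) (by omega)).mul_right ih

theorem E_chainTail_mul (hr : 0 < r) (k : ℕ) (z : M) :
    d.E (d.chainTail k * z) = d.chainTail k * d.E z := by
  induction k with
  | zero => simp [chainTail]
  | succ k ih => rw [chainTail, mul_assoc, d.E_mul hr (by omega), ih, mul_assoc]

variable (r M) in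
/-- The module `⊕_{k ≤ r} M`. -/
abbrev Ind : Type _ := Fin (r + 1) →₀ M

variable (R r M) in
/-- The inclusion of the summand of index `k`. -/
noncomputable def inc (k : ℕ) : M →ₗ[R] Ind (M := M) (r := r) :=
  if h : k < r + 1 then Finsupp.lsingle ⟨k, h⟩ else 0

theorem ind_ext {P : Type*} [AddCommMonoid P] [Module R P] {f g : Ind M r →ₗ[R] P}
    (h : ∀ k ≤ r, ∀ z, f (inc R M r k z) = g (inc R M r k z)) : f = g := by
  refine Finsupp.lhom_ext' fun k => LinearMap.ext fun z => ?_
  have := h k (by omega) z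
  rwa [inc, dif_pos k.2] at this

/-- The action of `T_i`. -/
noncomputable def act (i : ℕ) : Ind M r →ₗ[R] Ind M r :=
  Finsupp.lsum R fun k : Fin (r + 1) =>
    -- Summand k stands for T_k⋯T_1 applied to summand 0, where T_0 is X and T_{i+1} is τ_i for i ≥
    -- 1. Each branch is what the relations of the algebra then force.
    if i = 0 then
      if k.val = 0 then inc R M r 0 ∘ₗ LinearMap.mulLeft R d.X
      else inc R M r k ∘ₗ LinearMap.mulLeft R (d.τ 0) +
        ((q : R) - 1) • (inc R M r 0 ∘ₗ LinearMap.mulLeft R (d.chain (k.val - 1)) ∘ₗ d.E)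
    else if k.val + 2 ≤ i then inc R M r k ∘ₗ LinearMap.mulLeft R (d.τ (i - 1))
    else if i = k.val + 1 then inc R M r (k.val + 1)
    else if i = k.val then (q : R) • inc R M r (k.val - 1) + ((q : R) - 1) • inc R M r k
    else inc R M r k ∘ₗ LinearMap.mulLeft R (d.τ i)

theorem act_inc {i k : ℕ} (hk : k ≤ r) (z : M) : d.act i (inc R M r k z) =
    (if i = 0 then
      if k = 0 then inc R M r 0 ∘ₗ LinearMap.mulLeft R d.X
      else inc R M r k ∘ₗ LinearMap.mulLeft R (d.τ 0) +
        ((q : R) - 1) • (inc R M r 0 ∘ₗ LinearMap.mulLeft R (d.chain (k - 1)) ∘ₗ d.E)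
    else if k + 2 ≤ i then inc R M r k ∘ₗ LinearMap.mulLeft R (d.τ (i - 1))
    else if i = k + 1 then inc R M r (k + 1)
    else if i = k then (q : R) • inc R M r (k - 1) + ((q : R) - 1) • inc R M r k
    else inc R M r k ∘ₗ LinearMap.mulLeft R (d.τ i)) z := by
  conv_lhs => rw [inc, dif_pos (show k < r + 1 by omega)]
  rw [act, Finsupp.lsingle_apply, Finsupp.lsum_single]

theorem act_zero_inc_zero (z : M) : d.act 0 (inc R M r 0 z) = inc R M r 0 (d.X * z) := by
  rw [d.act_inc (Nat.zero_le r), if_pos rfl, if_pos rfl]; rfl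

theorem act_zero_inc {k : ℕ} (hk : k + 1 ≤ r) (z : M) : d.act 0 (inc R M r (k + 1) z) =
    inc R M r (k + 1) (d.τ 0 * z) + ((q : R) - 1) • inc R M r 0 (d.chain k * d.E z) := by
  rw [d.act_inc hk, if_pos rfl, if_neg (by omega)]; rfl

theorem act_far {i k : ℕ} (hk : k ≤ r) (hi : k + 1 ≤ i) (z : M) :
    d.act (i + 1) (inc R M r k z) = inc R M r k (d.τ i * z) := by
  rw [d.act_inc hk, if_neg (by omega), if_pos (by omega)]; rfl

theorem act_up {k : ℕ} (hk : k ≤ r) (z : M) :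
    d.act (k + 1) (inc R M r k z) = inc R M r (k + 1) z := by
  rw [d.act_inc hk, if_neg (by omega), if_neg (by omega), if_pos rfl]

theorem act_down {k : ℕ} (hk : k + 1 ≤ r) (z : M) : d.act (k + 1) (inc R M r (k + 1) z) =
    (q : R) • inc R M r k z + ((q : R) - 1) • inc R M r (k + 1) z := by
  rw [d.act_inc hk, if_neg (by omega), if_neg (by omega), if_neg (by omega), if_pos rfl]; rfl

theorem act_near {i k : ℕ} (hk : k ≤ r) (h1 : 1 ≤ i) (hi : i < k) (z : M) :
    d.act i (inc R M r k z) = inc R M r k (d.τ i * z) := by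
  rw [d.act_inc hk, if_neg (by omega), if_neg (by omega), if_neg (by omega), if_neg (by omega)]
  rfl

end InductionData
end ArikiKoike

namespace ArikiKoike

/-! ### Quadratic, commutation and braid relations for the action -/

namespace InductionData

variable {R M : Type*} [CommRing R] [Ring M] [Algebra R M] {m : ℕ} {q : Rˣ} {u : Fin m → R} {r : ℕ}
variable (d : InductionData (M := M) q u r)

theorem mul_self_assoc {i : ℕ} (h1 : 1 ≤ i) (h2 : i < r) (z : M) :
    d.τ i * (d.τ i * z) = ((q : R) - 1) • (d.τ i * z) + (q : R) • z := by
  rw [← mul_assoc, d.mul_self i h1 h2, add_mul, smul_mul_assoc, smul_mul_assoc, one_mul]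

theorem comm_assoc {i j : ℕ} (h : i + 2 ≤ j) (z : M) :
    d.τ i * (d.τ j * z) = d.τ j * (d.τ i * z) := by
  rw [← mul_assoc, (d.comm i j h).eq, mul_assoc]

theorem act_mul_self {i : ℕ} (h1 : 1 ≤ i) (h2 : i ≤ r) :
    d.act i * d.act i = ((q : R) - 1) • d.act i + (q : R) • 1 := by
  refine ind_ext fun k hk z => ?_
  simp only [Module.End.mul_apply, LinearMap.add_apply, LinearMap.smul_apply, Module.End.one_apply]
  rcases Nat.lt_or_ge (k + 1) i with h | h
  · obtain ⟨j, rfl⟩ : ∃ j, i = j + 1 := ⟨i - 1, by omega⟩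
    simp (disch := omega) only [d.act_far, d.mul_self_assoc, map_add, map_smul]
  rcases Nat.lt_or_ge k i with h' | h'
  · obtain rfl : i = k + 1 := by omega
    simp (disch := omega) only [d.act_up, d.act_down]
    module
  rcases Nat.lt_or_ge i k with h3 | h3
  · simp (disch := omega) only [d.act_near, d.mul_self_assoc, map_add, map_smul]
  · obtain rfl : i = k := by omega
    obtain ⟨j, rfl⟩ : ∃ j, i = j + 1 := ⟨i - 1, by omega⟩
    simp (disch := omega) only [d.act_up, d.act_down, map_add, map_smul]
    module

theorem act_braid {i : ℕ} (h1 : 1 ≤ i) (h2 : i + 1 ≤ r) :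
    d.act i * d.act (i + 1) * d.act i = d.act (i + 1) * d.act i * d.act (i + 1) := by
  refine ind_ext fun k hk z => ?_
  simp only [Module.End.mul_apply]
  have hb : ∀ j, 1 ≤ j → ∀ y, d.τ j * (d.τ (j + 1) * (d.τ j * y)) =
      d.τ (j + 1) * (d.τ j * (d.τ (j + 1) * y)) := by
    intro j hj y
    simp only [← mul_assoc, d.braid j hj]
  rcases Nat.lt_or_ge (k + 1) i with h | h
  · obtain ⟨j, rfl⟩ : ∃ j, i = j + 1 := ⟨i - 1, by omega⟩
    simp (disch := omega) only [d.act_far, hb]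
  rcases Nat.lt_or_ge k i with h' | h'
  · obtain rfl : i = k + 1 := by omega
    simp (disch := omega) only [d.act_far, d.act_up]
    rw [d.act_near (by omega) (by omega) (by omega)]
  rcases Nat.lt_or_ge (i + 1) k with h3 | h3
  · simp (disch := omega) only [d.act_near, hb]
  rcases Nat.lt_or_ge i k with h4 | h4
  · obtain rfl : k = i + 1 := by omega
    obtain ⟨j, rfl⟩ : ∃ j, i = j + 1 := ⟨i - 1, by omega⟩
    simp (disch := omega) only [d.act_near, d.act_up, d.act_down, d.act_far, map_add, map_smul,
      d.mul_self_assoc]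
    module
  · obtain rfl : i = k := by omega
    obtain ⟨j, rfl⟩ : ∃ j, i = j + 1 := ⟨i - 1, by omega⟩
    simp (disch := omega) only [d.act_near, d.act_up, d.act_down, d.act_far, map_add, map_smul]

theorem act_comm_of_pos {i j : ℕ} (h1 : 1 ≤ i) (h : i + 2 ≤ j) (h2 : j ≤ r) :
    d.act i * d.act j = d.act j * d.act i := by
  refine ind_ext fun k hk z => ?_
  simp only [Module.End.mul_apply]
  obtain ⟨i, rfl⟩ : ∃ i', i = i' + 1 := ⟨i - 1, by omega⟩
  obtain ⟨j, rfl⟩ : ∃ j', j = j' + 1 := ⟨j - 1, by omega⟩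
  rcases Nat.lt_or_ge k i with h | h
  · simp (disch := omega) only [d.act_far]
    rw [d.comm_assoc (i := i) (j := j) (by omega)]
  rcases Nat.lt_or_ge i k with h' | h'
  · rcases Nat.lt_or_ge (j + 1) k with h3 | h3
    · simp (disch := omega) only [d.act_near]
      rw [d.comm_assoc (i := i + 1) (j := j + 1) (by omega)]
    rcases Nat.lt_or_ge j k with h4 | h4
    · obtain rfl : k = j + 1 := by omega
      simp (disch := omega) only [d.act_near, d.act_down, map_add, map_smul]
    rcases Nat.lt_or_ge k j with h5 | h5
    · by_cases h6 : k = i + 1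
      · subst h6
        simp (disch := omega) only [d.act_far, d.act_down, map_add, map_smul]
      · simp (disch := omega) only [d.act_near, d.act_far]
        rw [d.comm_assoc (by omega)]
    · obtain rfl : k = j := by omega
      simp (disch := omega) only [d.act_near, d.act_up]
  · obtain rfl : k = i := by omega
    simp (disch := omega) only [d.act_far, d.act_up]

theorem act_comm_zero {j : ℕ} (h : 2 ≤ j) (h2 : j ≤ r) : d.act 0 * d.act j = d.act j * d.act 0 := by
  refine ind_ext fun k hk z => ?_
  simp only [Module.End.mul_apply]
  obtain ⟨j, rfl⟩ : ∃ j', j = j' + 1 := ⟨j - 1, by omega⟩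
  have hr : 0 < r := by omega
  rcases Nat.eq_zero_or_pos k with rfl | hk0
  · simp (disch := omega) only [d.act_far, d.act_zero_inc_zero]
    rw [← mul_assoc, ← mul_assoc, (d.commute_X j).eq]
  obtain ⟨k, rfl⟩ : ∃ k', k = k' + 1 := ⟨k - 1, by omega⟩
  rcases Nat.lt_or_ge (k + 1) j with h3 | h3
  · simp (disch := omega) only [d.act_far, d.act_zero_inc, d.E_mul, map_add, map_smul]
    rw [d.comm_assoc (i := 0) (j := j) (by omega), ← mul_assoc (d.τ j) (d.chain k),
      (d.chain_commute (by omega)).eq, mul_assoc]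
  rcases Nat.lt_or_ge k j with h4 | h4
  · obtain rfl : j = k + 1 := by omega
    simp (disch := omega) only [d.act_up, d.act_far, d.act_zero_inc, map_add, map_smul]
    rw [chain_succ, mul_assoc]
  rcases Nat.lt_or_ge j k with h5 | h5
  · simp (disch := omega) only [d.act_near, d.act_far, d.act_zero_inc, d.E_mul, map_add, map_smul]
    rw [d.comm_assoc (i := 0) (j := j + 1) (by omega), ← mul_assoc (d.chain k),
      d.chain_mul (by omega) (by omega), mul_assoc]
  · obtain rfl : k = j := by omega
    obtain ⟨k, rfl⟩ : ∃ k', k = k' + 1 := ⟨k - 1, by omega⟩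
    simp (disch := omega) only [d.act_down, d.act_far, d.act_zero_inc, map_add, map_smul]
    rw [chain_succ, mul_assoc, d.mul_self_assoc (by omega) (by omega)]
    simp only [map_add, map_smul]
    module

/-- Summand 0 rests on `E_X` and `E_add`. Summand 1 is the image of summand 0 under T_1, so the
relation carries over by the quadratic relation. For k ≥ 2 the components in summands k, 1 and 0 are
the relation for τ_0 and τ_1, `E_braid_one` and `E_braid_zero`. -/
theorem act_braid_four (hr : 1 ≤ r) :
    d.act 0 * d.act 1 * d.act 0 * d.act 1 = d.act 1 * d.act 0 * d.act 1 * d.act 0 := by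
  have h0 : ∀ z, (d.act 0 * d.act 1 * d.act 0 * d.act 1) (inc R M r 0 z) =
      (d.act 1 * d.act 0 * d.act 1 * d.act 0) (inc R M r 0 z) := by
    intro z
    have e1 := d.act_up (Nat.zero_le r)
    have e2 := d.act_zero_inc (k := 0) hr
    have e3 := d.act_down (k := 0) hr
    have e4 := d.E_X hr z
    have e5 := d.E_add hr z
    simp only [zero_add, chain, one_mul] at e1 e2 e3
    rw [map_add] at e5
    rw [mul_add] at e4
    simp only [Module.End.mul_apply, e1, e2, e3, d.act_zero_inc_zero, map_add, map_smul]
    have e6 := congrArg (inc R M r 1) e4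
    have e7 := congrArg (inc R M r 0) e5
    have e8 : d.τ 0 * (d.X * z) = d.X * (d.τ 0 * z) := by
      rw [← mul_assoc, ← mul_assoc, (d.commute_X 0).eq]
    simp only [map_add, map_zero, e8] at e6 e7 ⊢
    linear_combination (norm := module) ((q : R) - 1) • e6 +
      (((q : R) - 1) * ((q : R) - 1)) • e7
  refine ind_ext fun k hk z => ?_
  rcases Nat.eq_zero_or_pos k with rfl | hk0
  · exact h0 z
  obtain ⟨k, rfl⟩ : ∃ k', k = k' + 1 := ⟨k - 1, by omega⟩
  rcases Nat.eq_zero_or_pos k with rfl | hk0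
  · have e1 : inc R M r (0 + 1) z = d.act 1 (inc R M r 0 z) := (d.act_up (Nat.zero_le r) z).symm
    have hq := d.act_mul_self le_rfl hr
    have h0z := h0 z
    rw [e1, ← Module.End.mul_apply, ← Module.End.mul_apply, mul_assoc _ (d.act 1), hq]
    have e2 := congrArg (d.act 1) h0z
    rw [← Module.End.mul_apply, ← Module.End.mul_apply, ← mul_assoc, ← mul_assoc, ← mul_assoc,
      ← mul_assoc, ← mul_assoc, ← mul_assoc, hq] at e2
    rw [e2]
    simp only [mul_add, add_mul, mul_smul_comm, smul_mul_assoc, mul_one, one_mul,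
      LinearMap.add_apply, LinearMap.smul_apply]
    rw [h0z]
  · obtain ⟨k, rfl⟩ : ∃ k', k = k' + 1 := ⟨k - 1, by omega⟩
    have hr1 : 1 < r := by omega
    have hr0 : 0 < r := by omega
    have n1 : ∀ y, d.act 1 (inc R M r (k + 1 + 1) y) = inc R M r (k + 1 + 1) (d.τ 1 * y) :=
      fun y => d.act_near hk le_rfl (by omega) y
    have n2 := fun y => d.act_zero_inc hk y
    have n3 := d.act_up (Nat.zero_le r)
    have n4 := d.act_zero_inc (k := 0) hr
    have n5 := d.act_down (k := 0) hr
    simp only [zero_add, chain, one_mul] at n3 n4 n5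
    have n6 : ∀ y, d.chain (k + 1) * y = d.chainTail k * (d.τ 1 * y) := fun y => by
      rw [← d.chainTail_mul, mul_assoc]
    have n7 : ∀ y, d.τ 0 * (d.chainTail k * y) = d.chainTail k * (d.τ 0 * y) := fun y => by
      rw [← mul_assoc, (d.chainTail_commute_zero k).eq, mul_assoc]
    have n8 : d.τ 0 * (d.τ 1 * (d.τ 0 * (d.τ 1 * z))) =
        d.τ 1 * (d.τ 0 * (d.τ 1 * (d.τ 0 * z))) := by
      have := congrArg (· * z) d.braid_four
      simpa only [mul_assoc] using this
    have n9 := congrArg (fun y => inc R M r 1 (d.chainTail k * y)) (d.E_braid_one hr1 z)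
    have n10 := congrArg (fun y => inc R M r 0 (d.chainTail k * y)) (d.E_braid_zero hr1 z)
    simp only [Module.End.mul_apply, n1, n2, n3, n4, n5, n6, n7, n8, d.E_chainTail_mul hr0, map_add,
      map_smul, mul_add, mul_smul_comm] at n9 n10 ⊢
    linear_combination (norm := module) ((q : R) - 1) • n9 + ((q : R) - 1) • n10

end InductionData
end ArikiKoike

namespace ArikiKoike

/-! ### The cyclotomic relation for the action -/

/-- The polynomial `(X - u_1) ⋯ (X - u_m)`. -/
noncomputable def cycPoly {R : Type*} [CommRing R] {m : ℕ} (u : Fin m → R) : Polynomial R :=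
  ((List.finRange m).map fun k => Polynomial.X - Polynomial.C (u k)).prod

theorem aeval_cycPoly {R B : Type*} [CommRing R] [Ring B] [Algebra R B] {m : ℕ} (u : Fin m → R)
    (b : B) : Polynomial.aeval b (cycPoly u) =
      ((List.finRange m).map fun k => b - algebraMap R B (u k)).prod := by
  rw [cycPoly, map_list_prod, List.map_map]
  congr 1
  refine List.map_congr_left fun k _ => ?_
  simp

theorem monic_cycPoly {R : Type*} [CommRing R] {m : ℕ} (u : Fin m → R) : (cycPoly u).Monic := by
  rw [cycPoly, ← Fin.prod_univ_def]
  exact Polynomial.monic_prod_of_monic _ _ fun i _ => Polynomial.monic_X_sub_C (u i)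

theorem natDegree_cycPoly {R : Type*} [CommRing R] [Nontrivial R] {m : ℕ} (u : Fin m → R) :
    (cycPoly u).natDegree = m := by
  rw [cycPoly, ← Fin.prod_univ_def, Polynomial.natDegree_finsetProd_X_sub_C_eq_card]
  simp

namespace InductionData

variable {R M : Type*} [CommRing R] [Ring M] [Algebra R M] {m : ℕ} {q : Rˣ} {u : Fin m → R} {r : ℕ}
variable (d : InductionData (M := M) q u r)

theorem aeval_intertwine {N : Type*} [AddCommGroup N] [Module R N] {S : Set M} {b : M}
    (hS : ∀ s ∈ S, b * s ∈ S) (A : Module.End R N) (f : M →ₗ[R] N)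
    (hf : ∀ s ∈ S, A (f s) = f (b * s)) (p : Polynomial R) (s : M) (hs : s ∈ S) :
    Polynomial.aeval A p (f s) = f (Polynomial.aeval b p * s) := by
  induction p using Polynomial.induction_on' with
  | add p p' hp hp' => rw [map_add, map_add, LinearMap.add_apply, hp, hp', add_mul, map_add]
  | monomial n c =>
    rw [Polynomial.aeval_monomial, Polynomial.aeval_monomial, ← Algebra.smul_def,
      ← Algebra.smul_def, LinearMap.smul_apply, smul_mul_assoc, map_smul]
    congr 1
    induction n generalizing s with
    | zero => simp
    | succ n ih =>
      rw [pow_succ, pow_succ, Module.End.mul_apply, hf s hs, ih _ (hS s hs), mul_assoc]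

/-- Such a c makes the map taking s to X^n s in summand 1 minus (q - 1) c s in summand 0 turn τ_0
into T_0. It is built by c_0 = 1 and c_{n+1} = X c_n - X τ_0^n. -/
theorem exists_intertwiner (n : ℕ) :
    ∃ c : M, d.X * c - c * d.τ 0 = d.X * d.τ 0 ^ n - d.X ^ n * d.τ 0 := by
  induction n with
  | zero => exact ⟨1, by simp⟩
  | succ n ih =>
    obtain ⟨c, hc⟩ := ih
    refine ⟨d.X * c - d.X * d.τ 0 ^ n, ?_⟩
    have := congrArg (d.X * ·) hc
    simp only [mul_sub, ← mul_assoc] at this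
    rw [mul_sub, sub_mul, pow_succ, pow_succ', ← mul_assoc, ← mul_assoc, ← mul_assoc]
    linear_combination (norm := noncomm_ring) this

/-- On summand 0, T_0 acts as X. On summand 1 the relation for τ_0 is transported by the
intertwiner, whose component in summand 0 is already annihilated. Each later summand is the image of
the previous one under a generator commuting with T_0. -/
theorem act_cyclotomic :
    ((List.finRange m).map fun k => d.act 0 - algebraMap R (Module.End R (Ind M r)) (u k)).prod
      = 0 := by
  refine (aeval_cycPoly u (d.act 0)).symm.trans ?_
  have h0 : ∀ z, Polynomial.aeval (d.act 0) (cycPoly u) (inc R M r 0 z) = 0 := by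
    intro z
    rw [aeval_intertwine (S := Set.univ) (b := d.X) (fun _ _ => trivial) (d.act 0) (inc R M r 0)
      (fun s _ => d.act_zero_inc_zero s) _ z trivial, aeval_cycPoly, d.cyclotomic_X, zero_mul,
      map_zero]
  have h1 : ∀ k, k + 1 ≤ r → ∀ z,
      Polynomial.aeval (d.act 0) (cycPoly u) (inc R M r (k + 1) z) = 0 := by
    intro k
    induction k with
    | zero =>
      intro hr z
      refine LinearMap.congr_fun (f := Polynomial.aeval (d.act 0) (cycPoly u) ∘ₗ inc R M r 1)
        (g := 0) (d.linearMap_ext fun n s hs => ?_) z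
      obtain ⟨c, hc⟩ := d.exists_intertwiner n
      have hz : ∀ z, d.act 0 (inc R M r 1 z) =
          inc R M r 1 (d.τ 0 * z) + ((q : R) - 1) • inc R M r 0 (d.E z) := fun z => by
        have := d.act_zero_inc (k := 0) hr z
        rwa [chain, one_mul] at this
      have := aeval_intertwine (S := d.S) (b := d.τ 0) (d.mul_mem 0) (d.act 0)
        (inc R M r 1 ∘ₗ LinearMap.mulLeft R (d.X ^ n) -
          ((q : R) - 1) • (inc R M r 0 ∘ₗ LinearMap.mulLeft R c)) ?_ (cycPoly u) s hs
      · rw [aeval_cycPoly (u := u) (b := d.τ 0), d.cyclotomic hr, zero_mul, map_zero,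
          LinearMap.sub_apply, LinearMap.smul_apply, map_sub, map_smul] at this
        simp only [LinearMap.comp_apply, LinearMap.mulLeft_apply] at this ⊢
        rw [h0, smul_zero, sub_zero] at this
        rw [this, LinearMap.zero_apply]
      · intro s hs
        have hc' := congrArg (fun y => inc R M r 0 (y * s)) hc
        simp only [sub_mul, mul_assoc, map_sub] at hc'
        simp only [LinearMap.sub_apply, LinearMap.smul_apply, LinearMap.comp_apply,
          LinearMap.mulLeft_apply, map_sub, map_smul, hz, d.act_zero_inc_zero,
          d.E_apply' hr n hs, d.commute_assoc]
        linear_combination (norm := module) (1 - (q : R)) • hc'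
    | succ k ih =>
      intro hr z
      have e : inc R M r (k + 1 + 1) z = d.act (k + 1 + 1) (inc R M r (k + 1) z) :=
        (d.act_up (by omega) z).symm
      have hc : Commute (d.act 0) (d.act (k + 1 + 1)) := d.act_comm_zero (by omega) (by omega)
      have hc' : Commute (Polynomial.aeval (d.act 0) (cycPoly u)) (d.act (k + 1 + 1)) := by
        refine (congrArg (Commute · (d.act (k + 1 + 1))) (aeval_cycPoly u (d.act 0))).mpr ?_
        refine Commute.list_prod_left _ _ fun x hx => ?_
        obtain ⟨i, -, rfl⟩ := List.mem_map.mp hx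
        exact Commute.sub_left (R := Module.End R (Ind M r)) hc
          (Algebra.commute_algebraMap_left (A := Module.End R (Ind M r)) _ _)
      rw [e, ← Module.End.mul_apply, hc'.eq, Module.End.mul_apply, ih (by omega), map_zero]
  refine ind_ext fun k hk z => ?_
  rw [LinearMap.zero_apply]
  rcases Nat.eq_zero_or_pos k with rfl | hk0
  · exact h0 z
  · obtain ⟨k, rfl⟩ : ∃ k', k = k' + 1 := ⟨k - 1, by omega⟩
    exact h1 k hk z

/-- The action of `H_m^{r+1}` on the induced module. -/
noncomputable def hom : AK m (r + 1) q u →ₐ[R] Module.End R (Ind M r) :=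
  RingQuot.liftAlgHom R ⟨FreeAlgebra.lift R fun i : Fin (r + 1) => d.act i.val, by
    intro x y h
    induction h with
    | braid_four i j hi hj =>
      simp only [map_mul, FreeAlgebra.lift_ι_apply, hi, hj]
      exact d.act_braid_four (by omega)
    | braid_three i j hi hj =>
      simp only [map_mul, FreeAlgebra.lift_ι_apply, hj]
      exact d.act_braid hi (by omega)
    | comm i j hij =>
      simp only [map_mul, FreeAlgebra.lift_ι_apply]
      rcases Nat.eq_zero_or_pos i.val with hi | hi
      · rw [hi]
        exact d.act_comm_zero (by omega) (by omega)
      · exact d.act_comm_of_pos hi hij (by omega)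
    | quadratic i hi =>
      simp only [map_mul, map_sub, map_add, map_one, FreeAlgebra.lift_ι_apply, AlgHom.commutes,
        map_zero]
      have := d.act_mul_self (i := i.val) (by omega) (by omega)
      refine LinearMap.ext fun z => ?_
      have hz := LinearMap.congr_fun this z
      simp only [Module.End.mul_apply, LinearMap.add_apply, LinearMap.smul_apply,
        Module.End.one_apply, LinearMap.zero_apply] at hz ⊢
      erw [LinearMap.sub_apply]
      simp only [map_add, Module.algebraMap_end_apply]
      linear_combination (norm := module) hz
    | cyclotomic i hi =>
      rw [map_zero, map_list_prod, List.map_map, ← d.act_cyclotomic]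
      congr 1
      refine List.map_congr_left fun k _ => ?_
      simp [hi]⟩

theorem hom_gen {i : ℕ} (hi : i < r + 1) : d.hom (gen q u (r + 1) i) = d.act i := by
  rw [gen_of_lt q u (r + 1) hi, hom, RingQuot.liftAlgHom_mkAlgHom_apply, FreeAlgebra.lift_ι_apply]

end InductionData
end ArikiKoike

namespace ArikiKoike

/-! ### Products of consecutive generators -/

section Chains

variable {R : Type*} [CommRing R] {m : ℕ} (q : Rˣ) (u : Fin m → R) (r : ℕ)

/-- The product `T_1 ⋯ T_n`. -/
def asc : ℕ → AK m r q u
  | 0 => 1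
  | n + 1 => asc n * gen q u r (n + 1)

/-- The product `T_n ⋯ T_1`. -/
def desc : ℕ → AK m r q u
  | 0 => 1
  | n + 1 => gen q u r (n + 1) * desc n

/-- The inverse `T_n⁻¹ ⋯ T_1⁻¹` of `T_1 ⋯ T_n`. -/
def ascInv : ℕ → AK m r q u
  | 0 => 1
  | n + 1 => genInv q u r (n + 1) * ascInv n

theorem asc_mul_ascInv {n : ℕ} (h : n = 0 ∨ n < r) : asc q u r n * ascInv q u r n = 1 := by
  induction n with
  | zero => simp [asc, ascInv]
  | succ n ih =>
    rw [asc, ascInv, mul_assoc, ← mul_assoc (gen q u r (n + 1)),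
      gen_mul_genInv q u r (by omega) (by omega), one_mul, ih (by omega)]

theorem ascInv_mul_asc {n : ℕ} (h : n = 0 ∨ n < r) : ascInv q u r n * asc q u r n = 1 := by
  induction n with
  | zero => simp [asc, ascInv]
  | succ n ih =>
    rw [asc, ascInv, mul_assoc, ← mul_assoc (ascInv q u r n), ih (by omega), one_mul,
      genInv_mul_gen q u r (by omega) (by omega)]

theorem gen_commute_asc {j n : ℕ} (h : n + 2 ≤ j) : Commute (gen q u r j) (asc q u r n) := by
  induction n with
  | zero => exact Commute.one_right _
  | succ n ih => exact (ih (by omega)).mul_right (gen_comm q u r (by omega)).symm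

theorem gen_commute_desc {j n : ℕ} (h : n + 2 ≤ j) : Commute (gen q u r j) (desc q u r n) := by
  induction n with
  | zero => exact Commute.one_right _
  | succ n ih => exact (gen_comm q u r (by omega)).symm.mul_right (ih (by omega))

theorem asc_mul_gen {j n : ℕ} (h1 : 1 ≤ j) (h : j + 1 ≤ n) :
    asc q u r n * gen q u r j = gen q u r (j + 1) * asc q u r n := by
  induction n, h using Nat.le_induction with
  | base =>
    obtain ⟨i, rfl⟩ : ∃ i, j = i + 1 := ⟨j - 1, by omega⟩
    have h1 := (gen_commute_asc q u r (n := i) (j := i + 2) le_rfl).eq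
    have h2 := gen_braid q u r (i := i + 1) (by omega)
    rw [asc, asc, mul_assoc, mul_assoc, ← mul_assoc (gen q u r (i + 1)), h2, ← mul_assoc,
      ← mul_assoc, ← h1]
    simp only [mul_assoc]
  | succ k hk ih =>
    rw [asc, mul_assoc, ← (gen_comm q u r (i := j) (j := k + 1) (by omega)).eq, ← mul_assoc, ih,
      mul_assoc]

theorem desc_mul_gen {j n : ℕ} (h1 : 1 ≤ j) (h : j + 1 ≤ n) :
    desc q u r n * gen q u r (j + 1) = gen q u r j * desc q u r n := by
  induction n, h using Nat.le_induction with
  | base =>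
    obtain ⟨i, rfl⟩ : ∃ i, j = i + 1 := ⟨j - 1, by omega⟩
    have h1 := (gen_commute_desc q u r (n := i) (j := i + 2) le_rfl).eq
    rw [desc, desc, mul_assoc, mul_assoc, ← h1, ← mul_assoc, ← mul_assoc,
      ← gen_braid q u r (i := i + 1) (by omega)]
    simp only [mul_assoc]
  | succ k hk ih =>
    rw [desc, mul_assoc, ih, ← mul_assoc, ← mul_assoc,
      (gen_comm q u r (i := j) (j := k + 1) (by omega)).eq]

theorem gen_mul_ascInv {j n : ℕ} (h1 : 1 ≤ j) (h : j + 1 ≤ n) (hn : n < r) :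
    gen q u r j * ascInv q u r n = ascInv q u r n * gen q u r (j + 1) := by
  have := congrArg (fun x => ascInv q u r n * x * ascInv q u r n) (asc_mul_gen q u r h1 h)
  rwa [← mul_assoc, ascInv_mul_asc q u r (Or.inr hn), one_mul, mul_assoc, mul_assoc,
    asc_mul_ascInv q u r (Or.inr hn), mul_one] at this

end Chains

/-! ### The embedding `H_m^r → H_m^{r+1}` -/

section Incl

variable {R : Type*} [CommRing R] {m : ℕ} (q : Rˣ) (u : Fin m → R) (r : ℕ)

/-- The natural homomorphism `H_m^r → H_m^{r+1}`. -/
def incl : AK m r q u →ₐ[R] AK m (r + 1) q u :=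
  RingQuot.liftAlgHom R ⟨FreeAlgebra.lift R fun i : Fin r => gen q u (r + 1) i.val, by
    intro x y h
    induction h with
    | braid_four i j hi hj =>
      simp only [map_mul, FreeAlgebra.lift_ι_apply, hi, hj]
      exact gen_braid_four q u (r + 1)
    | braid_three i j hi hj =>
      simp only [map_mul, FreeAlgebra.lift_ι_apply, hj]
      exact gen_braid q u (r + 1) hi
    | comm i j hij =>
      simp only [map_mul, FreeAlgebra.lift_ι_apply]
      exact gen_comm q u (r + 1) hij
    | quadratic i hi =>
      have := RingQuot.mkAlgHom_rel R (Rel.quadratic (q := q) (u := u) (m := m)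
        (⟨i, by omega⟩ : Fin (r + 1)) hi)
      simpa [gen_of_lt q u (r + 1) (i := i.val) (by omega)] using this
    | cyclotomic i hi =>
      rw [map_zero, map_list_prod, List.map_map, ← gen_cyclotomic q u (r + 1) (by omega)]
      congr 1
      refine List.map_congr_left fun k _ => ?_
      simp [hi]⟩

theorem incl_gen {i : ℕ} (hi : i < r) : incl q u r (gen q u r i) = gen q u (r + 1) i := by
  rw [gen_of_lt q u r hi, incl, RingQuot.liftAlgHom_mkAlgHom_apply, FreeAlgebra.lift_ι_apply]

theorem incl_jm {j : ℕ} (hj : j ≤ r) : incl q u r (jm q u r j) = jm q u (r + 1) j := by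
  induction j with
  | zero => simp [jm]
  | succ j ih =>
    rcases Nat.eq_zero_or_pos j with rfl | h0
    · exact incl_gen q u r (by omega)
    · rw [jm_succ q u r h0, jm_succ q u (r + 1) h0, map_smul, map_mul, map_mul,
        incl_gen q u r (by omega), ih (by omega)]

theorem incl_jmPoly_stairPoly (v : Fin m → R) {J : Finset (Fin m)} {n : Fin m → ℕ}
    (hn : ∀ i ∈ J, n i ≤ r) : incl q u r (jmPoly q u r (stairPoly v J n)) =
      jmPoly q u (r + 1) (stairPoly v J n) := by
  have : stairPoly v J n ∈
      AlgHom.equalizer ((incl q u r).comp (jmPoly q u r)) (jmPoly q u (r + 1)) := by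
    refine Subalgebra.prod_mem _ fun i hi => Subalgebra.prod_mem _ fun j hj =>
      Subalgebra.sub_mem _ ?_ (Subalgebra.algebraMap_mem _ _)
    have h1 := hn i hi
    have h2 := Finset.mem_range.mp hj
    rw [AlgHom.mem_equalizer, AlgHom.comp_apply, jmPoly_X, jmPoly_X, incl_jm q u r (by omega)]
  exact this

end Incl

/-! ### The filtration by the degree in `T_0` -/

section Filtration

variable {R : Type*} [CommRing R] {m : ℕ} (q : Rˣ) (u : Fin m → R) (r : ℕ)

/-- The span of the words in the generators in which `T_0` occurs fewer than `d` times. -/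
def fil (d : ℕ) : Submodule R (AK m r q u) :=
  Submodule.span R {x | ∃ l : List ℕ, l.count 0 < d ∧ x = (l.map (gen q u r)).prod}

variable {q u r}

theorem word_mem_fil {l : List ℕ} {d : ℕ} (h : l.count 0 < d) :
    (l.map (gen q u r)).prod ∈ fil q u r d :=
  Submodule.subset_span ⟨l, h, rfl⟩

theorem fil_mono {d e : ℕ} (h : d ≤ e) : fil q u r d ≤ fil q u r e :=
  Submodule.span_mono fun _ ⟨l, hl, e⟩ => ⟨l, by omega, e⟩

/-- Index d stands for degree strictly below d; degree at most d times degree below e has degree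
below d + e. -/
theorem mul_mem_fil {d e : ℕ} {x y : AK m r q u} (hx : x ∈ fil q u r (d + 1))
    (hy : y ∈ fil q u r e) : x * y ∈ fil q u r (d + e) := by
  induction hx using Submodule.span_induction with
  | mem x hx =>
    obtain ⟨l, hl, rfl⟩ := hx
    induction hy using Submodule.span_induction with
    | mem y hy =>
      obtain ⟨l', hl', rfl⟩ := hy
      rw [← List.prod_append, ← List.map_append]
      exact word_mem_fil (by rw [List.count_append]; omega)
    | zero => rw [mul_zero]; exact Submodule.zero_mem _
    | add y y' _ _ h h' => rw [mul_add]; exact Submodule.add_mem _ h h'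
    | smul c y _ h => rw [mul_smul_comm]; exact Submodule.smul_mem _ c h
  | zero => rw [zero_mul]; exact Submodule.zero_mem _
  | add y y' _ _ h h' => rw [add_mul]; exact Submodule.add_mem _ h h'
  | smul c y _ h => rw [smul_mul_assoc]; exact Submodule.smul_mem _ c h

theorem mul_mem_fil' {d e : ℕ} {x y : AK m r q u} (hx : x ∈ fil q u r d)
    (hy : y ∈ fil q u r (e + 1)) : x * y ∈ fil q u r (d + e) := by
  cases d with
  | zero =>
    have : fil q u r 0 = (⊥ : Submodule R (AK m r q u)) := by
      rw [fil, Submodule.span_eq_bot]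
      rintro _ ⟨l, hl, -⟩
      omega
    rw [this, Submodule.mem_bot] at hx
    rw [hx, zero_mul]
    exact Submodule.zero_mem _
  | succ d => exact fil_mono (by omega) (mul_mem_fil hx hy)

theorem one_mem_fil (d : ℕ) : (1 : AK m r q u) ∈ fil q u r (d + 1) :=
  word_mem_fil (l := []) (by simp)

theorem gen_mem_fil {i : ℕ} (h : 1 ≤ i) : gen q u r i ∈ fil q u r 1 := by
  have := word_mem_fil (q := q) (u := u) (r := r) (l := [i]) (d := 1) (by
    rw [List.count_singleton, beq_eq_false_iff_ne.mpr (by omega)]; decide)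
  simpa using this

theorem gen_zero_mem_fil : gen q u r 0 ∈ fil q u r 2 := by
  have := word_mem_fil (q := q) (u := u) (r := r) (l := [0]) (d := 2) (by simp)
  simpa using this

theorem mul_mem_fil_of_one {d : ℕ} {x y : AK m r q u} (hx : x ∈ fil q u r 1)
    (hy : y ∈ fil q u r d) : x * y ∈ fil q u r d := by
  simpa using mul_mem_fil (d := 0) hx hy

theorem mul_mem_fil_of_one' {d : ℕ} {x y : AK m r q u} (hx : x ∈ fil q u r d)
    (hy : y ∈ fil q u r 1) : x * y ∈ fil q u r d := by
  simpa using mul_mem_fil' (e := 0) hx hy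

theorem genInv_mem_fil {i : ℕ} (h : 1 ≤ i) : genInv q u r i ∈ fil q u r 1 :=
  Submodule.smul_mem _ _ (Submodule.sub_mem _ (gen_mem_fil h)
    (Submodule.smul_mem _ _ (one_mem_fil 0)))

theorem jm_mem_fil (j : ℕ) : jm q u r j ∈ fil q u r 2 := by
  induction j with
  | zero => exact Submodule.zero_mem _
  | succ j ih =>
    rcases Nat.eq_zero_or_pos j with rfl | h0
    · exact gen_zero_mem_fil
    · rw [jm_succ q u r h0]
      exact Submodule.smul_mem _ _ (mul_mem_fil_of_one' (mul_mem_fil_of_one (gen_mem_fil h0) ih)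
        (gen_mem_fil h0))

theorem ascInv_mem_fil (n : ℕ) : ascInv q u r n ∈ fil q u r 1 := by
  induction n with
  | zero => exact one_mem_fil 0
  | succ n ih => exact mul_mem_fil_of_one (genInv_mem_fil (by omega)) ih

theorem T_mem_fil (w : Equiv.Perm (Fin r)) : T q u w ∈ fil q u r 1 := by
  induction w using descent_induction with
  | h1 => rw [T_one]; exact one_mem_fil 0
  | h w k hk ih =>
    rw [T_of_isDescent q u hk]
    exact mul_mem_fil_of_one (gen_mem_fil hk.1.1) ih

theorem incl_mem_fil {d : ℕ} {x : AK m r q u} (hx : x ∈ fil q u r d) :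
    incl q u r x ∈ fil q u (r + 1) d := by
  induction hx using Submodule.span_induction with
  | mem x hx =>
    obtain ⟨l, hl, rfl⟩ := hx
    by_cases h : ∀ i ∈ l, i < r
    · rw [map_list_prod, List.map_map, List.map_congr_left (g := gen q u (r + 1))]
      · exact word_mem_fil hl
      · exact fun i hi => incl_gen q u r (h i hi)
    · push Not at h
      obtain ⟨i, hi, hr⟩ := h
      rw [List.prod_eq_zero (List.mem_map.mpr ⟨i, hi, gen_of_le q u r hr⟩), map_zero]
      exact Submodule.zero_mem _
  | zero => rw [map_zero]; exact Submodule.zero_mem _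
  | add y y' _ _ h h' => rw [map_add]; exact Submodule.add_mem _ h h'
  | smul c y _ h => rw [map_smul]; exact Submodule.smul_mem _ c h

theorem jmPoly_prod_mem_fil {ι : Type*} (s : Finset ι) (f : ι → MvPolynomial ℕ R) (d : ι → ℕ)
    (h : ∀ i ∈ s, jmPoly q u r (f i) ∈ fil q u r (d i + 1)) :
    jmPoly q u r (∏ i ∈ s, f i) ∈ fil q u r (∑ i ∈ s, d i + 1) := by
  classical
  induction s using Finset.induction_on with
  | empty => rw [Finset.prod_empty, map_one]; exact one_mem_fil _
  | insert i s hi ih =>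
    rw [Finset.prod_insert hi, Finset.sum_insert hi, map_mul, add_assoc]
    exact mul_mem_fil (h i (Finset.mem_insert_self i s))
      (ih fun j hj => h j (Finset.mem_insert_of_mem hj))

/-- Telescoping: factors that agree up to lower degree have products that agree up to lower degree.
-/
theorem jmPoly_prod_sub_mem_fil {ι : Type*} (s : Finset ι) (f g : ι → MvPolynomial ℕ R) (d : ι → ℕ)
    (hg : ∀ i ∈ s, jmPoly q u r (g i) ∈ fil q u r (d i + 1))
    (h : ∀ i ∈ s, jmPoly q u r (f i - g i) ∈ fil q u r (d i)) :
    jmPoly q u r (∏ i ∈ s, f i - ∏ i ∈ s, g i) ∈ fil q u r (∑ i ∈ s, d i) := by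
  classical
  induction s using Finset.induction_on with
  | empty => rw [Finset.prod_empty, Finset.prod_empty, sub_self, map_zero]; exact zero_mem _
  | insert i s hi ih =>
    have ih := ih (fun j hj => hg j (Finset.mem_insert_of_mem hj))
      (fun j hj => h j (Finset.mem_insert_of_mem hj))
    have hgs := jmPoly_prod_mem_fil s g d fun j hj => hg j (Finset.mem_insert_of_mem hj)
    have hi1 := h i (Finset.mem_insert_self i s)
    have hf : jmPoly q u r (f i) ∈ fil q u r (d i + 1) := by
      have := Submodule.add_mem _ (fil_mono (Nat.le_succ _) hi1) (hg i (Finset.mem_insert_self i s))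
      rwa [← map_add, sub_add_cancel] at this
    have e : f i * ∏ i ∈ s, f i - g i * ∏ i ∈ s, g i =
        f i * (∏ i ∈ s, f i - ∏ i ∈ s, g i) + (f i - g i) * ∏ i ∈ s, g i := by ring
    rw [Finset.prod_insert hi, Finset.prod_insert hi, Finset.sum_insert hi, e, map_add, map_mul,
      map_mul]
    exact Submodule.add_mem _ (mul_mem_fil hf ih) (mul_mem_fil' hi1 hgs)

theorem jmPoly_X_sub_C_mem_fil (j : ℕ) (c : R) :
    jmPoly q u r (MvPolynomial.X j - MvPolynomial.C c) ∈ fil q u r 2 := by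
  rw [map_sub, jmPoly_X, jmPoly_C, Algebra.algebraMap_eq_smul_one]
  exact Submodule.sub_mem _ (jm_mem_fil _) (Submodule.smul_mem _ _ (one_mem_fil 1))

theorem stairPoly_mem_fil (v : Fin m → R) (J : Finset (Fin m)) (n : Fin m → ℕ) :
    jmPoly q u r (stairPoly v J n) ∈ fil q u r (∑ i ∈ J, n i + 1) := by
  refine jmPoly_prod_mem_fil J _ n fun i _ => ?_
  have := jmPoly_prod_mem_fil (q := q) (u := u) (r := r) (Finset.range (n i))
    (fun j => MvPolynomial.X j - MvPolynomial.C (v i)) (fun _ => 1)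
    fun j _ => jmPoly_X_sub_C_mem_fil j _
  simpa using this

/-- The parameters affect only lower terms; setting them to 0 extracts the leading monomial. -/
theorem stairPoly_sub_mem_fil (v v' : Fin m → R) (J : Finset (Fin m)) (n : Fin m → ℕ) :
    jmPoly q u r (stairPoly v J n - stairPoly v' J n) ∈ fil q u r (∑ i ∈ J, n i) := by
  refine jmPoly_prod_sub_mem_fil J _ _ n (fun i _ => ?_) fun i _ => ?_
  · have := jmPoly_prod_mem_fil (q := q) (u := u) (r := r) (Finset.range (n i))
      (fun j => MvPolynomial.X j - MvPolynomial.C (v' i)) (fun _ => 1)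
      fun j _ => jmPoly_X_sub_C_mem_fil j _
    simpa using this
  · have := jmPoly_prod_sub_mem_fil (q := q) (u := u) (r := r) (Finset.range (n i))
      (fun j => MvPolynomial.X j - MvPolynomial.C (v i))
      (fun j => MvPolynomial.X j - MvPolynomial.C (v' i)) (fun _ => 1)
      (fun j _ => jmPoly_X_sub_C_mem_fil j _) fun j _ => by
        rw [sub_sub_sub_cancel_left, ← map_sub, jmPoly_C, Algebra.algebraMap_eq_smul_one]
        exact Submodule.smul_mem _ _ (one_mem_fil 0)
    simpa using this

/-- By the cyclotomic relation, T_0^m equals T_0^m - (T_0 - u_1)⋯(T_0 - u_m), which has lower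
degree. -/
theorem gen_zero_pow_mem_fil (h : 0 < r) : gen q u r 0 ^ m ∈ fil q u r m := by
  have := stairPoly_sub_mem_fil (q := q) (u := u) (r := r) 0 u Finset.univ fun _ => 1
  rw [map_sub, jmPoly_stairPoly_one q u h, sub_zero] at this
  simpa [stairPoly, jmPoly_X, jm_one] using this

end Filtration
end ArikiKoike

namespace ArikiKoike

open scoped TensorProduct

/-! ### The module induced from H_m^r to H_m^{r+1} -/

section Induced

variable {R : Type*} [CommRing R] {m : ℕ} (q : Rˣ) (u : Fin m → R) (r : ℕ)

/-- Evaluation at `T_0`. -/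
noncomputable def evalGenZero : AdjoinRoot (cycPoly u) →ₗ[R] AK m r q u :=
  (Polynomial.aeval (gen q u r 0)).toLinearMap ∘ₗ AdjoinRoot.modByMonicHom (monic_cycPoly u)

theorem root_pow (n : ℕ) : AdjoinRoot.root (cycPoly u) ^ n =
    AdjoinRoot.mk (cycPoly u) (Polynomial.X ^ n) := by
  rw [map_pow, AdjoinRoot.mk_X]

theorem evalGenZero_pow (h : 0 < r) (n : ℕ) :
    evalGenZero q u r (AdjoinRoot.root (cycPoly u) ^ n) = gen q u r 0 ^ n := by
  have h0 : Polynomial.aeval (gen q u r 0) (cycPoly u) = 0 := by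
    rw [aeval_cycPoly, gen_cyclotomic q u r h]
  have h1 := congrArg (Polynomial.aeval (gen q u r 0))
    (Polynomial.modByMonic_add_div (Polynomial.X ^ n) (cycPoly u))
  rw [map_add, map_mul, h0, zero_mul, add_zero, Polynomial.aeval_X_pow] at h1
  rw [root_pow, evalGenZero, LinearMap.comp_apply, AdjoinRoot.modByMonicHom_mk]
  exact h1

/-- The coefficient of `x^{m-1}` in the normal form of an element of
`R[x] / ((x - u_1) ⋯ (x - u_m))`. -/
noncomputable def topCoeff : AdjoinRoot (cycPoly u) →ₗ[R] R :=
  Polynomial.lcoeff R (m - 1) ∘ₗ AdjoinRoot.modByMonicHom (monic_cycPoly u)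

theorem topCoeff_pow [Nontrivial R] {n : ℕ} (h : n < m) :
    topCoeff u (AdjoinRoot.root (cycPoly u) ^ n) = if n = m - 1 then 1 else 0 := by
  rw [topCoeff, LinearMap.comp_apply, root_pow, AdjoinRoot.modByMonicHom_mk,
    (Polynomial.modByMonic_eq_self_iff (monic_cycPoly u)).mpr, Polynomial.lcoeff_apply,
    Polynomial.coeff_X_pow]
  · exact if_congr eq_comm rfl rfl
  · rw [Polynomial.degree_X_pow, Polynomial.degree_eq_natDegree (monic_cycPoly u).ne_zero,
      natDegree_cycPoly]
    exact_mod_cast h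

/-- The algebra `R[x] / ((x - u_1) ⋯ (x - u_m)) ⊗ H_m^r`. -/
abbrev Coef : Type _ := AdjoinRoot (cycPoly u) ⊗[R] AK m r q u

/-- The inclusion of `H_m^r`. -/
noncomputable def inr : AK m r q u →ₐ[R] Coef q u r := Algebra.TensorProduct.includeRight

/-- The element `x ⊗ 1`. -/
noncomputable def xElt : Coef q u r := AdjoinRoot.root (cycPoly u) ⊗ₜ[R] 1

theorem xElt_pow_mul (n : ℕ) (h : AK m r q u) :
    xElt q u r ^ n * inr q u r h = (AdjoinRoot.root (cycPoly u) ^ n) ⊗ₜ[R] h := by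
  rw [xElt, Algebra.TensorProduct.tmul_pow, one_pow, inr, Algebra.TensorProduct.includeRight_apply,
    Algebra.TensorProduct.tmul_mul_tmul, one_mul, mul_one]

theorem xElt_commute (h : AK m r q u) : Commute (xElt q u r) (inr q u r h) := by
  rw [Commute, SemiconjBy, xElt, inr, Algebra.TensorProduct.includeRight_apply,
    Algebra.TensorProduct.tmul_mul_tmul, Algebra.TensorProduct.tmul_mul_tmul, one_mul, mul_one,
    one_mul, mul_one]

/-- The operator `p ⊗ h ↦ x ⊗ p(T_0) h`. -/
noncomputable def evalMul : Coef q u r →ₗ[R] Coef q u r :=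
  LinearMap.mulLeft R (xElt q u r) ∘ₗ (inr q u r).toLinearMap ∘ₗ
    TensorProduct.lift (LinearMap.mul R (AK m r q u) ∘ₗ evalGenZero q u r)

theorem span_xElt_pow_mul : Submodule.span R {z : Coef q u r | ∃ (n : ℕ) (s : Coef q u r),
    s ∈ Set.range (inr q u r) ∧ z = xElt q u r ^ n * s} = ⊤ := by
  refine eq_top_iff.mpr fun z _ => ?_
  induction z using TensorProduct.induction_on with
  | zero => exact Submodule.zero_mem _
  | add x y hx hy => exact Submodule.add_mem _ (hx trivial) (hy trivial)
  | tmul p h =>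
    obtain ⟨p, rfl⟩ := AdjoinRoot.mk_surjective p
    induction p using Polynomial.induction_on' with
    | add p p' hp hp' => rw [map_add, TensorProduct.add_tmul]; exact Submodule.add_mem _ (hp trivial) (hp' trivial)
    | monomial n c =>
      have : AdjoinRoot.mk (cycPoly u) (Polynomial.monomial n c) =
          c • AdjoinRoot.root (cycPoly u) ^ n := by
        rw [root_pow, ← Polynomial.C_mul_X_pow_eq_monomial, map_mul, AdjoinRoot.mk_C,
          Algebra.smul_def]
        rfl
      rw [this, ← TensorProduct.smul_tmul', ← xElt_pow_mul]
      exact Submodule.smul_mem _ _ (Submodule.subset_span ⟨n, _, ⟨h, rfl⟩, rfl⟩)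

/-- The data for the module induced from `H_m^r` to `H_m^{r+1}`. -/
noncomputable def inducedData : InductionData (M := Coef q u r) q u r where
  X := xElt q u r
  τ i := inr q u r (gen q u r i)
  -- For r > 0 this sends x^n ⊗ h to x ⊗ T_0^n h - x^n ⊗ T_0 h: T_0 is a root of the cyclotomic
  -- polynomial, so reducing x^n to normal form does not change its value at T_0.
  E := evalMul q u r - LinearMap.mulLeft R (inr q u r (gen q u r 0))
  S := Set.range (inr q u r)
  commute_X i := xElt_commute q u r _
  mul_self i h1 h2 := by
    rw [← map_mul, gen_mul_self q u r h1 h2, map_add, map_smul, map_smul, map_one]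
  braid i h := by
    simp only [← map_mul]
    rw [gen_braid q u r h]
  braid_four := by
    simp only [← map_mul]
    rw [gen_braid_four q u r]
  comm i j h := (gen_comm q u r h).map _
  cyclotomic h := by
    have := congrArg (inr q u r) (gen_cyclotomic q u r h)
    rw [map_zero, map_list_prod, List.map_map] at this
    refine Eq.trans (congrArg List.prod (List.map_congr_left fun k _ => ?_)) this
    simp
  cyclotomic_X := by
    have h1 : xElt q u r = (Algebra.TensorProduct.includeLeft :
        AdjoinRoot (cycPoly u) →ₐ[R] Coef q u r) (AdjoinRoot.root (cycPoly u)) := rfl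
    have h2 := aeval_cycPoly u (xElt q u r)
    rw [← h2, h1, Polynomial.aeval_algHom_apply, AdjoinRoot.aeval_eq, AdjoinRoot.mk_self, map_zero]
  mul_mem := by
    rintro i _ ⟨h, rfl⟩
    exact ⟨gen q u r i * h, map_mul _ _ _⟩
  span := span_xElt_pow_mul q u r
  E_apply := by
    rintro hr n _ ⟨h, rfl⟩
    have h1 : evalMul q u r (xElt q u r ^ n * inr q u r h) =
        xElt q u r * inr q u r (gen q u r 0) ^ n * inr q u r h := by
      rw [xElt_pow_mul, evalMul]
      simp only [LinearMap.comp_apply, TensorProduct.lift.tmul, evalGenZero_pow q u r hr,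
        LinearMap.mul_apply', AlgHom.toLinearMap_apply, LinearMap.mulLeft_apply, map_mul, map_pow,
        mul_assoc]
    rw [LinearMap.sub_apply, h1, LinearMap.mulLeft_apply, ← mul_assoc,
      ← ((xElt_commute q u r _).pow_left n).eq, sub_mul]

/-- The map `p ⊗ h ↦ c(p) h`, where `c(p)` is the coefficient of `x^{m-1}`. -/
noncomputable def contract : Coef q u r →ₗ[R] AK m r q u :=
  TensorProduct.lift (LinearMap.lsmul R (AK m r q u) ∘ₗ topCoeff u)

theorem contract_xElt_pow_mul (n : ℕ) (h : AK m r q u) :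
    contract q u r (xElt q u r ^ n * inr q u r h) =
      topCoeff u (AdjoinRoot.root (cycPoly u) ^ n) • h := by
  rw [xElt_pow_mul, contract, TensorProduct.lift.tmul, LinearMap.comp_apply, LinearMap.lsmul_apply]

theorem contract_inr_mul (h : AK m r q u) (z : Coef q u r) :
    contract q u r (inr q u r h * z) = h * contract q u r z := by
  induction z using TensorProduct.induction_on with
  | zero => simp
  | add x y hx hy => rw [mul_add, map_add, hx, hy, map_add, mul_add]
  | tmul p h' =>
    rw [inr, Algebra.TensorProduct.includeRight_apply, Algebra.TensorProduct.tmul_mul_tmul, one_mul,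
      contract, TensorProduct.lift.tmul, TensorProduct.lift.tmul, LinearMap.comp_apply,
      LinearMap.lsmul_apply, LinearMap.lsmul_apply, mul_smul_comm]

open InductionData

/-- The vectors `T_r⁻¹ ⋯ T_1⁻¹ (1 ⊗ h)`. -/
noncomputable def baseVec (h : AK m r q u) : Ind (Coef q u r) r :=
  (inducedData q u r).hom (ascInv q u (r + 1) r) (inc R (Coef q u r) r 0 (inr q u r h))

theorem hom_asc_baseVec (h : AK m r q u) :
    (inducedData q u r).hom (asc q u (r + 1) r) (baseVec q u r h) =
      inc R (Coef q u r) r 0 (inr q u r h) := by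
  rw [baseVec, ← Module.End.mul_apply, ← map_mul, asc_mul_ascInv q u (r + 1) (by omega), map_one,
    Module.End.one_apply]

theorem hom_genInv_one (hr : 0 < r) (z : Coef q u r) :
    (inducedData q u r).hom (genInv q u (r + 1) 1) (inc R (Coef q u r) r 0 z) =
      ((q⁻¹ : Rˣ) : R) • (inc R (Coef q u r) r 1 z + (1 - (q : R)) • inc R (Coef q u r) r 0 z) := by
  have h1 : (inducedData q u r).hom (gen q u (r + 1) 1) (((q⁻¹ : Rˣ) : R) •
      (inc R (Coef q u r) r 1 z + (1 - (q : R)) • inc R (Coef q u r) r 0 z)) =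
      inc R (Coef q u r) r 0 z := by
    have h1 := (inducedData q u r).act_up (Nat.zero_le r) z
    have h2 := (inducedData q u r).act_down (k := 0) hr z
    rw [zero_add] at h1 h2
    rw [hom_gen _ (by omega), map_smul, map_add, map_smul, h1, h2]
    have : ((q⁻¹ : Rˣ) : R) * (q : R) = 1 := Units.inv_mul q
    linear_combination (norm := module) this • inc R (Coef q u r) r 0 z
  rw [← h1, ← Module.End.mul_apply, ← map_mul, genInv_mul_gen q u (r + 1) le_rfl (by omega),
    map_one, Module.End.one_apply]
  rw [h1]

/-- For k = 0 the correction E(1 ⊗ h) = x ⊗ h - 1 ⊗ T_0 h combines with the (1 - q)-term of T_1⁻¹ so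
that x disappears. The further inverses commute with T_0. -/
theorem hom_gen_zero_ascInv (hr : 0 < r) (k : ℕ) (h : AK m r q u) :
    (inducedData q u r).hom (gen q u (r + 1) 0 * ascInv q u (r + 1) (k + 1))
      (inc R (Coef q u r) r 0 (inr q u r h)) =
    (inducedData q u r).hom (ascInv q u (r + 1) (k + 1))
      (inc R (Coef q u r) r 0 (inr q u r (gen q u r 0 * h))) := by
  induction k with
  | zero =>
    rw [ascInv, ascInv, mul_one, map_mul, Module.End.mul_apply, hom_genInv_one q u r hr,
      hom_genInv_one q u r hr, hom_gen _ (by omega)]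
    have h1 := (inducedData q u r).act_zero_inc (k := 0) hr
    have h2 := (inducedData q u r).E_apply' hr 0 (s := inr q u r h) ⟨h, rfl⟩
    rw [pow_zero, pow_zero, one_mul, one_mul, eq_sub_iff_add_eq] at h2
    have h3 := congrArg (inc R (Coef q u r) r 0) h2
    rw [map_add] at h3
    have h4 : inr q u r (gen q u r 0 * h) = (inducedData q u r).τ 0 * inr q u r h :=
      map_mul _ _ _
    simp only [map_smul, map_add, act_zero_inc_zero, h1, zero_add, chain, one_mul, ← h3, h4]
    module
  | succ k ih =>
    have hc := commute_genInv q u (r + 1) (gen_comm q u (r + 1) (i := 0) (j := k + 2)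
      (by omega)).symm
    rw [ascInv, ← mul_assoc, ← hc.eq, mul_assoc, map_mul, Module.End.mul_apply, ih, map_mul _ _ (ascInv _ _ _ _),
      Module.End.mul_apply]

theorem hom_gen_baseVec {j : ℕ} (hj : j < r) (h : AK m r q u) :
    (inducedData q u r).hom (gen q u (r + 1) j) (baseVec q u r h) =
      baseVec q u r (gen q u r j * h) := by
  rcases Nat.eq_zero_or_pos j with rfl | h0
  · obtain ⟨k, rfl⟩ : ∃ k, r = k + 1 := ⟨r - 1, by omega⟩
    rw [baseVec, ← Module.End.mul_apply, ← map_mul]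
    exact hom_gen_zero_ascInv q u (k + 1) hj k h
  · rw [baseVec, ← Module.End.mul_apply, ← map_mul,
      gen_mul_ascInv q u (r + 1) h0 (by omega) (by omega), map_mul, Module.End.mul_apply,
      hom_gen _ (by omega), act_far _ (Nat.zero_le r) (by omega), baseVec, map_mul (inr q u r)]
    rfl

/-- In the model T_0^n T_1⋯T_r h of x^n ⊗ h, the vector attached to h is h itself, on which H_m^r
acts by left multiplication. -/
theorem hom_incl_baseVec (h' h : AK m r q u) :
    (inducedData q u r).hom (incl q u r h') (baseVec q u r h) = baseVec q u r (h' * h) := by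
  have hlin : ∀ x y : AK m r q u, baseVec q u r (x + y) = baseVec q u r x + baseVec q u r y :=
    fun x y => by rw [baseVec, map_add, map_add, map_add]; rfl
  have hsmul : ∀ (c : R) (y : AK m r q u), baseVec q u r (c • y) = c • baseVec q u r y :=
    fun x y => by rw [baseVec, map_smul, map_smul, map_smul]; rfl
  have : h' ∈ Algebra.adjoin R (Set.range (gen q u r)) := by rw [adjoin_gen]; trivial
  induction this using Algebra.adjoin_induction generalizing h with
  | mem x hx =>
    obtain ⟨j, rfl⟩ := hx
    rcases Nat.lt_or_ge j r with hj | hj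
    · rw [incl_gen q u r hj, hom_gen_baseVec q u r hj]
    · rw [gen_of_le q u r hj, map_zero, map_zero, zero_mul, LinearMap.zero_apply]
      have := hsmul 0 0
      rwa [zero_smul, zero_smul, eq_comm] at this
  | algebraMap c =>
    rw [AlgHom.commutes, AlgHom.commutes, Module.algebraMap_end_apply, ← hsmul, ← Algebra.smul_def]
  | add x y _ _ hx hy => rw [map_add, map_add, LinearMap.add_apply, hx, hy, add_mul, hlin]
  | mul x y _ _ hx hy => rw [map_mul, map_mul, Module.End.mul_apply, hy, hx, mul_assoc]

end Induced
end ArikiKoike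

namespace ArikiKoike

/-! ### Extending a functional from H_m^r to H_m^{r+1} -/

section Descend

variable {R : Type*} [CommRing R] {m : ℕ} (q : Rˣ) (u : Fin m → R) (r : ℕ)

open InductionData

/-- The filtration of `R[x] / ((x - u_1) ⋯ (x - u_m)) ⊗ H_m^r` by degree. -/
noncomputable def coefFil (d : ℕ) : Submodule R (Coef q u r) :=
  Submodule.span R {z | ∃ (j e : ℕ) (h : AK m r q u), h ∈ fil q u r e ∧ j + e ≤ d ∧
    z = xElt q u r ^ j * inr q u r h}

/-- The filtration of the induced module by degree. -/
noncomputable def indFil (d : ℕ) : Submodule R (Ind (Coef q u r) r) :=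
  ⨆ k : Fin (r + 1), (coefFil q u r d).map (inc R (Coef q u r) r k)

variable {q u r}

theorem inc_mem_indFil {d k : ℕ} (hk : k ≤ r) {z : Coef q u r} (hz : z ∈ coefFil q u r d) :
    inc R (Coef q u r) r k z ∈ indFil q u r d :=
  (le_iSup (fun k : Fin (r + 1) => (coefFil q u r d).map (inc R (Coef q u r) r k)) ⟨k, by omega⟩)
    (Submodule.mem_map_of_mem hz)

theorem indFil_le {d : ℕ} {N : Submodule R (Ind (Coef q u r) r)}
    (h : ∀ k ≤ r, ∀ z ∈ coefFil q u r d, inc R (Coef q u r) r k z ∈ N) : indFil q u r d ≤ N := by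
  refine iSup_le fun k => ?_
  rintro _ ⟨z, hz, rfl⟩
  exact h k (by omega) z hz

theorem coefFil_mono {d e : ℕ} (h : d ≤ e) : coefFil q u r d ≤ coefFil q u r e :=
  Submodule.span_mono fun _ ⟨j, e', y, h1, h2, h3⟩ => ⟨j, e', y, h1, by omega, h3⟩

theorem indFil_mono {d e : ℕ} (h : d ≤ e) : indFil q u r d ≤ indFil q u r e :=
  indFil_le fun _ hk _ hz => inc_mem_indFil hk (coefFil_mono h hz)

theorem map_mem_of_coefFil {d e : ℕ} (f : Coef q u r →ₗ[R] Coef q u r)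
    (h : ∀ (j i : ℕ) (h : AK m r q u), h ∈ fil q u r i → j + i ≤ d →
      f (xElt q u r ^ j * inr q u r h) ∈ coefFil q u r e)
    {z : Coef q u r} (hz : z ∈ coefFil q u r d) : f z ∈ coefFil q u r e := by
  have : coefFil q u r d ≤ (coefFil q u r e).comap f := by
    refine Submodule.span_le.mpr ?_
    rintro _ ⟨j, i, y, h1, h2, rfl⟩
    exact h j i y h1 h2
  exact this hz

theorem basic_mem_coefFil {d j e : ℕ} {h : AK m r q u} (hh : h ∈ fil q u r e) (hd : j + e ≤ d) :
    xElt q u r ^ j * inr q u r h ∈ coefFil q u r d :=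
  Submodule.subset_span ⟨j, e, h, hh, hd, rfl⟩

theorem gen_mul_mem_coefFil {d i : ℕ} (hi : 1 ≤ i) {z : Coef q u r} (hz : z ∈ coefFil q u r d) :
    (inducedData q u r).τ i * z ∈ coefFil q u r d := by
  refine map_mem_of_coefFil (LinearMap.mulLeft R ((inducedData q u r).τ i)) (fun j e h hh hd => ?_) hz
  rw [LinearMap.mulLeft_apply]
  have h1 := (inducedData q u r).commute_assoc j i (inr q u r h)
  have h2 : (inducedData q u r).τ i * inr q u r h = inr q u r (gen q u r i * h) :=
    (map_mul _ _ _).symm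
  rw [h2] at h1
  exact h1 ▸ basic_mem_coefFil (mul_mem_fil_of_one (gen_mem_fil hi) hh) hd

theorem gen_zero_mul_mem_coefFil {d : ℕ} {z : Coef q u r} (hz : z ∈ coefFil q u r d) :
    (inducedData q u r).τ 0 * z ∈ coefFil q u r (d + 1) := by
  refine map_mem_of_coefFil (LinearMap.mulLeft R ((inducedData q u r).τ 0)) (fun j e h hh hd => ?_) hz
  rw [LinearMap.mulLeft_apply]
  have h1 := (inducedData q u r).commute_assoc j 0 (inr q u r h)
  have h2 : (inducedData q u r).τ 0 * inr q u r h = inr q u r (gen q u r 0 * h) :=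
    (map_mul _ _ _).symm
  rw [h2] at h1
  exact h1 ▸ basic_mem_coefFil (mul_mem_fil (d := 1) gen_zero_mem_fil hh) (by omega)

theorem X_mul_mem_coefFil {d : ℕ} {z : Coef q u r} (hz : z ∈ coefFil q u r d) :
    (inducedData q u r).X * z ∈ coefFil q u r (d + 1) := by
  refine map_mem_of_coefFil (LinearMap.mulLeft R ((inducedData q u r).X)) (fun j e h hh hd => ?_) hz
  rw [LinearMap.mulLeft_apply]
  have h1 : (inducedData q u r).X * (xElt q u r ^ j * inr q u r h) =
      xElt q u r ^ (j + 1) * inr q u r h := by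
    rw [pow_succ', mul_assoc]; rfl
  rw [h1]
  exact basic_mem_coefFil hh (by omega)

theorem gen_zero_pow_mul_mem_fil {e n : ℕ} {h : AK m r q u} (hh : h ∈ fil q u r e) :
    gen q u r 0 ^ n * h ∈ fil q u r (n + e) := by
  induction n with
  | zero => rwa [pow_zero, one_mul, zero_add]
  | succ n ih =>
    rw [pow_succ', mul_assoc]
    exact fil_mono (by omega) (mul_mem_fil (d := 1) gen_zero_mem_fil ih)

theorem E_mem_coefFil (hr : 0 < r) {d : ℕ} {z : Coef q u r} (hz : z ∈ coefFil q u r d) :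
    (inducedData q u r).E z ∈ coefFil q u r (d + 1) := by
  refine map_mem_of_coefFil ((inducedData q u r).E) (fun j e h hh hd => ?_) hz
  have h1 := (inducedData q u r).E_apply' hr j (s := inr q u r h) ⟨h, rfl⟩
  have h2 : (inducedData q u r).τ 0 ^ j * inr q u r h = inr q u r (gen q u r 0 ^ j * h) := by
    rw [map_mul, map_pow]; rfl
  have h3 := basic_mem_coefFil (j := 0) (d := d) (gen_zero_pow_mul_mem_fil (n := j) hh) (by omega)
  rw [pow_zero, one_mul, ← h2] at h3
  have h4 := gen_zero_mul_mem_coefFil (basic_mem_coefFil (j := j) hh hd)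
  have h5 := (inducedData q u r).commute_assoc j 0 (inr q u r h)
  rw [← h5] at h1
  change (inducedData q u r).E ((inducedData q u r).X ^ j * _) ∈ _
  rw [h1]
  exact Submodule.sub_mem _ (X_mul_mem_coefFil h3) h4

theorem chain_mul_mem_coefFil {d k : ℕ} {z : Coef q u r} (hz : z ∈ coefFil q u r d) :
    (inducedData q u r).chain k * z ∈ coefFil q u r d := by
  induction k with
  | zero => rw [chain, one_mul]; exact hz
  | succ k ih => rw [chain, mul_assoc]; exact gen_mul_mem_coefFil (by omega) ih

theorem act_zero_mem_indFil {d : ℕ} {n : Ind (Coef q u r) r} (hn : n ∈ indFil q u r d) :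
    (inducedData q u r).act 0 n ∈ indFil q u r (d + 1) := by
  have : indFil q u r d ≤ (indFil q u r (d + 1)).comap ((inducedData q u r).act 0) := by
    refine indFil_le fun k hk z hz => ?_
    rw [Submodule.mem_comap]
    rcases Nat.eq_zero_or_pos k with rfl | h0
    · rw [act_zero_inc_zero]
      exact inc_mem_indFil hk (X_mul_mem_coefFil hz)
    · obtain ⟨k, rfl⟩ : ∃ k', k = k' + 1 := ⟨k - 1, by omega⟩
      rw [act_zero_inc _ hk]
      exact Submodule.add_mem _ (inc_mem_indFil hk (gen_zero_mul_mem_coefFil hz))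
        (Submodule.smul_mem _ _ (inc_mem_indFil (Nat.zero_le _)
          (chain_mul_mem_coefFil (E_mem_coefFil (by omega) hz))))
  exact this hn

theorem act_mem_indFil {d i : ℕ} (h1 : 1 ≤ i) (h2 : i ≤ r) {n : Ind (Coef q u r) r}
    (hn : n ∈ indFil q u r d) : (inducedData q u r).act i n ∈ indFil q u r d := by
  have : indFil q u r d ≤ (indFil q u r d).comap ((inducedData q u r).act i) := by
    refine indFil_le fun k hk z hz => ?_
    rw [Submodule.mem_comap]
    obtain ⟨i, rfl⟩ : ∃ i', i = i' + 1 := ⟨i - 1, by omega⟩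
    rcases Nat.lt_trichotomy i k with h | h | h
    · rcases Nat.lt_or_ge (i + 1) k with h' | h'
      · rw [act_near _ hk (by omega) h']
        exact inc_mem_indFil hk (gen_mul_mem_coefFil (by omega) hz)
      · obtain rfl : k = i + 1 := by omega
        rw [act_down _ hk]
        exact Submodule.add_mem _ (Submodule.smul_mem _ _ (inc_mem_indFil (by omega) hz))
          (Submodule.smul_mem _ _ (inc_mem_indFil hk hz))
    · subst h
      rw [act_up _ hk]
      exact inc_mem_indFil h2 hz
    · rw [act_far _ hk (by omega)]
      exact inc_mem_indFil hk (gen_mul_mem_coefFil (by omega) hz)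
  exact this hn

theorem hom_word_mem_indFil (l : List ℕ) {d : ℕ} {n : Ind (Coef q u r) r}
    (hn : n ∈ indFil q u r d) :
    (inducedData q u r).hom ((l.map (gen q u (r + 1))).prod) n ∈
      indFil q u r (d + l.count 0) := by
  induction l with
  | nil => rw [List.map_nil, List.prod_nil, map_one]; exact hn
  | cons i l ih =>
    rw [List.map_cons, List.prod_cons, map_mul, Module.End.mul_apply]
    rcases Nat.lt_or_ge i (r + 1) with h | h
    · rw [hom_gen _ h]
      rcases Nat.eq_zero_or_pos i with rfl | h0
      · rw [List.count_cons_self]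
        exact act_zero_mem_indFil ih
      · rw [List.count_cons_of_ne (by omega)]
        exact act_mem_indFil h0 (by omega) ih
    · rw [gen_of_le q u _ h, map_zero, LinearMap.zero_apply]
      exact Submodule.zero_mem _

theorem hom_mem_indFil {d e : ℕ} {x : AK m (r + 1) q u} (hx : x ∈ fil q u (r + 1) (e + 1))
    {n : Ind (Coef q u r) r} (hn : n ∈ indFil q u r d) :
    (inducedData q u r).hom x n ∈ indFil q u r (d + e) := by
  induction hx using Submodule.span_induction with
  | mem x hx =>
    obtain ⟨l, hl, rfl⟩ := hx
    exact indFil_mono (by omega) (hom_word_mem_indFil l hn)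
  | zero => rw [map_zero]; exact Submodule.zero_mem _
  | add x y _ _ hx hy => rw [map_add]; exact Submodule.add_mem _ hx hy
  | smul c x _ hx => rw [map_smul]; exact Submodule.smul_mem _ c hx

theorem baseVec_one_mem_indFil : baseVec q u r 1 ∈ indFil q u r 1 := by
  have h1 := basic_mem_coefFil (q := q) (u := u) (r := r) (j := 0) (d := 1) (one_mem_fil 0) le_rfl
  rw [pow_zero, one_mul] at h1
  exact hom_mem_indFil (e := 0) (ascInv_mem_fil r) (inc_mem_indFil (Nat.zero_le r) h1)

/-- The map from the induced module to `H_m^{r+1}` sending `x^{m-1} ⊗ h` in the summand of index `k`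
to `T_k ⋯ T_1 T_1 ⋯ T_r φ(h)`. -/
noncomputable def descend (φ : AK m r q u →ₗ[R] AK m r q u) :
    Ind (Coef q u r) r →ₗ[R] AK m (r + 1) q u :=
  Finsupp.lsum R fun k : Fin (r + 1) =>
    LinearMap.mulLeft R (desc q u (r + 1) k * asc q u (r + 1) r) ∘ₗ (incl q u r).toLinearMap ∘ₗ
      φ ∘ₗ contract q u r

theorem descend_inc (φ : AK m r q u →ₗ[R] AK m r q u) {k : ℕ} (hk : k ≤ r) (z : Coef q u r) :
    descend φ (inc R (Coef q u r) r k z) = desc q u (r + 1) k * asc q u (r + 1) r *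
      incl q u r (φ (contract q u r z)) := by
  rw [inc, dif_pos (show k < r + 1 by omega), descend, Finsupp.lsingle_apply, Finsupp.lsum_single]
  rfl

variable {φ : AK m r q u →ₗ[R] AK m r q u}

/-- Crossing T_1⋯T_r raises the index of a generator by one and crossing T_k⋯T_1 lowers it if it is
small enough, just as in the action on summand k. T_0 is left out: the middle power of T_0 has been
dropped from the model. -/
theorem descend_act (hφ : ∀ i, 1 ≤ i → i < r → ∀ h, φ (gen q u r i * h) = gen q u r i * φ h)
    {i : ℕ} (h1 : 1 ≤ i) (h2 : i ≤ r) (n : Ind (Coef q u r) r) :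
    descend φ ((inducedData q u r).act i n) = gen q u (r + 1) i * descend φ n := by
  have hc : ∀ j, 1 ≤ j → j < r → ∀ z, incl q u r (φ (contract q u r ((inducedData q u r).τ j * z))) =
      gen q u (r + 1) j * incl q u r (φ (contract q u r z)) := fun j hj hj' z => by
    have := contract_inr_mul q u r (gen q u r j) z
    rw [← incl_gen q u r hj', ← map_mul, ← hφ j hj hj', ← this]
    rfl
  refine LinearMap.congr_fun (f := descend φ ∘ₗ (inducedData q u r).act i)
    (g := LinearMap.mulLeft R (gen q u (r + 1) i) ∘ₗ descend φ) (ind_ext fun k hk z => ?_) n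
  rw [LinearMap.comp_apply, LinearMap.comp_apply, LinearMap.mulLeft_apply]
  obtain ⟨i, rfl⟩ : ∃ i', i = i' + 1 := ⟨i - 1, by omega⟩
  rcases Nat.lt_trichotomy i k with h | h | h
  · rcases Nat.lt_or_ge (i + 1) k with h' | h'
    · rw [act_near _ hk (by omega) h', descend_inc φ hk, descend_inc φ hk, hc _ (by omega) (by omega),
        ← mul_assoc, mul_assoc (desc _ _ _ _), asc_mul_gen _ _ _ (by omega) (by omega),
        ← mul_assoc (desc _ _ _ _), desc_mul_gen _ _ _ (by omega) (by omega)]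
      simp only [mul_assoc]
    · obtain rfl : k = i + 1 := by omega
      rw [act_down _ hk, map_add, map_smul, map_smul, descend_inc φ hk, descend_inc φ (by omega)]
      have h3 := gen_mul_self q u (r + 1) (i := i + 1) (by omega) (by omega)
      rw [desc, mul_assoc, mul_assoc, mul_assoc, ← mul_assoc (gen q u (r + 1) (i + 1))
        (gen q u (r + 1) (i + 1)), h3, add_mul, smul_mul_assoc, smul_mul_assoc, one_mul]
      exact add_comm _ _
  · subst h
    rw [act_up _ hk, descend_inc φ hk, descend_inc φ h2, desc]
    simp only [mul_assoc]
  · rw [act_far _ hk (by omega), descend_inc φ hk, descend_inc φ hk, hc _ (by omega) (by omega),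
      ← mul_assoc, mul_assoc (desc _ _ _ _), asc_mul_gen _ _ _ (by omega) (by omega),
      ← mul_assoc (desc _ _ _ _), ← (gen_commute_desc _ _ _ (by omega)).eq]
    simp only [mul_assoc]

/-- For x^j ⊗ h with j < m - 1 the top coefficient is zero; for j ≥ m - 1 the degree left for h is
below r(m - 1). -/
theorem descend_eq_zero [Nontrivial R] (hφ : ∀ h ∈ fil q u r (r * (m - 1)), φ h = 0)
    {n : Ind (Coef q u r) r} (hn : n ∈ indFil q u r ((r + 1) * (m - 1))) : descend φ n = 0 := by
  have : indFil q u r ((r + 1) * (m - 1)) ≤ LinearMap.ker (descend φ) := by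
    refine indFil_le fun k hk z hz => ?_
    rw [LinearMap.mem_ker, descend_inc φ hk]
    have : φ (contract q u r z) = 0 := by
      have h0 : coefFil q u r ((r + 1) * (m - 1)) ≤ LinearMap.ker (φ ∘ₗ contract q u r) := by
        refine Submodule.span_le.mpr ?_
        rintro _ ⟨j, e, h, hh, hd, rfl⟩
        rw [SetLike.mem_coe, LinearMap.mem_ker, LinearMap.comp_apply, contract_xElt_pow_mul,
          map_smul]
        rcases Nat.lt_or_ge j (m - 1) with hj | hj
        · rw [topCoeff_pow u (by omega), if_neg (by omega), zero_smul]
        · rw [hφ h (fil_mono (by rw [add_mul] at hd; omega) hh), smul_zero]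
      exact h0 hz
    rw [this, map_zero, mul_zero]
  exact this hn

/-- Extension of a functional from `H_m^r` to `H_m^{r+1}`. -/
theorem exists_extension [Nontrivial R] (hm : 2 ≤ m)
    (hφ : ∀ i, 1 ≤ i → i < r → ∀ h, φ (gen q u r i * h) = gen q u r i * φ h)
    (hφ' : ∀ h ∈ fil q u r (r * (m - 1)), φ h = 0) :
    ∃ ψ : AK m (r + 1) q u →ₗ[R] AK m (r + 1) q u,
      (∀ i, 1 ≤ i → i < r + 1 → ∀ h, ψ (gen q u (r + 1) i * h) = gen q u (r + 1) i * ψ h) ∧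
      (∀ h ∈ fil q u (r + 1) ((r + 1) * (m - 1)), ψ h = 0) ∧
      (∀ h, ψ (incl q u r h) = 0) ∧
      ∀ h, ψ (gen q u (r + 1) 0 ^ (m - 1) * asc q u (r + 1) r * incl q u r h) =
        asc q u (r + 1) r * incl q u r (φ h) := by
  let ψ : AK m (r + 1) q u →ₗ[R] AK m (r + 1) q u :=
    descend φ ∘ₗ (LinearMap.applyₗ (baseVec q u r 1)) ∘ₗ (inducedData q u r).hom.toLinearMap
  have hψ : ∀ h, ψ h = descend φ ((inducedData q u r).hom h (baseVec q u r 1)) := fun _ => rfl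
  have hlin : ∀ i, 1 ≤ i → i < r + 1 → ∀ h,
      ψ (gen q u (r + 1) i * h) = gen q u (r + 1) i * ψ h := by
    intro i h1 h2 h
    rw [hψ, hψ, map_mul, Module.End.mul_apply, hom_gen _ h2, descend_act hφ h1 (by omega)]
  have hasc : ∀ k ≤ r, ∀ h, ψ (asc q u (r + 1) k * h) = asc q u (r + 1) k * ψ h := by
    intro k
    induction k with
    | zero => intro _ h; rw [asc, one_mul, one_mul]
    | succ k ih =>
      intro hk h
      rw [asc, mul_assoc, ih (by omega), hlin _ (by omega) (by omega), mul_assoc]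
  refine ⟨ψ, hlin, fun h hh => ?_, fun h => ?_, fun h => ?_⟩
  · rw [hψ]
    refine descend_eq_zero hφ' ?_
    -- Since m ≥ 2 the bound is positive, so one unit of it can be spent on the base vector, which
    -- lies in step 1 of the filtration.
    obtain ⟨e, he⟩ : ∃ e, (r + 1) * (m - 1) = e + 1 :=
      Nat.exists_eq_add_one.mpr (Nat.mul_pos (Nat.succ_pos r) (by omega))
    rw [he] at hh ⊢
    rw [add_comm e]
    exact hom_mem_indFil hh baseVec_one_mem_indFil
  -- T_1⋯T_r carries the base vector of h to 1 ⊗ h in summand 0, and the coefficient of x^{m-1} in 1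
  -- is 0 because m ≥ 2. Invertibility of T_1⋯T_r finishes.
  · have h1 : asc q u (r + 1) r * ψ (incl q u r h) = 0 := by
      rw [← hasc r le_rfl, hψ, map_mul, Module.End.mul_apply, hom_incl_baseVec, mul_one,
        hom_asc_baseVec, descend_inc φ (Nat.zero_le r)]
      have h2 := contract_xElt_pow_mul q u r 0 h
      rw [pow_zero, one_mul, topCoeff_pow u (by omega), if_neg (by omega), zero_smul] at h2
      rw [h2, map_zero, map_zero, mul_zero]
    have := congrArg (ascInv q u (r + 1) r * ·) h1
    simpa only [← mul_assoc, ascInv_mul_asc q u (r + 1) (show r = 0 ∨ r < r + 1 by omega), one_mul,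
      mul_zero] using this
  · have hpow : ∀ n z, (inducedData q u r).hom (gen q u (r + 1) 0 ^ n)
        (inc R (Coef q u r) r 0 z) = inc R (Coef q u r) r 0 (xElt q u r ^ n * z) := by
      intro n
      induction n with
      | zero => intro z; rw [pow_zero, pow_zero, one_mul, map_one, Module.End.one_apply]
      | succ n ih =>
        intro z
        rw [pow_succ', map_mul, Module.End.mul_apply, ih, hom_gen _ (Nat.succ_pos r),
          act_zero_inc_zero, pow_succ', mul_assoc]
        rfl
    rw [hψ, mul_assoc, map_mul, Module.End.mul_apply, map_mul, Module.End.mul_apply,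
      hom_incl_baseVec, mul_one, hom_asc_baseVec, hpow, descend_inc φ (Nat.zero_le r),
      contract_xElt_pow_mul, topCoeff_pow u (by omega), if_pos rfl, one_smul, desc, one_mul]

end Descend
end ArikiKoike

namespace ArikiKoike

/-! ### Final segments of T_1⋯T_r and of T_1⁻¹⋯T_r⁻¹ -/

section Segments

variable {R : Type*} [CommRing R] {m : ℕ} (q : Rˣ) (u : Fin m → R) (r : ℕ)

/-- The product `T_1⁻¹ ⋯ T_n⁻¹`. -/
def ascGenInv : ℕ → AK m r q u
  | 0 => 1
  | n + 1 => ascGenInv n * genInv q u r (n + 1)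

/-- The product `T_{r-n+1} ⋯ T_r` in `H_m^{r+1}`. -/
def seg : ℕ → AK m (r + 1) q u
  | 0 => 1
  | n + 1 => gen q u (r + 1) (r - n) * seg n

/-- The product `T_{r-n+1}⁻¹ ⋯ T_r⁻¹` in `H_m^{r+1}`. -/
def segInv : ℕ → AK m (r + 1) q u
  | 0 => 1
  | n + 1 => genInv q u (r + 1) (r - n) * segInv n

theorem asc_mul_seg {n : ℕ} (h : n ≤ r) :
    asc q u (r + 1) (r - n) * seg q u r n = asc q u (r + 1) r := by
  induction n with
  | zero => rw [seg, mul_one, Nat.sub_zero]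
  | succ n ih =>
    have e : r - n = r - (n + 1) + 1 := by omega
    rw [← ih (by omega), seg, e, asc, mul_assoc]

theorem ascGenInv_mul_segInv {n : ℕ} (h : n ≤ r) :
    ascGenInv q u (r + 1) (r - n) * segInv q u r n = ascGenInv q u (r + 1) r := by
  induction n with
  | zero => rw [segInv, mul_one, Nat.sub_zero]
  | succ n ih =>
    have e : r - n = r - (n + 1) + 1 := by omega
    rw [← ih (by omega), segInv, e, ascGenInv, mul_assoc]

theorem isUnit_genInv {i : ℕ} (h1 : 1 ≤ i) (h2 : i < r) : IsUnit (genInv q u r i) :=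
  ⟨⟨_, _, genInv_mul_gen q u r h1 h2, gen_mul_genInv q u r h1 h2⟩, rfl⟩

theorem isUnit_ascGenInv {n : ℕ} (h : n = 0 ∨ n < r) : IsUnit (ascGenInv q u r n) := by
  induction n with
  | zero => exact isUnit_one
  | succ n ih => exact (ih (by omega)).mul (isUnit_genInv q u r (by omega) (by omega))

theorem isUnit_asc {n : ℕ} (h : n = 0 ∨ n < r) : IsUnit (asc q u r n) :=
  ⟨⟨_, _, asc_mul_ascInv q u r h, ascInv_mul_asc q u r h⟩, rfl⟩

theorem ascGenInv_mem_fil (n : ℕ) : ascGenInv q u r n ∈ fil q u r 1 := by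
  induction n with
  | zero => exact one_mem_fil 0
  | succ n ih => exact mul_mem_fil_of_one ih (genInv_mem_fil (by omega))

theorem commute_ascGenInv {n : ℕ} {x : AK m r q u}
    (h : ∀ i, 1 ≤ i → i ≤ n → Commute (gen q u r i) x) : Commute (ascGenInv q u r n) x := by
  induction n with
  | zero => exact Commute.one_left _
  | succ n ih =>
    exact (ih fun i h1 h2 => h i h1 (by omega)).mul_left
      (commute_genInv q u r (h (n + 1) (by omega) le_rfl))

theorem genInv_mul {i : ℕ} (x : AK m r q u) : genInv q u r i * x =
    ((q⁻¹ : Rˣ) : R) • (gen q u r i * x) + (((q⁻¹ : Rˣ) : R) - 1) • x := by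
  have hq : ((q⁻¹ : Rˣ) : R) * ((q : R) - 1) = 1 - ((q⁻¹ : Rˣ) : R) := by
    rw [mul_sub, Units.inv_mul, mul_one]
  rw [genInv, smul_mul_assoc, sub_mul, smul_mul_assoc, one_mul, smul_sub, smul_smul, hq]
  module

theorem genInv_mul_jm {i : ℕ} (h1 : 1 ≤ i) (h2 : i < r) : genInv q u r i * jm q u r i =
    jm q u r (i + 1) * genInv q u r i + (((q⁻¹ : Rˣ) : R) - 1) • jm q u r i := by
  have e : jm q u r (i + 1) * genInv q u r i = ((q⁻¹ : Rˣ) : R) • (gen q u r i * jm q u r i) := by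
    rw [genInv, mul_smul_comm, mul_sub, jm_succ_mul_gen q u r h1 h2, mul_smul_comm, mul_one,
      add_sub_cancel_right]
  rw [genInv_mul, e]

end Segments

/-! ### The elements T_w sorted by the preimage of the last letter -/

section LastLetter

variable {R : Type*} [CommRing R] {m : ℕ} (q : Rˣ) (u : Fin m → R) (r : ℕ)

theorem T_mul_gen {w : Equiv.Perm (Fin r)} {k : ℕ} (h1 : 1 ≤ k) (h2 : k < r) :
    ∃ c d : R, T q u w * gen q u r k = c • T q u w + d • T q u (simpleRefl r k * w) := by
  by_cases h : IsDescent w⁻¹ k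
  · refine ⟨(q : R) - 1, q, ?_⟩
    conv_lhs => rw [T_of_isDescent_inv q u h, mul_assoc, gen_mul_self q u r h1 h2, mul_add,
      mul_smul_comm, mul_smul_comm, mul_one, ← T_of_isDescent_inv q u h]
  · exact ⟨0, 1, by rw [T_mul_gen_of_not_isDescent q u h1 h2 h, zero_smul, one_smul, zero_add]⟩

/-- The span of the `T_w` for which the last letter is the image of a letter `≥ A`. -/
noncomputable def lastSpan (A : ℕ) : Submodule R (AK m (r + 1) q u) :=
  Submodule.span R {x | ∃ (w : Equiv.Perm (Fin (r + 1))) (p : Fin (r + 1)),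
    w p = Fin.last r ∧ A ≤ p.val ∧ x = T q u w}

variable {q u r}

theorem T_mem_lastSpan {A : ℕ} {w : Equiv.Perm (Fin (r + 1))} {p : Fin (r + 1)}
    (h1 : w p = Fin.last r) (h2 : A ≤ p.val) : T q u w ∈ lastSpan q u r A :=
  Submodule.subset_span ⟨w, p, h1, h2, rfl⟩

theorem lastSpan_anti {A B : ℕ} (h : A ≤ B) : lastSpan q u r B ≤ lastSpan q u r A :=
  Submodule.span_mono fun _ ⟨w, p, h1, h2, h3⟩ => ⟨w, p, h1, by omega, h3⟩

theorem one_mem_lastSpan {A : ℕ} (h : A ≤ r) : 1 ∈ lastSpan q u r A := by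
  rw [← T_one q u]
  exact T_mem_lastSpan (p := Fin.last r) rfl h

/-- Only s_A can carry a letter from A or above to a letter below A. -/
theorem gen_mul_mem_lastSpan {A k : ℕ} (h1 : 1 ≤ k) (h2 : k ≤ r) (hA : k ≠ A)
    {x : AK m (r + 1) q u} (hx : x ∈ lastSpan q u r A) :
    gen q u (r + 1) k * x ∈ lastSpan q u r A := by
  induction hx using Submodule.span_induction with
  | mem x hx =>
    obtain ⟨w, p, h3, h4, rfl⟩ := hx
    obtain ⟨c, d, e⟩ := gen_mul_T q u (w := w) h1 (show k < r + 1 by omega)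
    rw [e]
    refine Submodule.add_mem _ (Submodule.smul_mem _ _ (T_mem_lastSpan h3 h4))
      (Submodule.smul_mem _ _ (T_mem_lastSpan (p := simpleRefl (r + 1) k p) ?_ ?_))
    · rw [Equiv.Perm.mul_apply, simpleRefl_apply_self, h3]
    · rw [simpleRefl_val ⟨h1, by omega⟩]
      split_ifs <;> omega
  | zero => rw [mul_zero]; exact Submodule.zero_mem _
  | add x y _ _ hx hy => rw [mul_add]; exact Submodule.add_mem _ hx hy
  | smul c x _ hx => rw [mul_smul_comm]; exact Submodule.smul_mem _ c hx

theorem mul_gen_mem_lastSpan {A k : ℕ} (h1 : 1 ≤ k) (h2 : k < r)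
    {x : AK m (r + 1) q u} (hx : x ∈ lastSpan q u r A) :
    x * gen q u (r + 1) k ∈ lastSpan q u r A := by
  induction hx using Submodule.span_induction with
  | mem x hx =>
    obtain ⟨w, p, h3, h4, rfl⟩ := hx
    obtain ⟨c, d, e⟩ := T_mul_gen q u (r + 1) (w := w) h1 (by omega)
    rw [e]
    refine Submodule.add_mem _ (Submodule.smul_mem _ _ (T_mem_lastSpan h3 h4))
      (Submodule.smul_mem _ _ (T_mem_lastSpan (p := p) ?_ h4))
    rw [Equiv.Perm.mul_apply, h3, simpleRefl_apply_of_ne] <;> rw [Fin.val_last] <;> omega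
  | zero => rw [zero_mul]; exact Submodule.zero_mem _
  | add x y _ _ hx hy => rw [add_mul]; exact Submodule.add_mem _ hx hy
  | smul c x _ hx => rw [smul_mul_assoc]; exact Submodule.smul_mem _ c hx

theorem mul_incl_T_mem_lastSpan {A : ℕ} (w : Equiv.Perm (Fin r))
    {x : AK m (r + 1) q u} (hx : x ∈ lastSpan q u r A) :
    x * incl q u r (T q u w) ∈ lastSpan q u r A := by
  induction w using descent_induction generalizing x with
  | h1 => rwa [T_one, map_one, mul_one]
  | h w k hk ih =>
    rw [T_of_isDescent q u hk, map_mul, incl_gen q u r hk.1.2, ← mul_assoc]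
    exact ih (mul_gen_mem_lastSpan hk.1.1 hk.1.2 hx)

theorem genInv_mul_mem_lastSpan {A k : ℕ} (h1 : 1 ≤ k) (h2 : k ≤ r) (hA : k ≠ A)
    {x : AK m (r + 1) q u} (hx : x ∈ lastSpan q u r A) :
    genInv q u (r + 1) k * x ∈ lastSpan q u r A := by
  rw [genInv_mul]
  exact Submodule.add_mem _ (Submodule.smul_mem _ _ (gen_mul_mem_lastSpan h1 h2 hA hx))
    (Submodule.smul_mem _ _ hx)

theorem segInv_mem_lastSpan {n : ℕ} (h : n ≤ r) : segInv q u r n ∈ lastSpan q u r (r - n) := by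
  induction n with
  | zero => exact one_mem_lastSpan le_rfl
  | succ n ih =>
    exact genInv_mul_mem_lastSpan (by omega) (by omega) (by omega)
      (lastSpan_anti (by omega) (ih (by omega)))

/-- Expand each T_k⁻¹ as q⁻¹ T_k + (q⁻¹ - 1). Only the term keeping every generator brings the
preimage of the last letter down to r - n; all others leave it further right. -/
theorem segInv_sub_mem_lastSpan {n : ℕ} (h : n ≤ r) :
    segInv q u r n - ((q⁻¹ : Rˣ) : R) ^ n • seg q u r n ∈ lastSpan q u r (r + 1 - n) := by
  induction n with
  | zero =>
    rw [segInv, seg, pow_zero, one_smul, sub_self]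
    exact Submodule.zero_mem _
  | succ n ih =>
    have h1 := gen_mul_mem_lastSpan (k := r - n) (by omega) (by omega) (by omega) (ih (by omega))
    have h2 := lastSpan_anti (A := r + 1 - (n + 1)) (by omega) h1
    have h3 := lastSpan_anti (A := r + 1 - (n + 1)) (by omega)
      (segInv_mem_lastSpan (q := q) (u := u) (r := r) (n := n) (by omega))
    have h4 := Submodule.add_mem _ (Submodule.smul_mem _ ((q⁻¹ : Rˣ) : R) h2)
      (Submodule.smul_mem _ (((q⁻¹ : Rˣ) : R) - 1) h3)
    convert h4 using 1
    rw [segInv, seg, genInv_mul, mul_sub, mul_smul_comm, smul_sub, smul_smul, ← pow_succ',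
      add_sub_right_comm]

/-- A permutation of `r` letters, considered as a permutation of `r + 1` letters. -/
theorem exists_incl_T (w : Equiv.Perm (Fin r)) : ∃ w' : Equiv.Perm (Fin (r + 1)),
    incl q u r (T q u w) = T q u w' ∧ (∀ p : Fin r, w' p.castSucc = (w p).castSucc) ∧
      w' (Fin.last r) = Fin.last r := by
  induction w using descent_induction with
  | h1 => exact ⟨1, by rw [T_one, T_one, map_one], fun _ => rfl, rfl⟩
  | h w k hk ih =>
    obtain ⟨w', h1, h2, h3⟩ := ih
    have hk' := hk.1
    have hk2 : 1 ≤ k ∧ k < r + 1 := ⟨hk'.1, by omega⟩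
    have hs : ∀ p : Fin r, simpleRefl (r + 1) k p.castSucc = (simpleRefl r k p).castSucc := by
      intro p
      refine Fin.ext ?_
      rw [simpleRefl_val hk2, Fin.val_castSucc, Fin.val_castSucc, simpleRefl_val hk']
    have hw : ∀ p : Fin r, (w' * simpleRefl (r + 1) k) p.castSucc = (w p).castSucc := by
      intro p
      rw [Equiv.Perm.mul_apply, hs, h2, Equiv.Perm.mul_apply, simpleRefl_apply_self]
    refine ⟨w' * simpleRefl (r + 1) k, ?_, hw, ?_⟩
    · have hd' : IsDescent (w' * simpleRefl (r + 1) k) k := by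
        refine ⟨hk2, ?_⟩
        have e1 := hw ⟨k, hk'.2⟩
        have e2 := hw ⟨k - 1, by omega⟩
        simp only [Fin.castSucc_mk] at e1 e2
        rw [e1, e2]
        exact hk.elim fun _ h => h
      rw [T_of_isDescent q u hk, T_of_isDescent q u hd', map_mul, incl_gen q u r hk'.2, h1,
        mul_assoc w', simpleRefl_mul_self, mul_one]
    · rw [Equiv.Perm.mul_apply, simpleRefl_apply_of_ne, h3] <;> rw [Fin.val_last] <;> omega

/-- The segment moves the preimage of the last letter to r - n and shifts the letters behind it by
one. Every step adds to the length, because the value moved is the largest. -/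
theorem exists_seg_mul_T {w : Equiv.Perm (Fin (r + 1))} (hw : w (Fin.last r) = Fin.last r)
    {n : ℕ} (h : n ≤ r) : ∃ w' : Equiv.Perm (Fin (r + 1)), seg q u r n * T q u w = T q u w' ∧
      (∀ p : Fin (r + 1), p.val < r - n → w' p = w p) ∧
      (∀ p : Fin (r + 1), p.val = r - n → w' p = Fin.last r) ∧
      (∀ p p' : Fin (r + 1), r - n ≤ p.val → p'.val = p.val + 1 → w' p' = w p) := by
  induction n with
  | zero =>
    refine ⟨w, by rw [seg, one_mul], fun _ _ => rfl, fun p hp => ?_, fun p p' h1 h2 => ?_⟩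
    · rw [← hw]; congr 1; exact Fin.ext hp
    · omega
  | succ n ih =>
    obtain ⟨w', e, h1, h2, h3⟩ := ih (by omega)
    have hk : 1 ≤ r - n ∧ r - n < r + 1 := ⟨by omega, by omega⟩
    have hlast := h2 ⟨r - n, by omega⟩ rfl
    refine ⟨w' * simpleRefl (r + 1) (r - n), ?_, fun p hp => ?_, fun p hp => ?_,
      fun p p' hp hp' => ?_⟩
    · rw [seg, mul_assoc, e, gen_mul_T_of_not_isDescent q u hk.1 hk.2]
      rintro ⟨_, hd⟩
      rw [hlast] at hd
      exact absurd hd (not_lt.mpr (Fin.le_last _))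
    · rw [Equiv.Perm.mul_apply, simpleRefl_apply_of_ne (by omega) (by omega), h1 p (by omega)]
    · rw [Equiv.Perm.mul_apply]
      refine h2 _ ?_
      rw [simpleRefl_val hk, if_pos (by omega)]
    · rw [Equiv.Perm.mul_apply]
      by_cases hp2 : p.val = r - (n + 1)
      · rw [← h1 p (by omega)]
        congr 1
        refine Fin.ext ?_
        rw [simpleRefl_val hk, if_neg (by omega), if_pos (by omega)]
        omega
      · rw [simpleRefl_apply_of_ne (by omega) (by omega)]
        exact h3 p p' (by omega) hp'

end LastLetter

/-! ### Moving T_1⁻¹⋯T_k⁻¹ through products L_1⋯L_n -/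

section Lambda

variable {R : Type*} [CommRing R] {m : ℕ} (q : Rˣ) (u : Fin m → R) (r : ℕ)

/-- The polynomial whose value at `L_1, L_2, …` is `L_1 ⋯ L_n`. -/
noncomputable def lam (R : Type*) [CommRing R] (n : ℕ) : MvPolynomial ℕ R :=
  ∏ j ∈ Finset.range n, MvPolynomial.X j

/-- The polynomial whose value at `L_1, L_2, …` is `L_2 ⋯ L_{n+1}`. -/
noncomputable def lamShift (R : Type*) [CommRing R] (n : ℕ) : MvPolynomial ℕ R :=
  ∏ j ∈ Finset.range n, MvPolynomial.X (j + 1)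

theorem lam_succ (n : ℕ) : lam R (n + 1) = MvPolynomial.X 0 * lamShift R n := by
  rw [lam, Finset.prod_range_succ', mul_comm]; rfl

theorem stairPoly_zero (J : Finset (Fin m)) (n : Fin m → ℕ) :
    stairPoly (0 : Fin m → R) J n = ∏ i ∈ J, lam R (n i) := by
  simp [stairPoly, lam]

theorem gen_commute_lam {i n : ℕ} (h1 : 1 ≤ i) (h2 : i ≠ n) :
    Commute (gen q u r i) (jmPoly q u r (lam R n)) := by
  have := gen_commute_piOne q u r h1 h2 0
  rw [piOne_eq] at this
  simpa [lam] using this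

theorem jm_mem_fil_prod (f : ℕ → ℕ) (n : ℕ) :
    jmPoly q u r (∏ j ∈ Finset.range n, MvPolynomial.X (f j)) ∈ fil q u r (n + 1) := by
  have := jmPoly_prod_mem_fil (q := q) (u := u) (r := r) (Finset.range n)
    (fun j => MvPolynomial.X (f j)) (fun _ => 1) fun j _ => by
      rw [jmPoly_X]; exact jm_mem_fil _
  simpa using this

/-- By `genInv_mul_jm` an inverse raises the index of a Jucys-Murphy element, up to an error. The
error contains a whole product L_1⋯L_{n+1}, which passes the remaining inverses and begins with L_1
= T_0. -/
theorem ascGenInv_mul_lam_self {n : ℕ} (h : n = 0 ∨ n < r) : ∃ f ∈ fil q u r n,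
    ascGenInv q u r n * jmPoly q u r (lam R n) =
      jmPoly q u r (lamShift R n) * ascGenInv q u r n + gen q u r 0 * f := by
  induction n with
  | zero => exact ⟨0, zero_mem _, by simp [ascGenInv, lam, lamShift]⟩
  | succ n ih =>
    obtain ⟨f, hf, e⟩ := ih (by omega)
    have hc : Commute (genInv q u r (n + 1)) (jmPoly q u r (lam R n)) :=
      commute_genInv q u r (gen_commute_lam q u r (by omega) (by omega))
    have hc2 : Commute (ascGenInv q u r n) (jm q u r (n + 2)) :=
      commute_ascGenInv q u r fun i h1 h2 => gen_commute_jm_of_gt q u r (by omega)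
    have hc3 : Commute (ascGenInv q u r n) (jmPoly q u r (lam R (n + 1))) :=
      commute_ascGenInv q u r fun i h1 h2 => gen_commute_lam q u r (by omega) (by omega)
    have e1 : lam R (n + 1) = lam R n * MvPolynomial.X n := Finset.prod_range_succ _ _
    have e2 : lamShift R (n + 1) = lamShift R n * MvPolynomial.X (n + 1) :=
      Finset.prod_range_succ _ _
    refine ⟨f * (jm q u r (n + 2) * genInv q u r (n + 1)) +
      (((q⁻¹ : Rˣ) : R) - 1) • (jmPoly q u r (lamShift R n) * ascGenInv q u r n), ?_, ?_⟩
    · refine Submodule.add_mem _ (mul_mem_fil' hf (mul_mem_fil_of_one' (jm_mem_fil _)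
        (genInv_mem_fil (by omega)))) (Submodule.smul_mem _ _ (mul_mem_fil_of_one'
          (jm_mem_fil_prod q u r _ n) (ascGenInv_mem_fil q u r n)))
    · have e3 : ascGenInv q u r (n + 1) * jmPoly q u r (lam R (n + 1)) =
          (ascGenInv q u r n * jmPoly q u r (lam R n)) *
            (jm q u r (n + 2) * genInv q u r (n + 1)) +
          (((q⁻¹ : Rˣ) : R) - 1) • (ascGenInv q u r n * jmPoly q u r (lam R (n + 1))) := by
        rw [ascGenInv, e1, map_mul, jmPoly_X, mul_assoc, ← mul_assoc (genInv q u r (n + 1)), hc.eq,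
          mul_assoc (jmPoly q u r (lam R n)), genInv_mul_jm q u r (by omega) (by omega), mul_add,
          mul_add, mul_smul_comm, mul_smul_comm, ← mul_assoc (ascGenInv q u r n)]
      rw [e3, e, add_mul, hc3.eq, lam_succ, map_mul, jmPoly_X, zero_add, jm_one, e2, map_mul,
        jmPoly_X, ascGenInv, mul_add, mul_smul_comm, mul_assoc (jmPoly q u r (lamShift R n)),
        ← mul_assoc (ascGenInv q u r n), hc2.eq]
      simp only [mul_assoc, add_assoc]

theorem ascGenInv_mul_lam {n k : ℕ} (h : n ≤ k) (hk : k < r) : ∃ f ∈ fil q u r n,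
    ascGenInv q u r k * jmPoly q u r (lam R n) =
      jmPoly q u r (lamShift R n) * ascGenInv q u r k + gen q u r 0 * f := by
  induction k, h using Nat.le_induction with
  | base => exact ascGenInv_mul_lam_self q u r (Or.inr hk)
  | succ k h ih =>
    obtain ⟨f, hf, e⟩ := ih (by omega)
    refine ⟨f * genInv q u r (k + 1), mul_mem_fil_of_one' hf (genInv_mem_fil (by omega)), ?_⟩
    have hc : Commute (genInv q u r (k + 1)) (jmPoly q u r (lam R n)) :=
      commute_genInv q u r (gen_commute_lam q u r (by omega) (by omega))
    rw [ascGenInv, mul_assoc, hc.eq, ← mul_assoc, e, add_mul, mul_assoc, mul_assoc]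

/-- Each T_0 in front completes one shifted product L_2⋯L_{n+1} to L_1⋯L_{n+1}. The errors carry one
more T_0 on the left, which the cyclotomic relation later makes negligible. -/
theorem pow_mul_ascGenInv_mul_prod_lam {ι : Type*} (s : Finset ι) (n : ι → ℕ) {k : ℕ}
    (hn : ∀ i ∈ s, n i ≤ k) (hk : k < r) : ∃ f ∈ fil q u r (∑ i ∈ s, n i),
    gen q u r 0 ^ s.card * ascGenInv q u r k * jmPoly q u r (∏ i ∈ s, lam R (n i)) =
      jmPoly q u r (∏ i ∈ s, lam R (n i + 1)) * ascGenInv q u r k +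
        gen q u r 0 ^ (s.card + 1) * f := by
  classical
  induction s using Finset.induction_on with
  | empty => exact ⟨0, zero_mem _, by simp⟩
  | insert i s hi ih =>
    obtain ⟨g, hg, e⟩ := ih fun j hj => hn j (Finset.mem_insert_of_mem hj)
    obtain ⟨f, hf, e'⟩ := ascGenInv_mul_lam q u r (hn i (Finset.mem_insert_self i s)) hk
    have hX : ∀ p, gen q u r 0 * jmPoly q u r p = jmPoly q u r p * gen q u r 0 := fun p => by
      have := (jmPoly_commute q u r (MvPolynomial.X 0) p).eq
      rwa [jmPoly_X, zero_add, jm_one] at this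
    have hXn : ∀ N p, gen q u r 0 ^ N * jmPoly q u r p = jmPoly q u r p * gen q u r 0 ^ N :=
      fun N p => (Commute.pow_left (hX p) N).eq
    have hprod := jmPoly_prod_mem_fil (q := q) (u := u) (r := r) s (fun i => lam R (n i)) n
      fun i _ => jm_mem_fil_prod q u r _ (n i)
    refine ⟨jmPoly q u r (lamShift R (n i)) * g + f * jmPoly q u r (∏ i ∈ s, lam R (n i)),
      ?_, ?_⟩
    · rw [Finset.sum_insert hi]
      exact Submodule.add_mem _ (mul_mem_fil (jm_mem_fil_prod q u r _ (n i)) hg)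
        (mul_mem_fil' hf hprod)
    · rw [Finset.card_insert_of_notMem hi, Finset.prod_insert hi, Finset.prod_insert hi, map_mul,
        mul_assoc, ← mul_assoc (ascGenInv q u r k), e', add_mul, lam_succ, map_mul, map_mul,
        jmPoly_X, zero_add, jm_one, hX, mul_add, mul_add]
      have h1 : gen q u r 0 ^ (s.card + 1) * (jmPoly q u r (lamShift R (n i)) *
          ascGenInv q u r k * jmPoly q u r (∏ i ∈ s, lam R (n i))) =
          jmPoly q u r (lamShift R (n i)) * (gen q u r 0 * (gen q u r 0 ^ s.card *
            ascGenInv q u r k * jmPoly q u r (∏ i ∈ s, lam R (n i)))) := by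
        rw [mul_assoc (jmPoly q u r (lamShift R (n i))), ← mul_assoc, hXn, pow_succ']
        simp only [mul_assoc]
      have h2 : gen q u r 0 ^ (s.card + 1) * (gen q u r 0 * f *
          jmPoly q u r (∏ i ∈ s, lam R (n i))) = gen q u r 0 ^ (s.card + 1 + 1) *
            (f * jmPoly q u r (∏ i ∈ s, lam R (n i))) := by
        rw [pow_succ _ (s.card + 1)]
        simp only [mul_assoc]
      have h3 : gen q u r 0 ^ (s.card + 1 + 1) * (jmPoly q u r (lamShift R (n i)) * g) =
          jmPoly q u r (lamShift R (n i)) * (gen q u r 0 * (gen q u r 0 ^ (s.card + 1) * g)) := by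
        rw [← mul_assoc, hXn, pow_succ']
        simp only [mul_assoc]
      rw [h1, h2, h3, e, mul_add, mul_add]
      simp only [mul_assoc, add_assoc]

end Lambda
end ArikiKoike

namespace ArikiKoike

/-- The sequence with the entries `a_i - 1` (and `0` if `a_i = 0`). -/
def Lam.pred {m r : ℕ} (a : Lam m (r + 1)) : Lam m r where
  seq i := a.seq i - 1
  zero := by rw [a.zero]
  mono i j h := Nat.sub_le_sub_right (a.mono h) 1
  top i h := by rw [a.top i h, Nat.add_sub_cancel]

/-! ### Functionals on the top degree -/

section Functional

variable {R : Type*} [CommRing R] {m : ℕ} {q : Rˣ} {u : Fin m → R} {r : ℕ}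

/-- A linear map which commutes with the left multiplications by `T_1, …, T_{r-1}` and which
vanishes on the elements of degree less than `r (m - 1)`. -/
structure IsTopFunctional (φ : AK m r q u →ₗ[R] AK m r q u) : Prop where
  gen_mul : ∀ i, 1 ≤ i → i < r → ∀ h, φ (gen q u r i * h) = gen q u r i * φ h
  eq_zero : ∀ h ∈ fil q u r (r * (m - 1)), φ h = 0

namespace IsTopFunctional

variable {φ : AK m r q u →ₗ[R] AK m r q u}

theorem eq_of_sub_mem (hφ : IsTopFunctional φ) {x y : AK m r q u} (h : x - y ∈ fil q u r (r * (m - 1))) : φ x = φ y := by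
  have := hφ.eq_zero _ h
  rwa [map_sub, sub_eq_zero] at this

theorem ascGenInv_mul (hφ : IsTopFunctional φ) {n : ℕ} (h : n = 0 ∨ n < r) (x : AK m r q u) :
    φ (ascGenInv q u r n * x) = ascGenInv q u r n * φ x := by
  induction n generalizing x with
  | zero => rw [ascGenInv, one_mul, one_mul]
  | succ n ih =>
    rw [ascGenInv, mul_assoc, ih (by omega), genInv_mul, map_add, map_smul, map_smul,
      hφ.gen_mul _ (by omega) (by omega), ← genInv_mul, mul_assoc]

theorem young_mul (hφ : IsTopFunctional φ) {a : Lam m r} {y : AK m r q u} (hy : y ∈ young q u a) (x : AK m r q u) :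
    φ (y * x) = y * φ x := by
  induction hy using Algebra.adjoin_induction generalizing x with
  | mem y hy =>
    obtain ⟨k, h1, h2, -, rfl⟩ := hy
    exact hφ.gen_mul k h1 h2 x
  | algebraMap c => rw [← Algebra.smul_def, ← Algebra.smul_def, map_smul]
  | add y y' _ _ h h' => rw [add_mul, map_add, h, h', add_mul]
  | mul y y' _ _ h h' => rw [mul_assoc, h, h', mul_assoc]

end IsTopFunctional

/-- If the last letter is the image of p ≥ 1, then T_w is T_{p+1}⋯T_r (zero-based p) times an
element of H_m^r. These generators commute with T_0 and come out of ψ; what is left lies in H_m^r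
and is killed. -/
theorem apply_pow_mul_mul_incl {ψ : AK m (r + 1) q u →ₗ[R] AK m (r + 1) q u}
    (hψ : IsTopFunctional ψ) (h0 : ∀ h, ψ (incl q u r h) = 0) (n : ℕ) {x : AK m (r + 1) q u}
    (hx : x ∈ lastSpan q u r 1) (h : AK m r q u) :
    ψ (gen q u (r + 1) 0 ^ n * x * incl q u r h) = 0 := by
  induction hx using Submodule.span_induction with
  | mem x hx =>
    obtain ⟨w, p, h1, h2, rfl⟩ := hx
    obtain ⟨d, hd⟩ : ∃ d, p.val + d = r := ⟨r - p.val, by omega⟩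
    induction d generalizing w p with
    | zero =>
      have hr : 0 < r := by omega
      have hw : w (Fin.last r) = Fin.last r := by
        rw [← h1]; congr 1; exact Fin.ext (by rw [h1]; exact hd.symm)
      have hT : ∃ t, T q u w = incl q u r t := by
        clear h1 h2 hd
        induction w using descent_induction with
        | h1 => exact ⟨1, by rw [T_one, map_one]⟩
        | h w k hk ih =>
          have hkr : k ≠ r := by
            rintro rfl
            obtain ⟨hk, hd⟩ := hk
            have : (⟨k, hk.2⟩ : Fin (k + 1)) = Fin.last k := rfl
            rw [this, hw] at hd
            exact absurd hd (not_lt.mpr (Fin.le_last _))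
          have hk1 := hk.1
          obtain ⟨t, ht⟩ := ih (by
            rw [Equiv.Perm.mul_apply, simpleRefl_apply_of_ne, hw] <;> rw [Fin.val_last] <;> omega)
          exact ⟨gen q u r k * t, by
            rw [T_of_isDescent q u hk, ht, map_mul, incl_gen q u r (by omega)]⟩
      obtain ⟨t, ht⟩ := hT
      rw [ht, ← incl_gen q u r hr, ← map_pow, ← map_mul, ← map_mul, h0]
    | succ d ih =>
      have hk : 1 ≤ p.val + 1 ∧ p.val + 1 < r + 1 := ⟨by omega, by omega⟩
      have hdes : IsDescent w (p.val + 1) := by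
        refine ⟨hk, ?_⟩
        have : (⟨p.val + 1 - 1, by omega⟩ : Fin (r + 1)) = p := Fin.ext (Nat.add_sub_cancel _ _)
        rw [this, h1]
        refine lt_of_le_of_ne (Fin.le_last _) fun he => ?_
        rw [← h1] at he
        have := congrArg Fin.val (w.injective he)
        simp at this
      have hc : Commute (gen q u (r + 1) 0 ^ n) (gen q u (r + 1) (p.val + 1)) :=
        (gen_comm q u (r + 1) (by omega)).pow_left n
      rw [T_of_isDescent q u hdes, ← mul_assoc, hc.eq, mul_assoc, mul_assoc,
        hψ.gen_mul _ hk.1 hk.2, ← mul_assoc (gen q u (r + 1) 0 ^ n),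
        ih _ ⟨p.val + 1, hk.2⟩ ?_ ?_ ?_, mul_zero]
      · rw [Equiv.Perm.mul_apply, simpleRefl_apply_right hk, ← h1]
        rfl
      · exact hk.1
      · simp only; omega
  | zero => rw [mul_zero, zero_mul, map_zero]
  | add x y _ _ hx hy => rw [mul_add, add_mul, map_add, hx, hy, add_zero]
  | smul c x _ hx => rw [mul_smul_comm, smul_mul_assoc, map_smul, hx, smul_zero]

end Functional

/-! ### Leading terms of the v_a -/

section Unit

variable {R : Type*} [CommRing R] {m : ℕ} {q : Rˣ} {u : Fin (m + 1) → R} {r : ℕ}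

theorem prod_lam_seq (a : Lam (m + 1) r) :
    stairPoly (0 : Fin (m + 1) → R) Finset.univ (fun i => a.seq i) =
      ∏ i : Fin m, lam R (a.seq (i + 1)) := by
  rw [stairPoly_zero, Fin.prod_univ_succ]
  simp [a.zero, lam]

theorem prod_lam_seq_dual (a : Lam (m + 1) r) :
    stairPoly (0 : Fin (m + 1) → R) Finset.univ (fun i => r - a.seq (i + 1)) =
      ∏ i : Fin m, lam R (r - a.seq (i + 1)) := by
  rw [stairPoly_zero, Fin.prod_univ_castSucc]
  simp [a.top, lam]

variable (q u) in
/-- The leading term of `v_a`, with `T_w` in place of `T_{w_a}`. -/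
noncomputable def lead (a : Lam (m + 1) r) (w : Equiv.Perm (Fin r)) : AK (m + 1) r q u :=
  jmPoly q u r (∏ i : Fin m, lam R (a.seq (i + 1))) * T q u w *
    jmPoly q u r (∏ i : Fin m, lam R (r - a.seq (i + 1)))

theorem stair_sub_lead_mem (a : Lam (m + 1) r) (w : Equiv.Perm (Fin r)) :
    jmPoly q u r (stairPoly u Finset.univ fun i => a.seq i) * T q u w *
      jmPoly q u r (stairPoly u Finset.univ fun i => r - a.seq (i + 1)) - lead q u a w ∈
        fil q u r (r * m) := by
  have hsum : ∑ i : Fin (m + 1), a.seq i + ∑ i : Fin (m + 1), (r - a.seq (i + 1)) = r * m := by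
    rw [Fin.sum_univ_succ, Fin.sum_univ_castSucc]
    simp only [Fin.val_zero, a.zero, zero_add, Fin.val_last, a.top (m + 1) le_rfl, Nat.sub_self,
      add_zero, Fin.val_succ, Fin.val_castSucc]
    rw [← Finset.sum_add_distrib, Finset.sum_congr rfl fun i _ =>
      Nat.add_sub_cancel' (a.le_top (i.val + 1))]
    simp [mul_comm]
  rw [lead, ← prod_lam_seq, ← prod_lam_seq_dual]
  have h1 := stairPoly_sub_mem_fil (q := q) (u := u) (r := r) u 0 Finset.univ fun i => a.seq i
  have h2 := stairPoly_sub_mem_fil (q := q) (u := u) (r := r) u 0 Finset.univ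
    fun i => r - a.seq (i + 1)
  have h3 := stairPoly_mem_fil (q := q) (u := u) (r := r) u Finset.univ fun i => r - a.seq (i + 1)
  have h4 := stairPoly_mem_fil (q := q) (u := u) (r := r) 0 Finset.univ fun i => a.seq i
  rw [map_sub] at h1 h2
  have h5 := Submodule.add_mem _ (mul_mem_fil' (mul_mem_fil_of_one' h1 (T_mem_fil w)) h3)
    (mul_mem_fil (mul_mem_fil_of_one' h4 (T_mem_fil w)) h2)
  rw [hsum] at h5
  convert h5 using 1
  rw [sub_mul, sub_mul, mul_sub, sub_add_sub_cancel]

theorem commute_T_of_gen {x : AK (m + 1) r q u}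
    (h : ∀ k, 1 ≤ k → k < r → Commute (gen q u r k) x) (w : Equiv.Perm (Fin r)) :
    Commute (T q u w) x := by
  induction w using descent_induction with
  | h1 => rw [T_one]; exact Commute.one_left _
  | h w k hk ih => rw [T_of_isDescent q u hk]; exact (h k hk.1.1 hk.1.2).mul_left ih

/-- Products L_1⋯L_N that commute with t may stand on either side of it. This treats the zero
entries of a: their left exponent 0 must not grow with r while their right exponent r must, so the
factor is moved to the left, raised, and moved back. -/
theorem jmPoly_prod_mul_mul (c : Fin m → ℕ) (N : ℕ) {t : AK (m + 1) r q u}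
    (ht : Commute t (jmPoly q u r (lam R N))) (f g : Fin m → ℕ)
    (hf : ∀ i, c i = 0 → f i = 0) (hg : ∀ i, c i = 0 → g i = N) :
    jmPoly q u r (∏ i, lam R (if c i = 0 then N else f i)) * t *
      jmPoly q u r (∏ i, lam R (if c i = 0 then 0 else g i)) =
    jmPoly q u r (∏ i, lam R (f i)) * t * jmPoly q u r (∏ i, lam R (g i)) := by
  let Z : MvPolynomial ℕ R := ∏ i, if c i = 0 then lam R N else 1
  have hl0 : lam R 0 = 1 := Finset.prod_range_zero _
  have h1 : ∏ i, lam R (if c i = 0 then N else f i) = (∏ i, lam R (f i)) * Z := by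
    rw [← Finset.prod_mul_distrib]
    refine Finset.prod_congr rfl fun i _ => ?_
    split_ifs with h
    · rw [hf i h, hl0, one_mul]
    · rw [mul_one]
  have h2 : ∏ i, lam R (g i) = Z * ∏ i, lam R (if c i = 0 then 0 else g i) := by
    rw [← Finset.prod_mul_distrib]
    refine Finset.prod_congr rfl fun i _ => ?_
    split_ifs with h
    · rw [hg i h, hl0, mul_one]
    · rw [one_mul]
  have hZ : Commute t (jmPoly q u r Z) := by
    have hZ' : ∀ s : Finset (Fin m),
        Commute t (jmPoly q u r (∏ i ∈ s, if c i = 0 then lam R N else 1)) := by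
      intro s
      induction s using Finset.induction_on with
      | empty => rw [Finset.prod_empty, map_one]; exact Commute.one_right _
      | insert i s hi ih =>
        rw [Finset.prod_insert hi, map_mul]
        refine Commute.mul_right ?_ ih
        split_ifs
        · exact ht
        · rw [map_one]; exact Commute.one_right _
    exact hZ' _
  rw [h1, h2, map_mul, map_mul, mul_assoc _ _ t, ← hZ.eq]
  simp only [mul_assoc]

theorem gen_zero_pow_mem_fil_succ (n : ℕ) : gen q u r 0 ^ n ∈ fil q u r (n + 1) := by
  have := gen_zero_pow_mul_mem_fil (n := n) (one_mem_fil (q := q) (u := u) (r := r) 0)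
  rwa [mul_one] at this

end Unit
end ArikiKoike

namespace ArikiKoike

/-! ### Units at the v_a: the inductive step -/

section UnitStep

variable {R : Type*} [CommRing R] {m : ℕ} {q : Rˣ} {u : Fin (m + 1) → R} {r : ℕ}

theorem not_reverses_of_last {a : Lam (m + 1) (r + 1)} {i : ℕ} (hi : a.seq i ≠ 0)
    {w : Equiv.Perm (Fin (r + 1))} {p : Fin (r + 1)} (h1 : w p = Fin.last r)
    (h2 : a.seq i ≤ p.val) : ¬ a.Reverses w := by
  intro h
  have := h.lt h2
  rw [h1, Fin.val_last] at this
  omega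

/-- For a_i ≠ 0 the new letter A - 1 is among the first a_i letters and goes to the last letter; the
other a_i - 1 are handled by the reversing property of the smaller permutation. -/
theorem pred_reverses_step (a : Lam (m + 1) (r + 1)) {A : ℕ} (hA : 1 ≤ A)
    (hmin : ∀ i, a.seq i ≠ 0 → A ≤ a.seq i)
    {w w' : Equiv.Perm (Fin (r + 1))}
    (hw : ∀ p : Fin r, w p.castSucc = (a.pred.perm p).castSucc)
    (h1 : ∀ p : Fin (r + 1), p.val < A - 1 → w' p = w p)
    (h2 : ∀ p : Fin (r + 1), p.val = A - 1 → w' p = Fin.last r)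
    (h3 : ∀ p p' : Fin (r + 1), A - 1 ≤ p.val → p'.val = p.val + 1 → w' p' = w p) :
    a.Reverses w' := by
  intro i p hp
  have hAi := hmin i (by omega)
  have hle := a.le_top i
  have key : ∀ p : Fin (r + 1), p.val + 1 < a.seq i → r + 1 - a.seq i ≤ (w p).val := by
    intro p hp
    have := a.pred.reverses_perm i ⟨p.val, by omega⟩ (show p.val < a.seq i - 1 by omega)
    have e := hw ⟨p.val, by omega⟩
    have e' : (⟨p.val, by omega⟩ : Fin r).castSucc = p := rfl
    rw [e'] at e
    rw [e, Fin.val_castSucc]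
    have e2 : a.pred.seq i = a.seq i - 1 := rfl
    omega
  rcases Nat.lt_trichotomy p.val (A - 1) with h | h | h
  · rw [h1 p h]
    exact key p (by omega)
  · rw [h2 p h, Fin.val_last]
    omega
  · rw [h3 ⟨p.val - 1, by omega⟩ p (show A - 1 ≤ p.val - 1 by omega)
      (show p.val = p.val - 1 + 1 by omega)]
    exact key _ (show p.val - 1 + 1 < a.seq i by omega)

theorem gen_commute_prod_lam {ι : Type*} (s : Finset ι) (n : ι → ℕ) {k : ℕ} (h1 : 1 ≤ k)
    (h : ∀ i ∈ s, k ≠ n i) : Commute (gen q u r k) (jmPoly q u r (∏ i ∈ s, lam R (n i))) := by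
  classical
  induction s using Finset.induction_on with
  | empty => rw [Finset.prod_empty, map_one]; exact Commute.one_right _
  | insert i s hi ih =>
    rw [Finset.prod_insert hi, map_mul]
    exact (gen_commute_lam q u r h1 (h i (Finset.mem_insert_self i s))).mul_right
      (ih fun j hj => h j (Finset.mem_insert_of_mem hj))

theorem isUnit_of_isUnit_mul_left {A : Type*} [Monoid A] {x y : A} (hx : IsUnit x)
    (h : IsUnit (x * y)) : IsUnit y := by
  obtain ⟨x, rfl⟩ := hx
  exact (Units.isUnit_units_mul x y).mp h

theorem isUnit_pow_smul_iff {A : Type*} [Ring A] [Algebra R A] (q : Rˣ) (n : ℕ) (x : A) :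
    IsUnit (((q⁻¹ : Rˣ) : R) ^ n • x) ↔ IsUnit x := by
  have h : IsUnit (algebraMap R A (((q⁻¹ : Rˣ) : R) ^ n)) :=
    ((Units.isUnit q⁻¹).pow n).map (algebraMap R A)
  rw [Algebra.smul_def]
  exact ⟨isUnit_of_isUnit_mul_left h, h.mul⟩

variable {φ : AK (m + 1) r q u →ₗ[R] AK (m + 1) r q u}
  {ψ : AK (m + 1) (r + 1) q u →ₗ[R] AK (m + 1) (r + 1) q u}

/-- T_1⁻¹⋯T_r⁻¹ and q^{-r} T_1⋯T_r differ by T_w's whose last letter is not the image of the first,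
and these do not contribute. -/
theorem apply_pow_mul_ascGenInv_mul (hψ : IsTopFunctional ψ) (h0 : ∀ h, ψ (incl q u r h) = 0)
    (h1 : ∀ h, ψ (gen q u (r + 1) 0 ^ m * asc q u (r + 1) r * incl q u r h) =
      asc q u (r + 1) r * incl q u r (φ h)) (h : AK (m + 1) r q u) :
    ψ (gen q u (r + 1) 0 ^ m * ascGenInv q u (r + 1) r * incl q u r h) =
      ((q⁻¹ : Rˣ) : R) ^ r • (asc q u (r + 1) r * incl q u r (φ h)) := by
  have e1 := ascGenInv_mul_segInv q u r le_rfl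
  have e2 := asc_mul_seg q u r le_rfl
  rw [Nat.sub_self, ascGenInv, one_mul] at e1
  rw [Nat.sub_self, asc, one_mul] at e2
  have h2 := segInv_sub_mem_lastSpan (q := q) (u := u) (r := r) le_rfl
  rw [Nat.add_sub_cancel_left, e1, e2] at h2
  have h3 := apply_pow_mul_mul_incl hψ h0 m h2 h
  rw [mul_sub, sub_mul, map_sub, sub_eq_zero, mul_smul_comm, smul_mul_assoc, map_smul, h1] at h3
  exact h3

/-- The weight of the summand of index `i` on the left. -/
def leftWeight (a : Lam (m + 1) (r + 1)) (i : Fin m) : ℕ :=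
  if a.seq (i + 1) = 0 then r else a.seq (i + 1) - 1

/-- The weight of the summand of index `i` on the right. -/
def rightWeight (a : Lam (m + 1) (r + 1)) (i : Fin m) : ℕ :=
  if a.seq (i + 1) = 0 then 0 else r + 1 - a.seq (i + 1)

theorem incl_lead_pred (a : Lam (m + 1) (r + 1)) {w : Equiv.Perm (Fin r)}
    {w' : Equiv.Perm (Fin (r + 1))} (hw : incl q u r (T q u w) = T q u w') :
    incl q u r (lead q u a.pred w) = jmPoly q u (r + 1) (∏ i, lam R (leftWeight a i)) *
      T q u w' * jmPoly q u (r + 1) (∏ i, lam R (rightWeight a i)) := by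
  have hc : Commute (T q u w') (jmPoly q u (r + 1) (lam R r)) := by
    rw [← hw]
    clear hw
    induction w using descent_induction with
    | h1 => rw [T_one, map_one]; exact Commute.one_left _
    | h w k hk ih =>
      rw [T_of_isDescent q u hk, map_mul, incl_gen q u r hk.1.2]
      have := hk.1
      exact (gen_commute_lam q u (r + 1) (by omega) (by omega)).mul_left ih
  have e := jmPoly_prod_mul_mul (fun i => a.seq (i + 1)) r hc (fun i => a.pred.seq (i + 1))
    (fun i => r - a.pred.seq (i + 1))
    (fun i h => by show a.seq (i + 1) - 1 = 0; rw [h])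
    (fun i h => by show r - (a.seq (i + 1) - 1) = r; rw [h]; rfl)
  have e1 : ∀ i, rightWeight a i =
      if a.seq (i + 1) = 0 then 0 else r - a.pred.seq (i + 1) := by
    intro i
    show _ = if a.seq (i + 1) = 0 then 0 else r - (a.seq (i + 1) - 1)
    rw [rightWeight]
    split_ifs <;> omega
  simp only [e1]
  refine Eq.trans ?_ e.symm
  rw [lead, map_mul, map_mul, hw, ← prod_lam_seq, ← prod_lam_seq_dual,
    incl_jmPoly_stairPoly q u r _ fun i _ => a.pred.le_top i,
    incl_jmPoly_stairPoly q u r _ fun i _ => Nat.sub_le _ _]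

theorem lead_eq (a : Lam (m + 1) (r + 1)) (w : Equiv.Perm (Fin (r + 1))) :
    jmPoly q u (r + 1) (∏ i, lam R (leftWeight a i + 1)) * T q u w *
      jmPoly q u (r + 1) (∏ i, lam R (rightWeight a i)) = lead q u a w := by
  have hc : Commute (T q u w) (jmPoly q u (r + 1) (lam R (r + 1))) :=
    commute_T_of_gen (fun k h1 h2 => gen_commute_lam q u (r + 1) h1 (by omega)) w
  have e := jmPoly_prod_mul_mul (fun i => a.seq (i + 1)) (r + 1) hc (fun i => a.seq (i + 1))
    (fun i => r + 1 - a.seq (i + 1)) (fun i h => h) (fun i h => by rw [h]; rfl)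
  have e1 : ∀ i, leftWeight a i + 1 = if a.seq (i + 1) = 0 then r + 1 else a.seq (i + 1) := by
    intro i
    rw [leftWeight]
    split_ifs <;> omega
  simp only [e1]
  exact e

theorem sum_weights (a : Lam (m + 1) (r + 1)) :
    m + ∑ i, leftWeight a i + ∑ i, rightWeight a i = (r + 1) * m := by
  have : ∀ i, 1 + leftWeight a i + rightWeight a i = r + 1 := by
    intro i
    have := a.le_top (i + 1)
    rw [leftWeight, rightWeight]
    split_ifs <;> omega
  have h := Finset.sum_congr (rfl : (Finset.univ : Finset (Fin m)) = _) fun i _ => this i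
  rw [Finset.sum_add_distrib, Finset.sum_add_distrib] at h
  simpa [mul_comm] using h

theorem IsTopFunctional.apply_lead (hψ : IsTopFunctional ψ) (a : Lam (m + 1) (r + 1))
    (w : Equiv.Perm (Fin (r + 1))) : ψ (lead q u a w) =
      ψ (jmPoly q u (r + 1) (stairPoly u Finset.univ fun i => a.seq i) * T q u w *
        jmPoly q u (r + 1) (stairPoly u Finset.univ fun i => r + 1 - a.seq (i + 1))) :=
  (hψ.eq_of_sub_mem (stair_sub_lead_mem a w)).symm

/-- ψ sees only top degree, so the leading monomials may be replaced by the full staircases; for a w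
not reversing a their product vanishes. -/
theorem apply_lastSpan (hψ : IsTopFunctional ψ) (a : Lam (m + 1) (r + 1)) {i : ℕ}
    (hi : a.seq i ≠ 0) {x : AK (m + 1) (r + 1) q u} (hx : x ∈ lastSpan q u r (a.seq i)) :
    ψ (jmPoly q u (r + 1) (∏ i, lam R (leftWeight a i + 1)) * x *
      jmPoly q u (r + 1) (∏ i, lam R (rightWeight a i))) = 0 := by
  induction hx using Submodule.span_induction with
  | mem x hx =>
    obtain ⟨w, p, h1, h2, rfl⟩ := hx
    rw [lead_eq, hψ.apply_lead,
      stair_mul_T_mul_stair_of_not_reverses q u (not_reverses_of_last hi h1 h2), map_zero]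
  | zero => rw [mul_zero, zero_mul, map_zero]
  | add x y _ _ hx hy => rw [mul_add, add_mul, map_add, hx, hy, add_zero]
  | smul c x _ hx => rw [mul_smul_comm, smul_mul_assoc, map_smul, hx, smul_zero]

/-- The value of ψ at T_0^m T_1⁻¹⋯T_r⁻¹ v, with v the image of the v-element of the lowered
sequence, is computed twice. Directly it is a unit by induction; after moving T_0^m T_1⁻¹⋯T_r⁻¹
through the leading term it is a unit times ψ(v_a). -/
theorem isUnit_apply_vElt (hψ : IsTopFunctional ψ) (h0 : ∀ h, ψ (incl q u r h) = 0)
    (h1 : ∀ h, ψ (gen q u (r + 1) 0 ^ m * asc q u (r + 1) r * incl q u r h) =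
      asc q u (r + 1) r * incl q u r (φ h)) (a : Lam (m + 1) (r + 1))
    (hu : IsUnit (φ (vElt q u a.pred))) : IsUnit (ψ (vElt q u a)) := by
  -- the smallest nonzero entry of `a`
  have hex : ∃ i, a.seq i ≠ 0 := ⟨m + 1, by rw [a.top _ le_rfl]; omega⟩
  have hi := Nat.find_spec hex
  have hmin : ∀ j, a.seq j ≠ 0 → a.seq (Nat.find hex) ≤ a.seq j :=
    fun j hj => a.mono (Nat.find_min' hex hj)
  generalize Nat.find hex = i at hi hmin
  have hA := a.le_top i
  obtain ⟨w, hw, hw1, hw2⟩ := exists_incl_T (q := q) (u := u) a.pred.perm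
  obtain ⟨w', hs, hs1, hs2, hs3⟩ := exists_seg_mul_T (q := q) (u := u) hw2
    (n := r + 1 - a.seq i) (by omega)
  have hsub : r - (r + 1 - a.seq i) = a.seq i - 1 := by omega
  rw [hsub] at hs1 hs2 hs3
  have hrev := pred_reverses_step a (by omega) hmin hw1 hs1 hs2 hs3
  obtain ⟨y, hy, hyu, hy'⟩ := exists_T_eq_mul_T_perm q u hrev
  -- the value at the leading term of `w'`
  have e1 : ψ (lead q u a w') = y * ψ (vElt q u a) := by
    have hc := young_commute_stairPoly q u hy u (J := Finset.univ) (n := fun i => a.seq i)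
      fun j _ => ⟨j, rfl⟩
    rw [hψ.apply_lead, hy', ← mul_assoc, ← hc.eq, ← hψ.young_mul hy, vElt_eq]
    simp only [mul_assoc]
  set P := jmPoly q u (r + 1) (∏ i, lam R (leftWeight a i + 1)) with hP
  set E := jmPoly q u (r + 1) (∏ i, lam R (rightWeight a i)) with hE
  -- Modulo terms killed by `apply_lastSpan`, the segment of inverses is a power of q⁻¹ times the
  -- segment of generators, whose product with T_w is T_{w'}.
  have e2 : ψ (P * (segInv q u r (r + 1 - a.seq i) * T q u w) * E) =
      ((q⁻¹ : Rˣ) : R) ^ (r + 1 - a.seq i) • (y * ψ (vElt q u a)) := by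
    have h2 := segInv_sub_mem_lastSpan (q := q) (u := u) (r := r) (n := r + 1 - a.seq i) (by omega)
    have h3 := mul_incl_T_mem_lastSpan a.pred.perm h2
    rw [hw, sub_mul, smul_mul_assoc, hs, show r + 1 - (r + 1 - a.seq i) = a.seq i by omega] at h3
    have h4 := apply_lastSpan hψ a hi h3
    rw [← hP, ← hE, mul_sub, sub_mul, map_sub, sub_eq_zero, mul_smul_comm, smul_mul_assoc, map_smul,
      lead_eq, e1] at h4
    exact h4
  have e3 : ψ (P * ascGenInv q u (r + 1) r * T q u w * E) =
      ascGenInv q u (r + 1) (a.seq i - 1) *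
        (((q⁻¹ : Rˣ) : R) ^ (r + 1 - a.seq i) • (y * ψ (vElt q u a))) := by
    have hc : Commute (ascGenInv q u (r + 1) (a.seq i - 1)) P := by
      refine commute_ascGenInv q u (r + 1) fun k hk1 hk2 => ?_
      -- All exponents in P are r + 1 or nonzero entries of a, hence at least the minimal entry; the
      -- generators of smaller index commute with P.
      have hne : ∀ j : Fin m, k ≠ leftWeight a j + 1 := by
        intro j
        rw [leftWeight]
        split_ifs with h
        · omega
        · have := hmin _ h
          omega
      exact gen_commute_prod_lam _ _ hk1 fun j _ => hne j
    rw [← e2, ← hψ.ascGenInv_mul (by omega), ← hsub,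
      ← ascGenInv_mul_segInv q u r (n := r + 1 - a.seq i) (by omega), hsub, ← mul_assoc P, ← hc.eq]
    simp only [mul_assoc]
  have e4 : ψ (gen q u (r + 1) 0 ^ m * ascGenInv q u (r + 1) r * incl q u r (vElt q u a.pred)) =
      ψ (P * ascGenInv q u (r + 1) r * T q u w * E) := by
    have key : ∀ {x y}, x - y ∈ fil q u (r + 1) ((r + 1) * m) → ψ x = ψ y :=
      fun h => hψ.eq_of_sub_mem (by rwa [Nat.add_sub_cancel])
    have h2 : incl q u r (vElt q u a.pred) - incl q u r (lead q u a.pred a.pred.perm) ∈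
        fil q u (r + 1) (r * m) := by
      rw [← map_sub, vElt_eq]
      exact incl_mem_fil (stair_sub_lead_mem _ _)
    have h3 := mul_mem_fil (mul_mem_fil_of_one' (gen_zero_pow_mem_fil_succ (q := q) (u := u)
      (r := r + 1) m) (ascGenInv_mem_fil q u (r + 1) r)) h2
    rw [mul_sub] at h3
    rw [← show m + r * m = (r + 1) * m by ring] at key
    rw [key h3, incl_lead_pred a hw]
    obtain ⟨f, hf, e⟩ := pow_mul_ascGenInv_mul_prod_lam q u (r + 1) Finset.univ (leftWeight a)
      (k := r) (fun j _ => by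
        have := a.le_top (j + 1)
        rw [leftWeight]
        split_ifs <;> omega) (by omega)
    rw [Finset.card_univ, Fintype.card_fin] at e
    refine key ?_
    rw [← mul_assoc, ← mul_assoc, e, ← hE, ← hP, add_mul, add_mul, add_sub_cancel_left,
      show m + r * m = (r + 1) * m by ring, ← sum_weights a]
    -- There are m + 1 parameters, so T_0^{m+1} has degree at most m, and the error term falls below
    -- top degree.
    refine mul_mem_fil' (mul_mem_fil_of_one' (mul_mem_fil
      (gen_zero_pow_mem_fil (by omega)) hf) (T_mem_fil w)) ?_
    exact jmPoly_prod_mem_fil _ _ _ fun j _ => jm_mem_fil_prod q u (r + 1) _ _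
  rw [e3, apply_pow_mul_ascGenInv_mul hψ h0 h1] at e4
  have h2 : IsUnit (((q⁻¹ : Rˣ) : R) ^ r • (asc q u (r + 1) r * incl q u r (φ (vElt q u a.pred)))) :=
    (isUnit_pow_smul_iff q r _).mpr ((isUnit_asc q u (r + 1) (by omega)).mul (hu.map _))
  rw [e4] at h2
  exact isUnit_of_isUnit_mul_left hyu ((isUnit_pow_smul_iff q _ _).mp
    (isUnit_of_isUnit_mul_left (isUnit_ascGenInv q u (r + 1) (by omega)) h2))

end UnitStep
end ArikiKoike

namespace ArikiKoike

/-! ### Faithfulness of the Young subalgebra on v_a -/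

section Faithful

variable {R : Type*} [CommRing R]

theorem exists_topFunctional [Nontrivial R] {m : ℕ} (hm : 1 ≤ m) (q : Rˣ) (u : Fin (m + 1) → R)
    (r : ℕ) : ∃ φ : AK (m + 1) r q u →ₗ[R] AK (m + 1) r q u, IsTopFunctional φ ∧
      ∀ a : Lam (m + 1) r, IsUnit (φ (vElt q u a)) := by
  induction r with
  | zero =>
    -- For r = 0 the identity works: step 0 of the filtration is zero and v_a = 1.
    refine ⟨LinearMap.id, ⟨fun i _ h => absurd h (Nat.not_lt_zero i), fun h hh => ?_⟩, fun a => ?_⟩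
    · rw [Nat.zero_mul, fil, Submodule.span_eq_bot.mpr] at hh
      · exact hh
      · rintro _ ⟨l, hl, -⟩
        exact absurd hl (Nat.not_lt_zero _)
    · have h0 : ∀ i, a.seq i = 0 := fun i => Nat.le_zero.mp (a.le_top i)
      rw [LinearMap.id_apply, vElt_eq, Subsingleton.elim a.perm 1, T_one]
      simp [stairPoly, h0]
  | succ r ih =>
    obtain ⟨φ, hφ, hu⟩ := ih
    obtain ⟨ψ, h1, h2, h3, h4⟩ := exists_extension (show 2 ≤ m + 1 by omega) hφ.gen_mul hφ.eq_zero
    exact ⟨ψ, ⟨h1, h2⟩, fun a => isUnit_apply_vElt ⟨h1, h2⟩ h3 h4 a (hu _)⟩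

variable {m r : ℕ} {q : Rˣ} {u : Fin m → R}

theorem eq_zero_of_mul_vElt_eq_zero (hm : 0 < m) {a : Lam m r} {y : AK m r q u}
    (hy : y ∈ young q u a) (h : y * vElt q u a = 0) : y = 0 := by
  rcases subsingleton_or_nontrivial R with hR | hR
  · exact (Module.subsingleton R (AK m r q u)).elim _ _
  obtain ⟨m, rfl⟩ : ∃ k, m = k + 1 := ⟨m - 1, by omega⟩
  rcases Nat.eq_zero_or_pos m with rfl | h1
  -- One parameter: the construction needs at least two, but here there is a single block, all
  -- exponents vanish and v_a = 1.
  · have hp : a.perm = 1 := by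
      refine eq_one_of_strictMono fun p p' hpp => ?_
      have hb : ∀ p, a.block p = 1 := fun p =>
        le_antisymm (a.block_le p) (a.block_spec p).1
      rw [Fin.lt_def, Lam.perm_val, Lam.perm_val, hb, hb, Nat.sub_self, a.zero]
      have : p.val < p'.val := hpp
      omega
    have hv : vElt q u a = 1 := by
      rw [vElt_eq, hp, T_one]
      simp [stairPoly, a.zero, a.top 1 le_rfl]
    rwa [hv, mul_one] at h
  · obtain ⟨φ, hφ, hu⟩ := exists_topFunctional h1 q u r
    have h2 := hφ.young_mul hy (vElt q u a)
    rw [h, map_zero] at h2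
    exact (hu a).mul_left_eq_zero.mp h2.symm

end Faithful

end ArikiKoike

/-! ### Corners at idempotents commuting with a subalgebra -/

section Corner

variable {R A : Type*} [CommRing R] [Ring A] [Algebra R A]

theorem isIdempotentElem_sum {ι : Type*} [Fintype ι] {e : ι → A}
    (he : ∀ i, IsIdempotentElem (e i)) (horth : ∀ i j, i ≠ j → e i * e j = 0) :
    IsIdempotentElem (∑ i, e i) := by
  classical
  rw [IsIdempotentElem, Finset.sum_mul]
  refine Finset.sum_congr rfl fun i _ => ?_
  rw [Finset.mul_sum, Finset.sum_eq_single i (fun j _ hj => horth i j hj.symm)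
    (fun h => absurd (Finset.mem_univ i) h), (he i).eq]

/-- If `B` commutes with the idempotent `e`, acts faithfully on it and `e A e = B e`, then
`e A e ≅ B`. -/
theorem nonempty_corner_algEquiv {e : A} (he : IsIdempotentElem e) (B : Subalgebra R A)
    (hcomm : ∀ y ∈ B, Commute y e) (hinj : ∀ y ∈ B, y * e = 0 → y = 0)
    (hsurj : ∀ h, ∃ y ∈ B, e * h * e = y * e) : Nonempty (he.Corner ≃ₐ[R] B) := by
  let f : B →ₐ[R] he.Corner := AlgHom.ofLinearMap
    { toFun := fun y => ⟨y.1 * e, y.1, by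
        show e * y.1 * e = y.1 * e
        rw [← (hcomm y.1 y.2).eq, mul_assoc, he.eq]⟩
      map_add' := fun y y' => Subtype.ext (add_mul y.1 y'.1 e)
      map_smul' := fun c y => Subtype.ext (smul_mul_assoc c y.1 e) }
    (Subtype.ext (one_mul e))
    (fun y y' => Subtype.ext (show y.1 * y'.1 * e = y.1 * e * (y'.1 * e) by
      rw [mul_assoc y.1 e, ← mul_assoc e, ← (hcomm y'.1 y'.2).eq, mul_assoc y'.1, he.eq,
        mul_assoc]))
  have hf : ∀ y, (f y).1 = y.1 * e := fun _ => rfl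
  refine ⟨(AlgEquiv.ofBijective f ⟨?_, ?_⟩).symm⟩
  · refine (injective_iff_map_eq_zero f).mpr fun y hy => Subtype.ext (hinj y.1 y.2 ?_)
    rw [← hf, hy]
    rfl
  · rintro ⟨_, h, rfl⟩
    obtain ⟨y, hy, hh⟩ := hsurj h
    exact ⟨⟨y, hy⟩, Subtype.ext hh.symm⟩

/-- The analogous statement for a sum of orthogonal idempotents. -/
theorem nonempty_corner_sum_algEquiv {ι : Type*} [Fintype ι] {e : ι → A}
    (he : ∀ i, IsIdempotentElem (e i)) (horth : ∀ i j, i ≠ j → ∀ h, e i * h * e j = 0)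
    (hsum : IsIdempotentElem (∑ i, e i)) (B : ι → Subalgebra R A)
    (hcomm : ∀ i, ∀ y ∈ B i, Commute y (e i)) (hinj : ∀ i, ∀ y ∈ B i, y * e i = 0 → y = 0)
    (hsurj : ∀ i h, ∃ y ∈ B i, e i * h * e i = y * e i) :
    Nonempty (hsum.Corner ≃ₐ[R] (∀ i, B i)) := by
  classical
  -- By orthogonality only the summand of index j survives multiplication by x e_j; every later
  -- identity is an instance.
  have hmul : ∀ (y : ∀ i, B i) (x : A) (j : ι),
      (∑ i, (y i).1 * e i) * (x * e j) = (y j).1 * e j * (x * e j) := by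
    intro y x j
    rw [Finset.sum_mul, Finset.sum_eq_single j _ (fun h => absurd (Finset.mem_univ j) h)]
    intro i _ hij
    rw [mul_assoc, ← mul_assoc (e i), horth i j hij, mul_zero]
  have he1 : ∀ (y : ∀ i, B i) j, (∑ i, (y i).1 * e i) * e j = (y j).1 * e j := by
    intro y j
    have := hmul y 1 j
    rwa [one_mul, mul_assoc, (he j).eq] at this
  have hsum1 : ∀ (y : ∀ i, B i), (∑ i, (y i).1 * e i) * ∑ i, e i = ∑ i, (y i).1 * e i := by
    intro y
    rw [Finset.mul_sum]
    exact Finset.sum_congr rfl fun j _ => he1 y j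
  have hsum2 : ∀ (y : ∀ i, B i), (∑ i, e i) * ∑ i, (y i).1 * e i = ∑ i, (y i).1 * e i := by
    intro y
    rw [Finset.mul_sum]
    refine Finset.sum_congr rfl fun j _ => ?_
    have := hmul (fun i => 1) (y j).1 j
    simp only [OneMemClass.coe_one, one_mul] at this
    rw [this, ← mul_assoc, ← (hcomm j _ (y j).2).eq, mul_assoc, (he j).eq]
  let f : (∀ i, B i) →ₐ[R] hsum.Corner := AlgHom.ofLinearMap
    { toFun := fun y => ⟨∑ i, (y i).1 * e i, ∑ i, (y i).1 * e i, by
        show (∑ i, e i) * (∑ i, (y i).1 * e i) * ∑ i, e i = _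
        rw [hsum2, hsum1]⟩
      map_add' := fun y y' => Subtype.ext (by
        show ∑ i, ((y i).1 + (y' i).1) * e i = ∑ i, (y i).1 * e i + ∑ i, (y' i).1 * e i
        rw [← Finset.sum_add_distrib]
        exact Finset.sum_congr rfl fun i _ => add_mul _ _ _)
      map_smul' := fun c y => Subtype.ext (by
        show ∑ i, (c • (y i).1) * e i = c • ∑ i, (y i).1 * e i
        rw [Finset.smul_sum]
        exact Finset.sum_congr rfl fun i _ => smul_mul_assoc _ _ _) }
    (Subtype.ext (Finset.sum_congr rfl fun i _ => one_mul _))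
    (fun y y' => Subtype.ext (by
      show ∑ i, ((y i).1 * (y' i).1) * e i = (∑ i, (y i).1 * e i) * ∑ i, (y' i).1 * e i
      rw [Finset.mul_sum]
      refine Finset.sum_congr rfl fun j _ => ?_
      rw [hmul, mul_assoc (y j).1 (e j), ← mul_assoc (e j), ← (hcomm j _ (y' j).2).eq,
        mul_assoc (y' j).1, (he j).eq, mul_assoc]))
  have hf : ∀ y, (f y).1 = ∑ i, (y i).1 * e i := fun _ => rfl
  refine ⟨(AlgEquiv.ofBijective f ⟨?_, ?_⟩).symm⟩
  · refine (injective_iff_map_eq_zero f).mpr fun y hy => funext fun j =>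
      Subtype.ext (hinj j _ (y j).2 ?_)
    rw [← he1, ← hf, hy]
    exact zero_mul _
  · rintro ⟨_, h, rfl⟩
    choose y hy hh using fun i => hsurj i h
    refine ⟨fun i => ⟨y i, hy i⟩, Subtype.ext ?_⟩
    show ∑ i, y i * e i = (∑ i, e i) * h * ∑ i, e i
    rw [Finset.sum_mul, Finset.sum_mul]
    refine Finset.sum_congr rfl fun i _ => ?_
    rw [Finset.mul_sum, Finset.sum_eq_single i (fun j _ hj => horth i j hj.symm h)
      (fun h => absurd (Finset.mem_univ i) h), hh]

end Corner

/-! ### The elements z_a and the idempotents e_a -/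

namespace ArikiKoike

variable {R : Type*} [CommRing R] {m r : ℕ} {q : Rˣ} {u : Fin m → R}

theorem existsUnique_isZ (hm : 0 < m) (a : Lam m r) : ∃! z, IsZ q u a z := by
  obtain ⟨z, hz, e⟩ := (mem_youngMul q u).mp (vElt_mul_mul_vElt_mem q u a (T q u a.dual.perm))
  refine ⟨z, ⟨hz, e.symm⟩, fun z' hz' => ?_⟩
  refine sub_eq_zero.mp (eq_zero_of_mul_vElt_eq_zero hm (sub_mem hz'.1 hz) ?_)
  rw [sub_mul, ← hz'.2, e, sub_self]

theorem isZ_zElt (hm : 0 < m) (a : Lam m r) : IsZ q u a (zElt q u a) :=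
  Classical.epsilon_spec (existsUnique_isZ hm a).exists

theorem eq_zero_of_mul_vElt_mul_T_eq_zero (hm : 0 < m) {a : Lam m r} {y : AK m r q u}
    (hy : y ∈ young q u a) (h : y * (vElt q u a * T q u a.dual.perm) = 0) : y = 0 := by
  rw [← mul_assoc] at h
  exact eq_zero_of_mul_vElt_eq_zero hm hy
    ((isUnit_T q u a.dual.perm).mul_left_eq_zero.mp h)

theorem eElt_mul_mul_eElt_of_ne {a b : Lam m r} (h : a ≠ b) (x : AK m r q u) :
    eElt q u a * x * eElt q u b = 0 := by
  have := vElt_mul_mul_vElt_of_ne q u h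
    (T q u a.dual.perm * Ring.inverse (zElt q u a) * x)
  rw [eElt, eElt]
  simp only [← mul_assoc] at this ⊢
  rw [this, zero_mul, zero_mul]

theorem vElt_mul_T_mul_self (hm : 0 < m) (a : Lam m r) :
    vElt q u a * T q u a.dual.perm * (vElt q u a * T q u a.dual.perm) =
      zElt q u a * (vElt q u a * T q u a.dual.perm) := by
  rw [← mul_assoc, (isZ_zElt hm a).2, mul_assoc]

/-- With f = v_a T_{w_{a'}} one has z_a f = f² and y f = f y, so z_a y f = f² y = y f² = y z_a f;
faithfulness on f removes f. -/
theorem zElt_commute_young (hm : 0 < m) {a : Lam m r} {y : AK m r q u} (hy : y ∈ young q u a) :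
    Commute (zElt q u a) y := by
  have hz := (isZ_zElt (q := q) (u := u) hm a).1
  have hf := vElt_mul_T_mul_self (q := q) (u := u) hm a
  have hc := young_commute_vElt_mul_T q u hy
  refine sub_eq_zero.mp (eq_zero_of_mul_vElt_mul_T_eq_zero hm
    (sub_mem (mul_mem hz hy) (mul_mem hy hz)) ?_)
  generalize vElt q u a * T q u a.dual.perm = f at hf hc ⊢
  rw [sub_mul, mul_assoc, hc.eq, ← mul_assoc, ← hf, mul_assoc, ← hc.eq, ← mul_assoc, ← hc.eq,
    mul_assoc y, hf, ← mul_assoc, sub_self]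

section Idempotent

variable {a : Lam m r}

theorem inverse_zElt_commute (hz : IsUnit (zElt q u a)) {x : AK m r q u}
    (h : Commute (zElt q u a) x) : Commute (Ring.inverse (zElt q u a)) x := by
  obtain ⟨z, hz'⟩ := hz
  rw [← hz', Ring.inverse_unit]
  rw [← hz'] at h
  exact h.units_inv_left

theorem inverse_zElt_commute_vElt_mul_T (hm : 0 < m) (hz : IsUnit (zElt q u a)) :
    Commute (Ring.inverse (zElt q u a)) (vElt q u a * T q u a.dual.perm) :=
  inverse_zElt_commute hz (young_commute_vElt_mul_T q u (isZ_zElt hm a).1)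

theorem young_commute_eElt (hm : 0 < m) (hz : IsUnit (zElt q u a)) {y : AK m r q u}
    (hy : y ∈ young q u a) : Commute y (eElt q u a) :=
  (young_commute_vElt_mul_T q u hy).mul_right
    (inverse_zElt_commute hz (zElt_commute_young hm hy)).symm

theorem isIdempotentElem_eElt (hm : 0 < m) (hz : IsUnit (zElt q u a)) :
    IsIdempotentElem (eElt q u a) := by
  have hc := inverse_zElt_commute_vElt_mul_T hm hz
  have hf := vElt_mul_T_mul_self (q := q) (u := u) hm a
  have h1 := Ring.inverse_mul_cancel _ hz
  rw [IsIdempotentElem, eElt]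
  generalize vElt q u a * T q u a.dual.perm = f at *
  generalize Ring.inverse (zElt q u a) = y at *
  rw [← hc.eq, mul_assoc, ← mul_assoc f, ← hc.eq, mul_assoc y f f, hf, ← mul_assoc y (zElt q u a), h1,
    one_mul]

theorem eElt_eq (hm : 0 < m) (hz : IsUnit (zElt q u a)) : zElt q u a * eElt q u a =
    vElt q u a * T q u a.dual.perm := by
  have hc := inverse_zElt_commute_vElt_mul_T hm hz
  rw [eElt, ← hc.eq, ← mul_assoc, Ring.mul_inverse_cancel _ hz, one_mul]

theorem eq_zero_of_mul_eElt_eq_zero (hm : 0 < m) (hz : IsUnit (zElt q u a)) {y : AK m r q u}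
    (hy : y ∈ young q u a) (h : y * eElt q u a = 0) : y = 0 := by
  refine eq_zero_of_mul_vElt_mul_T_eq_zero hm hy ?_
  rw [← eElt_eq hm hz, ← mul_assoc, ← (zElt_commute_young hm hy).eq, mul_assoc, h, mul_zero]

theorem exists_eElt_mul_mul_eElt (a : Lam m r) (h : AK m r q u) :
    ∃ y ∈ young q u a, eElt q u a * h * eElt q u a = y * eElt q u a := by
  obtain ⟨y, hy, e⟩ := (mem_youngMul q u).mp (vElt_mul_mul_vElt_mem q u a
    (T q u a.dual.perm * Ring.inverse (zElt q u a) * h))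
  refine ⟨y, hy, ?_⟩
  rw [eElt, ← mul_assoc y, ← mul_assoc y, e]
  simp only [mul_assoc]

end Idempotent
end ArikiKoike

theorem mainTheorem8 {R : Type*} [CommRing R] (m r : ℕ) (hm : 0 < m) (q : Rˣ) (u : Fin m → R) :
    (∀ a : ArikiKoike.Lam m r, ∃! z, ArikiKoike.IsZ q u a z) ∧
    (∀ a b : ArikiKoike.Lam m r,
      IsUnit (ArikiKoike.zElt q u a) → IsUnit (ArikiKoike.zElt q u b) → a ≠ b →
        ∀ h : ArikiKoike.AK m r q u,
          ArikiKoike.eElt q u a * h * ArikiKoike.eElt q u b = 0) ∧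
    (∀ a : ArikiKoike.Lam m r, IsUnit (ArikiKoike.zElt q u a) →
      ∃ idem : IsIdempotentElem (ArikiKoike.eElt q u a),
        Nonempty (idem.Corner ≃ₐ[R] ArikiKoike.young q u a)) ∧
    ((∀ a : ArikiKoike.Lam m r, IsUnit (ArikiKoike.zElt q u a)) →
      ∃ idem : IsIdempotentElem (∑ a : ArikiKoike.Lam m r, ArikiKoike.eElt q u a),
        Nonempty (idem.Corner ≃ₐ[R] (∀ a : ArikiKoike.Lam m r, ArikiKoike.young q u a))) := by
  refine ⟨fun a => ArikiKoike.existsUnique_isZ hm a,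
    fun a b _ _ hab h => ArikiKoike.eElt_mul_mul_eElt_of_ne hab h, fun a hz => ?_, fun hz => ?_⟩
  · exact ⟨ArikiKoike.isIdempotentElem_eElt hm hz, nonempty_corner_algEquiv _ _
      (fun y hy => ArikiKoike.young_commute_eElt hm hz hy)
      (fun y hy => ArikiKoike.eq_zero_of_mul_eElt_eq_zero hm hz hy)
      (ArikiKoike.exists_eElt_mul_mul_eElt a)⟩
  · have he := fun a => ArikiKoike.isIdempotentElem_eElt hm (hz a)
    have horth : ∀ a b : ArikiKoike.Lam m r, a ≠ b → ∀ h : ArikiKoike.AK m r q u,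
        ArikiKoike.eElt q u a * h * ArikiKoike.eElt q u b = 0 :=
      fun a b hab h => ArikiKoike.eElt_mul_mul_eElt_of_ne hab h
    exact ⟨isIdempotentElem_sum he fun a b hab => by
        have := horth a b hab 1
        rwa [mul_one] at this,
      nonempty_corner_sum_algEquiv he horth _ _
        (fun a y hy => ArikiKoike.young_commute_eElt hm (hz a) hy)
        (fun a y hy => ArikiKoike.eq_zero_of_mul_eElt_eq_zero hm (hz a) hy)
        ArikiKoike.exists_eElt_mul_mul_eElt⟩
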